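/- **Definitions.** Let $k$ be a field. Operads are graded, with differentials of degree $1$; in $V[m]$ one has $V[m]^i=V^{i+m}$. Let $\mathcal P=Free(\mathcal E)/\langle R\rangle$ be the operad of pre-Lie$^{\mathfrak 2}$ algebras: $\mathcal E(2)=k[\mathbb S_2][0]\oplus \mathbf 1_2[-1]$ is spanned by a binary operation $\circ$ of degree $0$ (with its transpose) and a commutative binary operation $\bullet$ of degree $1$, and $R$ is spanned, for all permutations $(i_1,i_2,i_3)$ of $(1,2,3)$, by $$(i_1\circ i_2)\circ i_3-(i_1\circ i_3)\circ i_2-i_1\circ(i_2\circ i_3)+i_1\circ(i_3\circ i_2),\qquad (1\bullet 2)\bullet 3+(3\bullet 1)\bullet 2+(2\bullet 3)\bullet 1,$$ $$(i_1\bullet i_2)\circ i_3+i_1\circ(i_2\bullet i_3)+i_2\circ(i_1\bullet i_3)-i_1\bullet(i_2\circ i_3)-i_2\bullet(i_1\circ i_3).$$ Let $\mathcal P^!=Free(\mathcal E(2)^*\otimes sgn_2)/\langle R^\perp\rangle$ be its Koszul dual, and let $\mathcal P_\infty=\mathbf D\mathcal P^!$ be the cobar construction, i.e. the free operad on the $\mathbb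 S$-module $\{\mathcal P^!(n)^*\otimes sgn_n[n-2]\}_{n\ge2}$ with the cobar differential $d$, the degree $1$ derivation which on generators is the dual of the operadic compositions of $\mathcal P^!$. In a tree with two vertices the lower vertex is written before the upper one. A generator of arity $n$ is read as $\lambda_n\otimes f$ with $f\in\mathcal P^!(n)^*$ and $\lambda_n$ spanning $sgn_n[n-2]$. If $f\mapsto\sum\varphi\otimes\psi$ is dual to the composition $\mathcal P^!(A^c\sqcup *)\otimes\mathcal P^!(A)\to\mathcal P^!(n)$, the term $\varphi\circ_A\psi$ occurs in $d f$ with the sign of the unshuffle $(1,\ldots,n)\to(A,A^c)$ times $(-1)^{\#A(|\varphi|+1)}$, where $|\varphi|$ is the degree of the generator $\varphi$ of $\mathcal P_\infty$ and the sum is over all $A\subset\{1,\ldots,n\}$ with $2\le \#A\le n-1$. **Proposition.** The derivation $d$ of $\mathcal P_\infty$ exists, and the generators of $\mathcal P_\infty$ can be identified with corollas as follows. For $n\ge2$ the $\mathbb S_n$-module of generators of arity $n$ is $$\mathcal P^!(n)^*\otimes sgn_n[n-2]\;\cong\;\bigoplus_{p=0}^{n-1}\mathrm{Ind}^{\mathbb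 S_n}_{\mathbb S_{n-p}\times\mathbb S_p}\mathbf 1_{n-p}\otimes sgn_p[p-1].$$ The $p$-th summand lies in degree $1-p$ and has as basis the $\binom np$ corollas $C(I;J)$ with $I\sqcup J=\{1,\dots,n\}$, $\#J=p$, symmetric in the "solid" inputs $I$ and antisymmetric in the "wavy" inputs $J$. For $n=2$ the corollas $C(1,2;\,)$ and $C(1;2)$ are the elements $1\bullet2$ and $1\circ2$ of $\mathcal E(2)=\mathcal P^!(2)^*\otimes sgn_2$. With inputs from a set listed in increasing order, for all $n\ge2$ and $0\le p\le n-1$, $$d\,C(1,\ldots,n-p;\,n-p+1,\ldots,n)=\sum_{\substack{I_1\sqcup I_2=\{1,\ldots,n-p\}\\ J_1\sqcup J_2=\{n-p+1,\ldots,n\}\\ \#I_2\ge1,\ \#I_1+\#J_2\ge1,\ \#I_2+\#J_1\ge2}}(-1)^{\#J_2+\sigma(J_1\sqcup J_2)}\;C\bigl(I_1,\,C(I_2;J_1);\;J_2\bigr)$$ $$\qquad-\sum_{\substack{I_1\sqcup I_2=\{1,\ldots,n-p\}\\ J_1\sqcup J_2\sqcup J_3=\{n-p+1,\ldots,n\}\\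 \#I_1\ge1,\ \#J_1=1,\ \#I_2+\#J_2\ge1}}(-1)^{\#J_2+\#J_3+\sigma(J_1\sqcup J_2\sqcup J_3)}\;C\bigl(I_1;\;C(I_2,J_1;J_2),\,J_3\bigr).$$ Here $C(\ldots C(\ldots)\ldots)$ is the tree with two vertices in which the upper corolla is attached to a solid input of the lower corolla in the first sum, and to its first wavy input in the second sum; $\sigma(J_1\sqcup J_2)$ and $\sigma(J_1\sqcup J_2\sqcup J_3)$ are the parities of the permutations $(n-p+1,\ldots,n)\to(J_1\sqcup J_2)$ and $(n-p+1,\ldots,n)\to(J_1\sqcup J_2\sqcup J_3)$. -/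

import Mathlib

universe u

open Finset

noncomputable section

namespace PreLieTwo

/-! ### Signs -/

/-- The sign `(-1)^z`, as an element of `k`. -/
def sg (k : Type u) [Field k] (z : ℤ) : k := (((z.negOnePow : ℤˣ) : ℤ) : k)

/-- Exponent of the Koszul sign for reordering factors of degrees `d 0, …, d (n-1)` into the order
`σ 0, σ 1, …, σ (n-1)`. -/
def koszulExp {n : ℕ} (d : Fin n → ℤ) (σ : Equiv.Perm (Fin n)) : ℤ :=
  ∑ i, ∑ j, if i < j ∧ σ j < σ i then d (σ i) * d (σ j) else 0

/-- Exponent of the Koszul sign for reordering factors of degrees `d 0, …, d (n-1)` into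
"first those in `A`, increasingly, then the others, increasingly".
For `d = 1` it is the parity of that unshuffle permutation. -/
def unshuffleExp {n : ℕ} (d : Fin n → ℤ) (A : Finset (Fin n)) : ℤ :=
  ∑ i ∈ A, ∑ j ∈ Aᶜ, if j < i then d i * d j else 0

/-- Number of inversions of a list of distinct numbers; its parity is the parity of the
permutation that sorts the list. -/
def inversions {n : ℕ} : List (Fin n) → ℕ
  | [] => 0
  | a :: l => l.countP (fun b => decide (b < a)) + inversions l

/-! ### Graded S-modules and decorated trees -/

/-- A graded `𝕊`-module: `X n d` is the degree `d` part in arity `n`. The action is written as a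
left action: `σ • e` is `e` with its input `i` renamed `σ i`. -/
structure GrSMod (k : Type u) [Field k] where
  X : ℕ → ℤ → Type u
  [acg : ∀ n d, AddCommGroup (X n d)]
  [mod : ∀ n d, Module k (X n d)]
  act : ∀ n d, Representation k (Equiv.Perm (Fin n)) (X n d)

attribute [instance] GrSMod.acg GrSMod.mod

/-- Dual representation, twisted by the sign representation. -/
def signDual {k : Type u} [Field k] {n : ℕ} {V : Type u} [AddCommGroup V] [Module k V]
    (ρ : Representation k (Equiv.Perm (Fin n)) V) :
    Representation k (Equiv.Perm (Fin n)) (Module.Dual k V) where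
  toFun σ := (((Equiv.Perm.sign σ : ℤˣ) : ℤ) : k) • ρ.dual σ
  map_one' := by
    rw [map_one, map_one]
    simp
  map_mul' σ τ := by
    rw [map_mul, map_mul, smul_mul_smul_comm]
    simp

/-- Planar trees with leaves labelled by `L`, whose vertices with `n` ordered inputs are decorated
by homogeneous elements of `M` of arity `n`. The vertices of a planar tree are ordered by reading
it from the root, each vertex before its subtrees and the subtrees from left to right; a tree
stands for the tensor product of its decorations in that order. -/
inductive Tree {k : Type u} [Field k] (M : GrSMod k) (L : Type) : Type u
  | leaf : L → Tree M L
  | node (n : ℕ) (d : ℤ) (e : M.X n d) (ch : Fin n → Tree M L) : Tree M L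

namespace Tree

variable {k : Type u} [Field k] {M : GrSMod k} {L L' : Type}

/-- Total degree of the decorations. -/
def deg : Tree M L → ℤ
  | leaf _ => 0
  | node _ d _ ch => d + ∑ i, (ch i).deg

/-- Number of leaves with label `l`. -/
def count [DecidableEq L] (l : L) : Tree M L → ℕ
  | leaf l' => if l' = l then 1 else 0
  | node _ _ _ ch => ∑ i, (ch i).count l

/-- Each label occurs on exactly one leaf. -/
def Multilinear [DecidableEq L] (T : Tree M L) : Prop := ∀ l, T.count l = 1

/-- Relabelling of the leaves. -/
def map (f : L → L') : Tree M L → Tree M L'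
  | leaf l => leaf (f l)
  | node n d e ch => node n d e (fun i => (ch i).map f)

/-- Gluing of trees at all the leaves. -/
def bind (f : L → Tree M L') : Tree M L → Tree M L'
  | leaf l => f l
  | node n d e ch => node n d e (fun i => (ch i).bind f)

/-- Total degree of the vertices that come after the leaf labelled `l`. -/
def degAfter [DecidableEq L] (l : L) : Tree M L → ℤ
  | leaf _ => 0
  | node n _ _ ch => ∑ i : Fin n, if (ch i).count l = 0 then 0 else
      (ch i).degAfter l + ∑ j : Fin n, if i < j then (ch j).deg else 0

theorem deg_map (f : L → L') (T : Tree M L) : (T.map f).deg = T.deg := by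
  induction T with
  | leaf l => rfl
  | node n d e ch ih => simp [map, deg, ih]

theorem map_map {L'' : Type} (g : L' → L'') (f : L → L') (T : Tree M L) :
    (T.map f).map g = T.map (g ∘ f) := by
  induction T with
  | leaf l => rfl
  | node n d e ch ih => simp [map, ih]

theorem map_id (T : Tree M L) : T.map id = T := by
  induction T with
  | leaf l => rfl
  | node n d e ch ih => simp [map, ih]

theorem count_map [DecidableEq L] [DecidableEq L'] (σ : L ≃ L') (T : Tree M L) (l : L') :
    (T.map σ).count l = T.count (σ.symm l) := by
  induction T with
  | leaf l' => simp [map, count, Equiv.eq_symm_apply]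
  | node n d e ch ih => simp [map, count, ih]

end Tree

/-! ### Operads given by generators and relators -/

section Presented

variable {k : Type u} [Field k] {M : GrSMod k} {L L' : Type}

/-- The relations between decorated trees: decorations are multilinear; renaming the inputs of a
vertex is the same as permuting the subtrees attached to it, with the Koszul sign; the given
relators `S` vanish; and all of this may happen above any vertex of a bigger tree. -/
inductive OpRel (S : Set (Tree M L →₀ k)) : (Tree M L →₀ k) → Prop
  | rel (x : Tree M L →₀ k) (hx : x ∈ S) : OpRel S x
  | add (n : ℕ) (d : ℤ) (e e' : M.X n d) (ch : Fin n → Tree M L) :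
      OpRel S (Finsupp.single (.node n d (e + e') ch) 1
        - Finsupp.single (.node n d e ch) 1 - Finsupp.single (.node n d e' ch) 1)
  | smul (n : ℕ) (d : ℤ) (a : k) (e : M.X n d) (ch : Fin n → Tree M L) :
      OpRel S (Finsupp.single (.node n d (a • e) ch) 1 - Finsupp.single (.node n d e ch) a)
  | perm (n : ℕ) (d : ℤ) (σ : Equiv.Perm (Fin n)) (e : M.X n d) (ch : Fin n → Tree M L) :
      OpRel S (Finsupp.single (.node n d (M.act n d σ e) ch) 1
        - Finsupp.single (.node n d e (ch ∘ σ)) (sg k (koszulExp (fun i => (ch i).deg) σ)))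
  | graft (n : ℕ) (d : ℤ) (e : M.X n d) (ch : Fin n → Tree M L) (i : Fin n)
      (x : Tree M L →₀ k) (hx : OpRel S x) :
      OpRel S (x.mapDomain (fun t => .node n d e (Function.update ch i t)))

/-- Linear combinations of decorated trees modulo the relations. -/
abbrev OpSpace (S : Set (Tree M L →₀ k)) : Type u :=
  (Tree M L →₀ k) ⧸ Submodule.span k {x | OpRel S x}

/-- The class of a decorated tree. -/
def cls (S : Set (Tree M L →₀ k)) (T : Tree M L) : OpSpace S :=
  Submodule.Quotient.mk (Finsupp.single T 1)

/-- The linear map that puts its argument in place of the `i`-th subtree above a root vertex. -/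
def graftAt (S : Set (Tree M L →₀ k)) (n : ℕ) (d : ℤ) (e : M.X n d) (ch : Fin n → Tree M L)
    (i : Fin n) : OpSpace S →ₗ[k] OpSpace S :=
  Submodule.mapQ _ _ (Finsupp.lmapDomain k k (fun t => .node n d e (Function.update ch i t))) (by
    rw [Submodule.span_le]
    intro x hx
    exact Submodule.subset_span (OpRel.graft n d e ch i x hx))

theorem OpRel.map {S : Set (Tree M L →₀ k)} {S' : Set (Tree M L' →₀ k)} (f : L → L')
    (h : ∀ x ∈ S, x.mapDomain (Tree.map f) ∈ S') {x : Tree M L →₀ k} (hx : OpRel S x) :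
    OpRel S' (x.mapDomain (Tree.map f)) := by
  have sub : ∀ a b : Tree M L →₀ k,
      (a - b).mapDomain (Tree.map f) = a.mapDomain (Tree.map f) - b.mapDomain (Tree.map f) :=
    fun a b => map_sub (Finsupp.lmapDomain k k (Tree.map (M := M) f)) a b
  induction hx with
  | rel x hx => exact .rel _ (h x hx)
  | add n d e e' ch =>
    simpa [sub, Finsupp.mapDomain_single, Tree.map] using
      OpRel.add (S := S') n d e e' (fun i => (ch i).map f)
  | smul n d a e ch =>
    simpa [sub, Finsupp.mapDomain_single, Tree.map] using
      OpRel.smul (S := S') n d a e (fun i => (ch i).map f)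
  | perm n d σ e ch =>
    have := OpRel.perm (S := S') n d σ e (fun i => (ch i).map f)
    simp only [Tree.deg_map] at this
    simpa [sub, Finsupp.mapDomain_single, Tree.map, Function.comp_def] using this
  | graft n d e ch i x hx ih =>
    have := OpRel.graft n d e (fun i => (ch i).map f) i _ ih
    rw [← Finsupp.mapDomain_comp] at this ⊢
    convert this using 2
    funext t
    simp only [Function.comp, Tree.map]
    congr 1
    funext j
    by_cases hj : j = i
    · subst hj; simp
    · simp [hj]

/-- Relabelling of the leaves, on classes. -/
def relabel (S : Set (Tree M L →₀ k)) (S' : Set (Tree M L' →₀ k)) (f : L → L')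
    (h : ∀ x ∈ S, x.mapDomain (Tree.map f) ∈ S') : OpSpace S →ₗ[k] OpSpace S' :=
  Submodule.mapQ _ _ (Finsupp.lmapDomain k k (Tree.map f)) (by
    rw [Submodule.span_le]
    intro x hx
    exact Submodule.subset_span (OpRel.map f h hx))

theorem relabel_cls (S : Set (Tree M L →₀ k)) (S' : Set (Tree M L' →₀ k)) (f : L → L')
    (h : ∀ x ∈ S, x.mapDomain (Tree.map f) ∈ S') (T : Tree M L) :
    relabel S S' f h (cls S T) = cls S' (T.map f) := by
  simp [relabel, cls, Finsupp.lmapDomain_apply, Finsupp.mapDomain_single]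

end Presented

/-! ### Quadratic operads and Koszul duality -/

section Quadratic

variable {k : Type u} [Field k]

/-- A decorated binary tree with leaves `0, 1, 2`: `(c, g, h)` is the tree whose root is decorated
by `g`, with first input the vertex decorated by `h` and second input the leaf `c`; the inputs of
`h` are the two other leaves in increasing order. These trees span the arity three part
`⨁_{c = 0, 1, 2} E(2) ⊗ E(2)` of the free operad on `E = E(2)`. -/
abbrev QuadTerm (E : GrSMod k) : Type u := Fin 3 × (Σ a : ℤ, E.X 2 a) × (Σ b : ℤ, E.X 2 b)

/-- The tree `(c, g, h)` with trees `t 0, t 1, t 2` glued to its leaves. -/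
def QuadTerm.tree {E : GrSMod k} {L : Type} (q : QuadTerm E) (t : Fin 3 → Tree E L) : Tree E L :=
  .node 2 q.2.1.1 q.2.1.2
    ![.node 2 q.2.2.1 q.2.2.2 ![t (q.1.succAbove 0), t (q.1.succAbove 1)], t q.1]

/-- Quadratic data: a graded `𝕊`-module of binary generators, and a set of quadratic relators,
given as linear combinations of decorated trees with two vertices. -/
structure QuadData (k : Type u) [Field k] where
  E : GrSMod k
  binary : ∀ n d, n ≠ 2 → Subsingleton (E.X n d)
  R : Set (QuadTerm E →₀ k)

/-- The relators of the quadratic operad, with trees glued to their three leaves; the sign is the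
Koszul sign of the order in which the glued trees occur. -/
def QuadData.relators (Q : QuadData k) (L : Type) : Set (Tree Q.E L →₀ k) :=
  {y | ∃ x ∈ Q.R, ∃ t : Fin 3 → Tree Q.E L, y = x.sum fun q α =>
    Finsupp.single (q.tree t) (α * sg k (unshuffleExp (fun i => (t i).deg) {q.1}ᶜ))}

theorem QuadData.relators_map (Q : QuadData k) {L L' : Type} (f : L → L') :
    ∀ x ∈ Q.relators L, x.mapDomain (Tree.map f) ∈ Q.relators L' := by
  rintro _ ⟨x, hx, t, rfl⟩
  refine ⟨x, hx, fun i => (t i).map f, ?_⟩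
  have hm : ∀ y : Tree Q.E L →₀ k, y.mapDomain (Tree.map f)
      = Finsupp.lmapDomain k k (Tree.map (M := Q.E) f) y := fun _ => rfl
  rw [hm, Finsupp.sum, Finsupp.sum, map_sum]
  refine Finset.sum_congr rfl fun q _ => ?_
  rw [Finsupp.lmapDomain_apply, Finsupp.mapDomain_single]
  simp only [Tree.deg_map]
  congr 1
  simp only [QuadTerm.tree, Tree.map]
  congr 1
  funext i
  fin_cases i
  · simp only [Fin.zero_eta, Matrix.cons_val_zero, Tree.map]
    congr 1
    funext j
    fin_cases j <;> rfl
  · rfl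

/-- All linear combinations of decorated trees with leaves labelled by `L` (repetitions allowed)
modulo the relations of the quadratic operad `Free(E) / (R)`. -/
abbrev QuadData.Space (Q : QuadData k) (L : Type) : Type u := OpSpace (Q.relators L)

/-- The degree `d` part in arity `n` of the quadratic operad `Free(E) / (R)` (without its unit, so
`0` for `n < 2`): each of the labels `0, …, n-1` occurs exactly once. -/
def QuadData.part (Q : QuadData k) (n : ℕ) (d : ℤ) : Submodule k (Q.Space (Fin n)) :=
  Submodule.span k
    {x | ∃ T : Tree Q.E (Fin n), 2 ≤ n ∧ T.Multilinear ∧ T.deg = d ∧ x = cls _ T}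

theorem QuadData.relabel_part (Q : QuadData k) (n : ℕ) (d : ℤ) (σ : Equiv.Perm (Fin n)) :
    ∀ x ∈ Q.part n d, relabel _ _ σ (Q.relators_map σ) x ∈ Q.part n d := by
  intro x hx
  have : Q.part n d ≤ (Q.part n d).comap (relabel _ _ σ (Q.relators_map σ)) := by
    rw [QuadData.part, Submodule.span_le]
    rintro _ ⟨T, hn, hT, hd, rfl⟩
    refine Submodule.subset_span ⟨T.map σ, hn, ?_, ?_, relabel_cls _ _ _ _ _⟩
    · intro l
      rw [Tree.count_map]
      exact hT _
    · rw [Tree.deg_map, hd]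
  exact this hx

theorem OpSpace.ext_cls {M : GrSMod k} {L : Type} {S : Set (Tree M L →₀ k)} {V : Type u}
    [AddCommGroup V] [Module k V] {f g : OpSpace S →ₗ[k] V} (h : ∀ T, f (cls S T) = g (cls S T)) :
    f = g := by
  apply Submodule.linearMap_qext
  ext T
  exact h T

/-- The action of the symmetric group by relabelling. -/
def QuadData.partRep (Q : QuadData k) (n : ℕ) (d : ℤ) :
    Representation k (Equiv.Perm (Fin n)) (Q.part n d) where
  toFun σ := (relabel _ _ σ (Q.relators_map σ)).restrict (Q.relabel_part n d σ)
  map_one' := by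
    have : relabel _ _ (1 : Equiv.Perm (Fin n)) (Q.relators_map _) = LinearMap.id :=
      OpSpace.ext_cls fun T => by
        rw [relabel_cls]
        exact congrArg _ (Tree.map_id T)
    ext x
    exact congrArg (fun F => F x.1) this
  map_mul' σ τ := by
    have : relabel _ _ (σ * τ : Equiv.Perm (Fin n)) (Q.relators_map _)
        = relabel _ _ σ (Q.relators_map σ) ∘ₗ relabel _ _ τ (Q.relators_map τ) :=
      OpSpace.ext_cls fun T => by
        rw [LinearMap.comp_apply, relabel_cls, relabel_cls, relabel_cls, Tree.map_map]
        rfl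
    ext x
    exact congrArg (fun F => F x.1) this

/-- The `𝕊`-module `E^* ⊗ sgn`. -/
abbrev GrSMod.signDual (E : GrSMod k) : GrSMod k where
  X n d := Module.Dual k (E.X n (-d))
  act n d := PreLieTwo.signDual (E.act n (-d))

/-- The pairing of `E^*` with `E`. -/
def pairGen {E : GrSMod k} (g : Σ a : ℤ, E.signDual.X 2 a) (e : Σ a : ℤ, E.X 2 a) : k :=
  if h : e.1 = -g.1 then g.2 (h ▸ e.2) else 0

/-- The pairing of the arity three parts of the free operads on `E^* ⊗ sgn_2` and `E`, which makes
the first one the dual of the second one, tensored with `sgn_3`. -/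
def pairQuad {E : GrSMod k} (x : QuadTerm E.signDual →₀ k) (r : QuadTerm E →₀ k) : k :=
  x.sum fun q α => r.sum fun q' β =>
    if q.1 = q'.1 then
      α * β * sg k (unshuffleExp (fun _ => 1) ({q.1}ᶜ : Finset (Fin 3))) *
        pairGen q.2.1 q'.2.1 * pairGen q.2.2 q'.2.2
    else 0

/-- The Koszul dual: generators `E^* ⊗ sgn_2`, relators the annihilator of `R`. -/
abbrev QuadData.koszulDual (Q : QuadData k) : QuadData k where
  E := Q.E.signDual
  binary n d hn := by
    have := Q.binary n (-d) hn
    exact ⟨fun f g => LinearMap.ext fun x => by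
      rw [Subsingleton.elim x 0, map_zero, map_zero]⟩
  R := {x | ∀ r ∈ Q.R, pairQuad x r = 0}

end Quadratic

/-! ### The cobar construction -/

section Cobar

variable {k : Type u} [Field k]

/-- The `𝕊`-module `{O(n)^* ⊗ sgn_n [n-2]}_{n ≥ 2}` that generates the cobar construction of the
quadratic operad `O`. An element of degree `d` is a linear form on the part of `O(n)` of degree
`2 - n - d`. -/
abbrev QuadData.cobarGen (Q : QuadData k) : GrSMod k where
  X n d := Module.Dual k (Q.part n (2 - n - d))
  act n d := PreLieTwo.signDual (Q.partRep n (2 - n - d))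

open Classical in
/-- The value of a generator of the cobar construction, as a linear form extended by `0` to the
other degrees, on the class of a decorated tree. -/
def QuadData.ev (Q : QuadData k) {n : ℕ} {d : ℤ} (f : Q.cobarGen.X n d)
    (T : Tree Q.E (Fin n)) : k :=
  if h : 2 ≤ n ∧ T.Multilinear ∧ T.deg = 2 - n - d then
    f ⟨cls _ T, Submodule.subset_span ⟨T, h.1, h.2.1, h.2.2, rfl⟩⟩
  else 0

/-- Gluing of a tree `T'` to the leaf `0` of a tree `T`; the inputs of `T'` become the elements of
`A`, the remaining inputs of `T` the elements of the complement, both in increasing order. -/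
def insertTree {M : GrSMod k} {n : ℕ} (A : Finset (Fin n)) (T : Tree M (Fin (#Aᶜ + 1)))
    (T' : Tree M (Fin #A)) : Tree M (Fin n) :=
  T.bind (Fin.cons (T'.map (A.orderEmbOfFin rfl)) (fun j => .leaf (Aᶜ.orderEmbOfFin rfl j)))

/-- A finite sum of tensors `φ ⊗ ψ` of generators of arities `n - #A + 1` and `#A`. -/
abbrev QuadData.Tensors (Q : QuadData k) {n : ℕ} (A : Finset (Fin n)) : Type u :=
  List (Σ a : ℤ, Σ b : ℤ, Q.cobarGen.X (#Aᶜ + 1) a × Q.cobarGen.X #A b)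

/-- `Δ = ∑ φ ⊗ ψ` is the image of the linear form `f` under the dual of the operadic composition
`x ⊗ y ↦ x ∘_A y`, that is `f (x ∘_A y) = ∑ φ x * ψ y`. The sign moves the vertices of `y` to
their place in the glued tree. -/
def QuadData.IsCocomposition (Q : QuadData k) {n : ℕ} {d : ℤ} (f : Q.cobarGen.X n d)
    (A : Finset (Fin n)) (Δ : Q.Tensors A) : Prop :=
  ∀ (T : Tree Q.E (Fin (#Aᶜ + 1))) (T' : Tree Q.E (Fin #A)), T.Multilinear → T'.Multilinear →
    sg k (T'.deg * T.degAfter 0) * Q.ev f (insertTree A T T')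
      = (Δ.map fun s => Q.ev s.2.2.1 T * Q.ev s.2.2.2 T').sum

/-- All linear combinations of decorated trees with leaves labelled by `L` (repetitions allowed)
modulo the relations of the free operad on the generators of the cobar construction. The part with
`L = Fin n` and all labels occurring exactly once is the arity `n` part of that free operad. -/
abbrev QuadData.CobarSpace (Q : QuadData k) (L : Type) : Type u :=
  OpSpace (∅ : Set (Tree Q.cobarGen L →₀ k))

/-- The two-vertex tree `φ ∘_A ψ` of generators, with trees `ch i` glued to its leaves `i`. -/
def QuadData.twoVertex (Q : QuadData k) {L : Type} {n : ℕ} (A : Finset (Fin n)) {a b : ℤ}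
    (φ : Q.cobarGen.X (#Aᶜ + 1) a) (ψ : Q.cobarGen.X #A b) (ch : Fin n → Tree Q.cobarGen L) :
    Tree Q.cobarGen L :=
  .node _ a φ (Fin.cons (.node _ b ψ (fun i => ch (A.orderEmbOfFin rfl i)))
    (fun j => ch (Aᶜ.orderEmbOfFin rfl j)))

/-- `D` is the cobar differential: the derivation of degree one that on generators is the dual of
the operadic compositions.

A generator `f` of arity `n` is read as `λ_n ⊗ f`, where `λ_n` spans `sgn_n [n-2]` and has degree
`2 - n`. The differential of `λ_n` is `∑_A ± λ_{n-#A+1} ∘_A λ_{#A}` with the sign of the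
unshuffle `(A, Aᶜ)` times `(-1)^(#A * #Aᶜ)`; with the Koszul sign for moving `λ_{#A}` past `φ`, the
sign of `φ ∘_A ψ` is the sign of the unshuffle times `(-1)^(#A * (|φ| + 1))`. The first sum is
the differential of the root vertex (with the subtrees `ch i` brought into the order of the new
tree), the second one that of the subtrees. -/
structure QuadData.IsCobarDifferential (Q : QuadData k) {L : Type}
    (D : Q.CobarSpace L →ₗ[k] Q.CobarSpace L) : Prop where
  leaf : ∀ l, D (cls _ (.leaf l)) = 0
  node : ∀ (n : ℕ) (d : ℤ) (f : Q.cobarGen.X n d) (ch : Fin n → Tree Q.cobarGen L),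
    ∃ Δ : ∀ A : Finset (Fin n), Q.Tensors A,
      (∀ A : Finset (Fin n), 2 ≤ #A → #A < n → Q.IsCocomposition f A (Δ A)) ∧
      D (cls _ (.node n d f ch)) =
        (∑ A : Finset (Fin n) with 2 ≤ #A ∧ #A < n,
          ((Δ A).map fun s =>
            sg k (unshuffleExp (fun _ => 1) A + #A * (s.1 + 1)
              + unshuffleExp (fun i => (ch i).deg) A) •
            cls _ (Q.twoVertex A s.2.2.1 s.2.2.2 ch)).sum)
        + ∑ i : Fin n, sg k (d + ∑ j : Fin n, if j < i then (ch j).deg else 0) •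
            graftAt _ n d f ch i (D (cls _ (ch i)))

end Cobar

/-! ### The operad of pre-Lie² algebras -/

section PreLie

variable (k : Type u) [Field k]

/-- Basis of the generators: the two binary operations `x ∘ y`, `y ∘ x` of degree `0`, permuted by
`𝕊_2`, and the commutative binary operation `[x • y]` of degree `1`. -/
inductive Op : ℕ → ℤ → Type
  | circ (σ : Equiv.Perm (Fin 2)) : Op 2 0
  | bullet : Op 2 1

/-- The action of `𝕊_2` on the basis. -/
def Op.perm : {n : ℕ} → {d : ℤ} → Equiv.Perm (Fin n) → Op n d → Op n d
  | _, _, τ, .circ σ => .circ (τ * σ)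
  | _, _, _, .bullet => .bullet

instance (n : ℕ) (d : ℤ) : MulAction (Equiv.Perm (Fin n)) (Op n d) where
  smul := Op.perm
  one_smul x := by cases x <;> rfl
  mul_smul σ τ x := by cases x <;> rfl

/-- `E(2) = k[𝕊_2][0] ⊕ 1_2[-1]`. -/
abbrev preLieGen : GrSMod k where
  X n d := Op n d →₀ k
  act n d :=
    { toFun := fun σ => Finsupp.lmapDomain k k (fun x => σ • x)
      map_one' := by
        ext x
        simp
      map_mul' := fun σ τ => by
        ext x
        simp [mul_smul] }

/-- The operation `x ∘ y`. -/
def circ : (preLieGen k).X 2 0 := Finsupp.single (.circ 1) 1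

/-- The operation `[x • y]`. -/
def bullet : (preLieGen k).X 2 1 := Finsupp.single .bullet 1

variable {k}

/-- The tree `f (g (i, j), l)`, for `{i, j, l} = {0, 1, 2}`. -/
def leftTree {E : GrSMod k} {a b : ℤ} (f : E.X 2 a) (g : E.X 2 b) (i j l : Fin 3) :
    QuadTerm E →₀ k :=
  Finsupp.single (l, ⟨a, f⟩, ⟨b, if i < j then g else E.act 2 b (Equiv.swap 0 1) g⟩) 1

/-- The tree `f (i, g (j, l))`, for `{i, j, l} = {0, 1, 2}`. -/
def rightTree {E : GrSMod k} {a b : ℤ} (f : E.X 2 a) (g : E.X 2 b) (i j l : Fin 3) :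
    QuadTerm E →₀ k :=
  leftTree (E.act 2 a (Equiv.swap 0 1) f) g j l i

variable (k)

/-- The operad of pre-Lie² algebras: the pre-Lie identity for `∘`, the odd Jacobi identity for
`[ • ]`, and the compatibility identity. -/
abbrev preLieTwo : QuadData k where
  E := preLieGen k
  binary n d hn := by
    have : IsEmpty (Op n d) := ⟨fun x => by cases x <;> exact hn rfl⟩
    infer_instance
  R :=
    {x | ∃ σ : Equiv.Perm (Fin 3), x =
      leftTree (circ k) (circ k) (σ 0) (σ 1) (σ 2) - leftTree (circ k) (circ k) (σ 0) (σ 2) (σ 1)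
      - rightTree (circ k) (circ k) (σ 0) (σ 1) (σ 2)
      + rightTree (circ k) (circ k) (σ 0) (σ 2) (σ 1)} ∪
    {leftTree (bullet k) (bullet k) 0 1 2 + leftTree (bullet k) (bullet k) 2 0 1
      + leftTree (bullet k) (bullet k) 1 2 0} ∪
    {x | ∃ σ : Equiv.Perm (Fin 3), x =
      leftTree (circ k) (bullet k) (σ 0) (σ 1) (σ 2)
      + rightTree (circ k) (bullet k) (σ 0) (σ 1) (σ 2)
      + rightTree (circ k) (bullet k) (σ 1) (σ 0) (σ 2)
      - rightTree (bullet k) (circ k) (σ 0) (σ 1) (σ 2)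
      - rightTree (bullet k) (circ k) (σ 1) (σ 0) (σ 2)}

/-- The Koszul dual `P^!` of the operad `P` of pre-Lie² algebras. -/
abbrev dualPreLieTwo : QuadData k := (preLieTwo k).koszulDual

/-- The generators of `P_∞ = D P^!`. -/
abbrev infGen : GrSMod k := (dualPreLieTwo k).cobarGen

end PreLie

/-! ### Corollas -/

section Corollas

variable {k : Type u} [Field k]

/-- `c n p` are the corollas with `n` inputs, the first `n - p` of them solid and the last `p`
wavy. They are symmetric in the solid inputs, antisymmetric in the wavy ones; the corollas obtained
from `c n p` by relabelling, of which there are `n.choose p` up to sign, form a basis of the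
generators of arity `n` and degree `1 - p`, for `p = 0, …, n - 1`; and there are no other
generators. For `n = 2` they are the basis of linear forms dual to the binary generators of
`P^!`, which are in turn dual to `[x • y]` and `x ∘ y`. -/
structure IsCorollas (c : ∀ n p : ℕ, (infGen k).X n (1 - p)) : Prop where
  symm : ∀ n p : ℕ, 2 ≤ n → p < n → ∀ i j : Fin n, (i : ℕ) < n - p → (j : ℕ) < n - p →
    (infGen k).act n (1 - p) (Equiv.swap i j) (c n p) = c n p
  antisymm : ∀ n p : ℕ, 2 ≤ n → p < n → ∀ i j : Fin n, n - p ≤ (i : ℕ) → n - p ≤ (j : ℕ) →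
    i ≠ j → (infGen k).act n (1 - p) (Equiv.swap i j) (c n p) = - c n p
  span : ∀ n p : ℕ, 2 ≤ n → p < n →
    Submodule.span k (Set.range fun σ => (infGen k).act n (1 - p) σ (c n p)) = ⊤
  finrank : ∀ n p : ℕ, 2 ≤ n → p < n → Module.finrank k ((infGen k).X n (1 - p)) = n.choose p
  other : ∀ (n : ℕ) (d : ℤ), 2 ≤ n → (∀ p : ℕ, p < n → d ≠ 1 - p) → Subsingleton ((infGen k).X n d)
  two_zero : ∀ g : (preLieGen k).signDual.X 2 (-1),
    (dualPreLieTwo k).ev (c 2 0) (.node 2 (-1) g ![.leaf 0, .leaf 1]) = pairGen ⟨-1, g⟩ ⟨1, bullet k⟩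
  two_one : ∀ g : (preLieGen k).signDual.X 2 0,
    (dualPreLieTwo k).ev (c 2 1) (.node 2 0 g ![.leaf 0, .leaf 1]) = pairGen ⟨0, g⟩ ⟨0, circ k⟩

variable (c : ∀ n p : ℕ, (infGen k).X n (1 - p))

/-- The planar corolla with the given solid and wavy inputs. -/
def corolla {L : Type} (solid wavy : List (Tree (infGen k) L)) : Tree (infGen k) L :=
  .node (solid ++ wavy).length (1 - wavy.length) (c (solid ++ wavy).length wavy.length)
    (solid ++ wavy).get

variable (k) in
/-- The elements of a set of inputs, in increasing order. -/
def leaves {n : ℕ} (I : Finset (Fin n)) : List (Tree (infGen k) (Fin n)) :=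
  (I.sort (· ≤ ·)).map .leaf

/-- The first `n - p` inputs. -/
def solidInputs (n p : ℕ) : Finset (Fin n) := {i | (i : ℕ) < n - p}

/-- The last `p` inputs. -/
def wavyInputs (n p : ℕ) : Finset (Fin n) := {i | n - p ≤ (i : ℕ)}

/-- The first sum, over `I₁ ⊔ I₂ = {1, …, n-p}` and `J₁ ⊔ J₂ = {n-p+1, …, n}`. -/
def firstSum (n p : ℕ) : (dualPreLieTwo k).CobarSpace (Fin n) :=
  ∑ x : (Finset (Fin n) × Finset (Fin n)) × (Finset (Fin n) × Finset (Fin n)) with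
      (Disjoint x.1.1 x.1.2 ∧ x.1.1 ∪ x.1.2 = solidInputs n p) ∧
      (Disjoint x.2.1 x.2.2 ∧ x.2.1 ∪ x.2.2 = wavyInputs n p) ∧
      1 ≤ #x.1.2 ∧ 1 ≤ #x.1.1 + #x.2.2 ∧ 2 ≤ #x.1.2 + #x.2.1,
    let ⟨⟨I₁, I₂⟩, J₁, J₂⟩ := x
    sg k (#J₂ + inversions (J₁.sort (· ≤ ·) ++ J₂.sort (· ≤ ·))) •
      cls _ (corolla c (leaves k I₁ ++ [corolla c (leaves k I₂) (leaves k J₁)]) (leaves k J₂))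

/-- The second sum, over `I₁ ⊔ I₂ = {1, …, n-p}` and `J₁ ⊔ J₂ ⊔ J₃ = {n-p+1, …, n}` with `J₁` a
singleton. -/
def secondSum (n p : ℕ) : (dualPreLieTwo k).CobarSpace (Fin n) :=
  ∑ x : (Finset (Fin n) × Finset (Fin n)) ×
      (Finset (Fin n) × Finset (Fin n) × Finset (Fin n)) with
      (Disjoint x.1.1 x.1.2 ∧ x.1.1 ∪ x.1.2 = solidInputs n p) ∧
      (Disjoint x.2.1 x.2.2.1 ∧ Disjoint x.2.1 x.2.2.2 ∧ Disjoint x.2.2.1 x.2.2.2 ∧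
        x.2.1 ∪ x.2.2.1 ∪ x.2.2.2 = wavyInputs n p) ∧
      1 ≤ #x.1.1 ∧ #x.2.1 = 1 ∧ 1 ≤ #x.1.2 + #x.2.2.1,
    let ⟨⟨I₁, I₂⟩, J₁, J₂, J₃⟩ := x
    sg k (#J₂ + #J₃
        + inversions (J₁.sort (· ≤ ·) ++ J₂.sort (· ≤ ·) ++ J₃.sort (· ≤ ·))) •
      cls _ (corolla c (leaves k I₁)
        (corolla c (leaves k I₂ ++ leaves k J₁) (leaves k J₂) :: leaves k J₃))

end Corollas

end PreLieTwo

end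

/-! The dual operad `P^!` has a model in exterior algebras. Attach an odd generator to each input
and let `dd` be the contraction that sends every generator to `1`. The operation dual to `x ∘ y`
acts as `(a, b) ↦ a * dd b`, the one dual to `x • y` as `(a, b) ↦ -(inv a * b)`, where `inv` is the
parity automorphism. By the Leibniz rule and `dd² = 0`, everything that annihilates the relators of
pre-Lie² algebras has value zero (`model_relators`), so classes of trees have values (`modelHom`).

Conversely, the relators of `P^!` rewrite every tree as a combination of combs, where the inputs in
a set `I` are joined by `•` and the others are then appended by `∘` (`dcls_eq_zero_or`,
`dcls_mem_span_stdComb`). As `dd` of a leaf is `1`, the value of such a comb is, up to sign, the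
product of the generators in `I` (`model_comb`). Hence the combs of nonempty sets `I` form a basis
of `P^!(n)`, in degrees `1 - #I`, and up to sign the coefficient forms `coefF` are the dual basis
(`infGen_expand`, `coefF_linearIndependent`). The inputs in `I` are the solid ones. Coefficient
forms are antisymmetric in `I` and symmetric in the rest; the twist by the sign representation
exchanges the two, and a sign depending only on `n` turns them into the corollas `stdCor`.

Composition at an input also lives in the model: if its generator occurs it is replaced by the value
`w` of the inserted tree, and otherwise, when that input has been differentiated, one multiplies by
`dd w` (`subst`, `model_bind`). Taking coefficients (`coefL_subst`), the first case attaches the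
upper corolla to a solid input. In the second it is attached to a wavy input, and since `dd` is the
sum of all partial contractions, one wavy input `j` becomes solid in the upper corolla. These are
the two sums of the formula.

The differential is defined on trees by recursion (`dTree`) and must respect the relations of the
free operad. The sum over a cocomposition does not depend on its choice (`coSum_eq`), it is
equivariant (`root_act`), and the relations are homogeneous (`OpRel.homogeneous`), which matters
because the signs depend on degrees. What remains is to compare signs (`rootPhi_left`,
`rootPhi_right`) and to split each subset `A` of the inputs into solid and wavy parts
(`sum_solidTerm`, `sum_wavyTerm`). -/

noncomputable section

namespace PreLieTwo

/-! ### Signs as elements of the field. -/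

section SignLemmas

variable (k : Type u) [Field k]

theorem sg_zero : sg k 0 = 1 := by simp [sg]

theorem sg_one : sg k 1 = -1 := by simp [sg]

theorem sg_add (a b : ℤ) : sg k (a + b) = sg k a * sg k b := by
  simp [sg, Int.negOnePow_add]

theorem sg_congr {a b : ℤ} (h : Even (a - b)) : sg k a = sg k b := by
  rw [sg, sg, (Int.negOnePow_eq_iff a b).2 h]

theorem sg_even {a : ℤ} (h : Even a) : sg k a = 1 := by
  rw [sg_congr k (b := 0) (by simpa using h), sg_zero]

theorem sg_mul_self (a : ℤ) : sg k a * sg k a = 1 := by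
  rw [← sg_add, sg_even k ⟨a, rfl⟩]

theorem sg_ne_zero (a : ℤ) : sg k a ≠ 0 := fun h => by
  simpa [h] using sg_mul_self k a

theorem sg_add_one (a : ℤ) : sg k (a + 1) = - sg k a := by
  rw [sg_add, sg_one]; ring

end SignLemmas

/-! ### Exterior algebras: contractions, parity, graded commutativity. -/

section Exterior

variable {k : Type u} [Field k] {L L' : Type}

/-- The exterior algebra on the set `L`. -/
abbrev Ext (k : Type u) [Field k] (L : Type) : Type u := ExteriorAlgebra k (L →₀ k)

/-- The generator `l` of the exterior algebra. -/
abbrev gen (k : Type u) [Field k] {L : Type} (l : L) : Ext k L :=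
  ExteriorAlgebra.ι k (Finsupp.single l 1)

/-- Contraction with a linear form. -/
abbrev ctr (f : (L →₀ k) →ₗ[k] k) : Ext k L →ₗ[k] Ext k L :=
  CliffordAlgebra.contractLeft (Q := (0 : QuadraticForm k (L →₀ k))) f

/-- The parity automorphism. -/
abbrev inv : Ext k L →ₐ[k] Ext k L :=
  CliffordAlgebra.involute (Q := (0 : QuadraticForm k (L →₀ k)))

/-- Elements of a given parity. -/
abbrev parity (k : Type u) [Field k] (L : Type) (z : ℤ) : Submodule k (Ext k L) :=
  CliffordAlgebra.evenOdd (0 : QuadraticForm k (L →₀ k)) (z : ZMod 2)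

/-- The sum of the coordinates. -/
def coordSum (k : Type u) [Field k] (L : Type) : (L →₀ k) →ₗ[k] k :=
  Finsupp.linearCombination k (fun _ => 1)

@[simp] theorem coordSum_single (l : L) (a : k) : coordSum k L (Finsupp.single l a) = a := by
  simp [coordSum]

/-- The Koszul differential, which sends all generators to `1`. -/
abbrev dd : Ext k L →ₗ[k] Ext k L := ctr (coordSum k L)

/-- Contraction with the coordinate `l`. -/
abbrev pd (l : L) : Ext k L →ₗ[k] Ext k L := ctr (Finsupp.lapply l)

-- Scalars, sums and left multiplication by one vector suffice; since `ctr_ι_mul` computes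
-- contractions in the last case, identities between contractions are proved by this induction.
@[elab_as_elim]
theorem ext_induction {P : Ext k L → Prop} (x : Ext k L) (one : ∀ r, P (algebraMap k _ r))
    (add : ∀ x y, P x → P y → P (x + y))
    (mul : ∀ m x, P x → P (ExteriorAlgebra.ι k m * x)) : P x :=
  CliffordAlgebra.left_induction _ one add (fun x m hx => mul m x hx) x

theorem ctr_ι_mul (f : (L →₀ k) →ₗ[k] k) (m : L →₀ k) (x : Ext k L) :
    ctr f (ExteriorAlgebra.ι k m * x) = f m • x - ExteriorAlgebra.ι k m * ctr f x :=
  CliffordAlgebra.contractLeft_ι_mul (Q := (0 : QuadraticForm k (L →₀ k))) (d := f) m x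

theorem ctr_ι (f : (L →₀ k) →ₗ[k] k) (m : L →₀ k) :
    ctr f (ExteriorAlgebra.ι k m) = algebraMap k _ (f m) :=
  CliffordAlgebra.contractLeft_ι (Q := (0 : QuadraticForm k (L →₀ k))) (d := f) m

theorem ctr_algebraMap (f : (L →₀ k) →ₗ[k] k) (r : k) :
    ctr f (algebraMap k (Ext k L) r) = 0 :=
  CliffordAlgebra.contractLeft_algebraMap (Q := (0 : QuadraticForm k (L →₀ k))) (d := f) r

theorem ctr_one (f : (L →₀ k) →ₗ[k] k) : ctr f (1 : Ext k L) = 0 :=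
  CliffordAlgebra.contractLeft_one (Q := (0 : QuadraticForm k (L →₀ k))) (d := f)

theorem ctr_ctr (f : (L →₀ k) →ₗ[k] k) (x : Ext k L) : ctr f (ctr f x) = 0 :=
  CliffordAlgebra.contractLeft_contractLeft (Q := (0 : QuadraticForm k (L →₀ k))) f x

theorem ctr_comm (f g : (L →₀ k) →ₗ[k] k) (x : Ext k L) : ctr f (ctr g x) = - ctr g (ctr f x) :=
  CliffordAlgebra.contractLeft_comm (Q := (0 : QuadraticForm k (L →₀ k))) f g x

theorem ctr_sub_left (f g : (L →₀ k) →ₗ[k] k) (x : Ext k L) :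
    ctr (f - g) x = ctr f x - ctr g x := by
  rw [ctr, map_sub]; rfl

theorem ctr_zero_left (x : Ext k L) : ctr (0 : (L →₀ k) →ₗ[k] k) x = 0 := by
  rw [ctr, map_zero]; rfl

theorem inv_ι (m : L →₀ k) : inv (ExteriorAlgebra.ι k m) = - ExteriorAlgebra.ι k m :=
  CliffordAlgebra.involute_ι (Q := (0 : QuadraticForm k (L →₀ k))) m

theorem inv_inv (x : Ext k L) : inv (inv x) = x :=
  CliffordAlgebra.involute_involute (Q := (0 : QuadraticForm k (L →₀ k))) x

theorem inv_ctr (f : (L →₀ k) →ₗ[k] k) (x : Ext k L) : inv (ctr f x) = - ctr f (inv x) := by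
  induction x using ext_induction with
  | one r => rw [AlgHom.commutes, ctr_algebraMap, map_zero, neg_zero]
  | add x y hx hy => simp only [map_add, hx, hy, neg_add]
  | mul m x hx =>
    rw [ctr_ι_mul, map_sub, map_mul, map_smul, map_mul, inv_ι, hx, neg_mul, neg_mul, map_neg, ctr_ι_mul]
    simp

theorem ctr_inv (f : (L →₀ k) →ₗ[k] k) (x : Ext k L) : ctr f (inv x) = - inv (ctr f x) := by
  rw [inv_ctr, neg_neg]

/-- The graded Leibniz rule. Together with `ctr_ctr` it gives all relations between the operations
of the model. -/
theorem ctr_mul (f : (L →₀ k) →ₗ[k] k) (x y : Ext k L) :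
    ctr f (x * y) = ctr f x * y + inv x * ctr f y := by
  induction x using ext_induction with
  | one r => simp [← Algebra.smul_def]
  | add x y hx hy => simp only [map_add, hx, hy, add_mul]; abel
  | mul m x hx =>
    rw [mul_assoc, ctr_ι_mul, hx, ctr_ι_mul, map_mul, inv_ι, mul_add, sub_mul, smul_mul_assoc]
    simp only [mul_assoc, neg_mul]
    abel

/-- Contractions are natural if the form is pulled back. In particular maps preserving the
coordinate sum commute with `dd`. -/
theorem ctr_map (f : (L' →₀ k) →ₗ[k] k) (g : (L →₀ k) →ₗ[k] (L' →₀ k)) (x : Ext k L) :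
    ctr f (ExteriorAlgebra.map g x) = ExteriorAlgebra.map g (ctr (f ∘ₗ g) x) := by
  induction x using ext_induction with
  | one r => rw [AlgHom.commutes, ctr_algebraMap, ctr_algebraMap, map_zero]
  | add x y hx hy => simp only [map_add, hx, hy]
  | mul m x hx =>
    rw [map_mul, ExteriorAlgebra.map_apply_ι, ctr_ι_mul, ctr_ι_mul, hx, map_sub, map_mul, map_smul,
      ExteriorAlgebra.map_apply_ι]
    rfl

theorem inv_map (g : (L →₀ k) →ₗ[k] (L' →₀ k)) (x : Ext k L) :
    inv (ExteriorAlgebra.map g x) = ExteriorAlgebra.map g (inv x) := by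
  induction x using ext_induction with
  | one r => simp only [AlgHom.commutes]
  | add x y hx hy => simp only [map_add, hx, hy]
  | mul m x hx =>
    simp only [map_mul, ExteriorAlgebra.map_apply_ι, inv_ι, hx, map_neg]

theorem map_map_ext {L'' : Type} (f : (L' →₀ k) →ₗ[k] (L'' →₀ k)) (g : (L →₀ k) →ₗ[k] (L' →₀ k))
    (x : Ext k L) :
    ExteriorAlgebra.map f (ExteriorAlgebra.map g x) = ExteriorAlgebra.map (f ∘ₗ g) x := by
  rw [← ExteriorAlgebra.map_comp_map]; rfl

/-- The projection to the scalars. -/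
abbrev scal : Ext k L →ₐ[k] k := ExteriorAlgebra.algebraMapInv

theorem scal_ι (m : L →₀ k) : scal (ExteriorAlgebra.ι k m) = 0 := by
  simp [scal, ExteriorAlgebra.algebraMapInv]

theorem scal_ι_mul (m : L →₀ k) (x : Ext k L) : scal (ExteriorAlgebra.ι k m * x) = 0 := by
  rw [map_mul, scal_ι, zero_mul]

theorem scal_inv (x : Ext k L) : scal (inv x) = scal x := by
  induction x using ext_induction with
  | one r => rw [AlgHom.commutes]
  | add x y hx hy => simp only [map_add, hx, hy]
  | mul m x hx => rw [map_mul, inv_ι, neg_mul, map_neg, scal_ι_mul, scal_ι_mul, neg_zero]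

theorem scal_map (g : (L →₀ k) →ₗ[k] (L' →₀ k)) (x : Ext k L) :
    scal (ExteriorAlgebra.map g x) = scal x := by
  induction x using ext_induction with
  | one r => simp only [AlgHom.commutes]
  | add x y hx hy => simp only [map_add, hx, hy]
  | mul m x hx => rw [map_mul, ExteriorAlgebra.map_apply_ι, scal_ι_mul, scal_ι_mul]

theorem map_zero_ext (x : Ext k L) :
    ExteriorAlgebra.map (0 : (L →₀ k) →ₗ[k] (L' →₀ k)) x = algebraMap k _ (scal x) := by
  induction x using ext_induction with
  | one r => simp only [AlgHom.commutes, Algebra.algebraMap_self, RingHom.id_apply]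
  | add x y hx hy => simp only [map_add, hx, hy]
  | mul m x hx =>
    rw [map_mul, ExteriorAlgebra.map_apply_ι, scal_ι_mul]
    simp

/-- Degrees of trees are integers, while only their classes modulo two matter for the grading of the
exterior algebra. -/
theorem parity_congr {a b : ℤ} (h : Even (a - b)) {x : Ext k L} (hx : x ∈ parity k L a) :
    x ∈ parity k L b := by
  have : (a : ZMod 2) = b := by
    rw [← sub_eq_zero, ← Int.cast_sub]
    exact (ZMod.intCast_zmod_eq_zero_iff_dvd _ 2).2 h.two_dvd
  simpa [parity, this] using hx

theorem parity_ι (m : L →₀ k) : ExteriorAlgebra.ι k m ∈ parity k L 1 := by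
  simpa [parity] using CliffordAlgebra.ι_mem_evenOdd_one (0 : QuadraticForm k (L →₀ k)) m

theorem parity_mul {a b : ℤ} {x y : Ext k L} (hx : x ∈ parity k L a) (hy : y ∈ parity k L b) :
    x * y ∈ parity k L (a + b) := by
  rw [parity, Int.cast_add]
  exact CliffordAlgebra.evenOdd_mul_le _ _ _ (Submodule.mul_mem_mul hx hy)

theorem int_cast_zmod_two (a : ℤ) : (a : ZMod 2) = 0 ∧ Even a ∨ (a : ZMod 2) = 1 ∧ Odd a := by
  rcases Int.even_or_odd a with h | h
  · exact .inl ⟨(ZMod.intCast_zmod_eq_zero_iff_dvd _ 2).2 h.two_dvd, h⟩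
  · refine .inr ⟨?_, h⟩
    obtain ⟨b, rfl⟩ := h
    push_cast
    rw [show (2 : ZMod 2) = 0 from rfl]; simp

theorem inv_of_parity {a : ℤ} {x : Ext k L} (hx : x ∈ parity k L a) : inv x = sg k a • x := by
  rcases int_cast_zmod_two a with ⟨h, e⟩ | ⟨h, e⟩
  · rw [parity, h] at hx
    rw [sg_even k e, one_smul]
    exact CliffordAlgebra.involute_eq_of_mem_even hx
  · rw [parity, h] at hx
    rw [sg_congr k (b := 1) (by obtain ⟨b, rfl⟩ := e; exact ⟨b, by ring⟩), sg_one, neg_one_smul]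
    exact CliffordAlgebra.involute_eq_of_mem_odd hx

theorem parity_inv {a : ℤ} {x : Ext k L} (hx : x ∈ parity k L a) : inv x ∈ parity k L a := by
  rw [inv_of_parity hx]
  exact Submodule.smul_mem _ _ hx

/-- The induction adds two generators at a time, so that it stays within one parity; each of the two
can be contracted by `ctr_ι_mul`. -/
theorem parity_ctr (f : (L →₀ k) →ₗ[k] k) {a : ℤ} {x : Ext k L} (hx : x ∈ parity k L a) :
    ctr f x ∈ parity k L (a + 1) := by
  rw [parity, Int.cast_add, Int.cast_one]
  rw [parity] at hx
  generalize (a : ZMod 2) = z at hx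
  induction x, hx using CliffordAlgebra.evenOdd_induction with
  | range_ι_pow v h =>
    have hz : ∀ z : ZMod 2, z = 0 ∨ z = 1 := by decide
    rcases hz z with rfl | rfl
    · rw [ZMod.val_zero, pow_zero, Submodule.mem_one] at h
      obtain ⟨r, rfl⟩ := h
      erw [ctr_algebraMap]
      exact Submodule.zero_mem _
    · rw [ZMod.val_one, pow_one] at h
      obtain ⟨m, rfl⟩ := h
      erw [ctr_ι]
      rw [show (1 : ZMod 2) + 1 = 0 from rfl, Algebra.algebraMap_eq_smul_one]
      exact Submodule.smul_mem _ _ (CliffordAlgebra.one_le_evenOdd_zero _ ⟨1, by simp⟩)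
  | add x y hx hy ihx ihy => rw [map_add]; exact Submodule.add_mem _ ihx ihy
  | ι_mul_ι_mul m n x hx ihx =>
    have h1 := ctr_ι_mul f m (ExteriorAlgebra.ι k n * x)
    rw [ctr_ι_mul f n x, ← mul_assoc] at h1
    erw [h1]
    have hι : ∀ (m : L →₀ k) {w : ZMod 2} {y : Ext k L},
        y ∈ CliffordAlgebra.evenOdd (0 : QuadraticForm k (L →₀ k)) w →
        ExteriorAlgebra.ι k m * y ∈ CliffordAlgebra.evenOdd (0 : QuadraticForm k (L →₀ k)) (w + 1) :=
      fun m w y hy => by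
        rw [add_comm]
        exact CliffordAlgebra.evenOdd_mul_le _ _ _
          (Submodule.mul_mem_mul (CliffordAlgebra.ι_mem_evenOdd_one _ m) hy)
    refine Submodule.sub_mem _ (Submodule.smul_mem _ _ (hι _ hx)) ?_
    rw [mul_sub]
    refine Submodule.sub_mem _ ?_ ?_
    · rw [mul_smul_comm]
      exact Submodule.smul_mem _ _ (hι _ hx)
    · have := hι m (hι n ihx)
      rwa [add_assoc (z + 1), show (1 : ZMod 2) + 1 = 0 from rfl, add_zero] at this

/-- For the zero quadratic form all vectors are orthogonal, so the commutation rule for orthogonal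
parts of a Clifford algebra applies with both isometries the identity. -/
theorem mul_comm_of_parity {a b : ℤ} {x y : Ext k L} (hx : x ∈ parity k L a)
    (hy : y ∈ parity k L b) : x * y = sg k (a * b) • (y * x) := by
  have h := CliffordAlgebra.map_mul_map_of_isOrtho_of_mem_evenOdd
    (Q₁ := (0 : QuadraticForm k (L →₀ k))) (Q₂ := (0 : QuadraticForm k (L →₀ k)))
    (Qₙ := (0 : QuadraticForm k (L →₀ k)))
    (QuadraticMap.Isometry.id _) (QuadraticMap.Isometry.id _)
    (fun x y => by simp [QuadraticMap.IsOrtho]) x y hx hy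
  rw [CliffordAlgebra.map_id] at h
  erw [h]
  rcases int_cast_zmod_two a with ⟨h1, e1⟩ | ⟨h1, e1⟩ <;>
  rcases int_cast_zmod_two b with ⟨h2, e2⟩ | ⟨h2, e2⟩
  · rw [h1, h2, sg_even k (e1.mul_right _)]; simp
  · rw [h1, h2, sg_even k (e1.mul_right _)]; simp
  · rw [h1, h2, sg_even k (e2.mul_left _)]; simp
  · rw [h1, h2, sg_congr k (b := 1) ((e1.mul e2).sub_odd odd_one), sg_one]
    simp

end Exterior

/-! ### The operations of the dual operad on exterior algebras. -/

section Model

variable {k : Type u} [Field k] {L L' : Type}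

theorem perm_two (σ : Equiv.Perm (Fin 2)) : σ = 1 ∨ σ = Equiv.swap 0 1 := by
  revert σ; decide

instance (n : ℕ) (d : ℤ) : DecidableEq (Op n d) := Classical.decEq _

instance (n : ℕ) (d : ℤ) : Fintype (Op n d) :=
  @Fintype.ofFinite _ (Finite.of_injective
    -- A permutation of two letters is determined by the image of `0`; the extra value separates
    -- `bullet`.
    (fun o : Op n d => (match o with | .circ σ => some (σ 0) | .bullet => none))
    (by
      rintro a b h
      cases a with
      | circ σ =>
        cases b with
        | circ τ =>
          have : σ = τ := by
            rcases perm_two σ with rfl | rfl <;> rcases perm_two τ with rfl | rfl <;>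
              simp at h ⊢
          rw [this]
      | bullet => cases b; rfl))

theorem Op.univ_zero : (univ : Finset (Op 2 0)) = {.circ 1, .circ (Equiv.swap 0 1)} := by
  ext o
  cases o with
  | circ σ => rcases perm_two σ with rfl | rfl <;> simp

theorem Op.univ_one : (univ : Finset (Op 2 1)) = {.bullet} := by
  ext o
  cases o; simp

/-- The operations of `P^!` dual to `o`, on the exterior algebra. -/
def opVal : {n : ℕ} → {d : ℤ} → Op n d → (Fin n → Ext k L) → Ext k L
  | _, _, .circ σ, a => if σ = 1 then a 0 * dd (a 1) else - (inv (dd (a 0)) * a 1)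
  | _, _, .bullet, a => - (inv (a 0) * a 1)

/-- The value of a tree of operations of `P^!` in the exterior algebra on its leaves. -/
def Tree.model : Tree (preLieGen k).signDual L → Ext k L
  | .leaf l => gen k l
  | .node n d e ch => ∑ o : Op n (-d), e (Finsupp.single o 1) • opVal o fun i => (ch i).model

/-- Linearity in each slot lets a relation between subtrees pass to the values of the trees grafted
from them. -/
theorem opVal_linear {n : ℕ} {d : ℤ} (o : Op n d) (a : Fin n → Ext k L) (i : Fin n) :
    ∃ g : Ext k L →ₗ[k] Ext k L, ∀ x, opVal o (Function.update a i x) = g x := by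
  cases o with
  | circ σ =>
    by_cases h : σ = 1
    · fin_cases i
      · exact ⟨LinearMap.mulRight k (dd (a 1)), fun x => by simp [opVal, h]⟩
      · exact ⟨LinearMap.mulLeft k (a 0) ∘ₗ dd, fun x => by simp [opVal, h]⟩
    · fin_cases i
      · exact ⟨- (LinearMap.mulRight k (a 1) ∘ₗ inv.toLinearMap ∘ₗ dd), fun x => by
          simp [opVal, h]⟩
      · exact ⟨- LinearMap.mulLeft k (inv (dd (a 0))), fun x => by simp [opVal, h]⟩
  | bullet =>
    fin_cases i
    · exact ⟨- (LinearMap.mulRight k (a 1) ∘ₗ inv.toLinearMap), fun x => by simp [opVal]⟩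
    · exact ⟨- LinearMap.mulLeft k (inv (a 0)), fun x => by simp [opVal]⟩

/-- A leaf has degree `0` but an odd value, hence the shift by one. One contraction compensates the
second shift for `∘`; for `•` the degree `1` of the operation does. -/
theorem opVal_parity {n : ℕ} {d : ℤ} (o : Op n d) (a : Fin n → Ext k L) (t : Fin n → ℤ)
    (h : ∀ i, a i ∈ parity k L (1 + t i)) : opVal o a ∈ parity k L (1 + d + ∑ i, t i) := by
  cases o with
  | circ σ =>
    rw [Fin.sum_univ_two]
    by_cases hσ : σ = 1
    · simp only [opVal, hσ, if_true]
      exact parity_congr ⟨1, by ring⟩ (parity_mul (h 0) (parity_ctr _ (h 1)))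
    · simp only [opVal, hσ, if_false]
      exact Submodule.neg_mem _ (parity_congr ⟨1, by ring⟩
        (parity_mul (parity_inv (parity_ctr _ (h 0))) (h 1)))
  | bullet =>
    rw [Fin.sum_univ_two]
    exact Submodule.neg_mem _ (parity_congr ⟨0, by ring⟩ (parity_mul (parity_inv (h 0)) (h 1)))

theorem Tree.model_parity (T : Tree (preLieGen k).signDual L) :
    T.model ∈ parity k L (1 + T.deg) := by
  induction T with
  | leaf l => exact parity_congr ⟨0, by simp [deg]⟩ (parity_ι _)
  | node n d e ch ih =>
    refine Submodule.sum_mem _ fun o _ => Submodule.smul_mem _ _ ?_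
    refine parity_congr ⟨-d, ?_⟩ (opVal_parity o _ _ ih)
    rw [deg]; ring

theorem koszulExp_two (d : Fin 2 → ℤ) :
    koszulExp d (Equiv.swap 0 1) = d 0 * d 1 := by
  simp [koszulExp, Fin.sum_univ_two]; ring

theorem koszulExp_id {n : ℕ} (d : Fin n → ℤ) : koszulExp d 1 = 0 := by
  unfold koszulExp
  refine sum_eq_zero fun i _ => sum_eq_zero fun j _ => if_neg ?_
  rintro ⟨h1, h2⟩
  exact absurd h2 (by simpa using h1.le)

theorem inv_mul_eq_of_parity {a b : ℤ} {x y : Ext k L} (hx : x ∈ parity k L a)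
    (hy : y ∈ parity k L b) : inv x * y = sg k (a + a * b) • (y * x) := by
  rw [inv_of_parity hx, smul_mul_assoc, mul_comm_of_parity hx hy, smul_smul, ← sg_add]

/-- Graded commutativity in the shifted parities produces the Koszul sign of the tree degrees times
the sign character; this is what fixes the signs and the parity automorphisms in `opVal`. -/
theorem opVal_perm {n : ℕ} {d : ℤ} (o : Op n d) (σ : Equiv.Perm (Fin n)) (a : Fin n → Ext k L)
    (t : Fin n → ℤ) (h : ∀ i, a i ∈ parity k L (1 + t i)) :
    opVal (σ • o) a
      = ((((Equiv.Perm.sign σ : ℤˣ) : ℤ) : k) * sg k (koszulExp t σ)) • opVal o (a ∘ σ) := by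
  have hs : ∀ z w : k, ∀ x : Ext k L, z = w → z • x = w • x := fun z w x h => by rw [h]
  cases o with
  | circ τ =>
    rcases perm_two σ with rfl | rfl
    · simp [koszulExp_id, sg_zero]
    · rw [koszulExp_two]
      rcases perm_two τ with rfl | rfl
      · change opVal (.circ (Equiv.swap 0 1 * 1)) a = _
        have : (Equiv.swap (0 : Fin 2) 1) ≠ 1 := by decide
        simp only [opVal, mul_one, this, if_false, if_true, Function.comp, Equiv.swap_apply_left,
          Equiv.swap_apply_right]
        rw [inv_mul_eq_of_parity (parity_ctr _ (h 0)) (h 1), ← neg_smul]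
        apply hs
        rw [Equiv.Perm.sign_swap (by decide)]
        simp only [Units.val_neg, Units.val_one, Int.cast_neg, Int.cast_one, neg_mul, one_mul]
        congr 1
        exact sg_congr k ⟨2 + t 0 + t 1, by ring⟩
      · change opVal (.circ (Equiv.swap 0 1 * Equiv.swap 0 1)) a = _
        have : (Equiv.swap (0 : Fin 2) 1) ≠ 1 := by decide
        simp only [opVal, Equiv.swap_mul_self, this, if_false, if_true, Function.comp,
          Equiv.swap_apply_left, Equiv.swap_apply_right]
        rw [inv_mul_eq_of_parity (parity_ctr _ (h 1)) (h 0), smul_neg, smul_smul,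
          Equiv.Perm.sign_swap (by decide)]
        simp only [Units.val_neg, Units.val_one, Int.cast_neg, Int.cast_one, neg_mul, one_mul,
          neg_smul, neg_neg]
        rw [← sg_add, sg_even k, one_smul]
        exact ⟨t 0 * t 1 + 1 + t 1 + (1 + t 0), by ring⟩
  | bullet =>
    rcases perm_two σ with rfl | rfl
    · simp [koszulExp_id, sg_zero]
    · change opVal .bullet a = _
      simp only [opVal, Function.comp, Equiv.swap_apply_left, Equiv.swap_apply_right]
      rw [koszulExp_two, inv_mul_eq_of_parity (h 0) (h 1), inv_of_parity (h 1), smul_mul_assoc,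
        smul_neg, smul_smul, Equiv.Perm.sign_swap (by decide), ← neg_smul, ← neg_smul]
      apply hs
      simp only [Units.val_neg, Units.val_one, Int.cast_neg, Int.cast_one, neg_mul, one_mul,
          neg_neg]
      rw [← sg_add, ← sg_add_one]
      exact sg_congr k ⟨1 + t 0, by ring⟩

end Model

/-! ### The relators up to sign and the quadratic pairing. -/

section Relators

variable {k : Type u} [Field k] {L L' : Type}

/-- The binary operations. -/
abbrev BinOp : Type := Σ d : ℤ, Op 2 d

/-- The operation `x ∘ y`. -/
abbrev opC : BinOp := ⟨0, .circ 1⟩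

/-- The operation `y ∘ x`. -/
abbrev opS : BinOp := ⟨0, .circ (Equiv.swap 0 1)⟩

/-- The operation `[x • y]`. -/
abbrev opB : BinOp := ⟨1, .bullet⟩

variable (k) in
/-- The generator given by an operation. -/
def BinOp.elt (o : BinOp) : Σ a : ℤ, (preLieGen k).X 2 a := ⟨o.1, Finsupp.single o.2 1⟩

variable (k) in
/-- The tree with two vertices decorated by operations. -/
def elTree (c : Fin 3) (o o' : BinOp) : QuadTerm (preLieGen k) →₀ k :=
  Finsupp.single (c, o.elt k, o'.elt k) 1

/-- The pairing, as a linear map in both arguments. -/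
theorem pairQuad_eq {E : GrSMod k} (x : QuadTerm E.signDual →₀ k) (r : QuadTerm E →₀ k) :
    pairQuad x r = Finsupp.linearCombination k (fun q : QuadTerm E.signDual =>
      Finsupp.linearCombination k fun q' : QuadTerm E =>
      if q.1 = q'.1 then sg k (unshuffleExp (fun _ => 1) ({q.1}ᶜ : Finset (Fin 3))) *
        pairGen q.2.1 q'.2.1 * pairGen q.2.2 q'.2.2 else 0) x r := by
  rw [pairQuad, Finsupp.linearCombination_apply, Finsupp.sum, Finsupp.sum, LinearMap.sum_apply]
  refine sum_congr rfl fun q _ => ?_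
  rw [LinearMap.smul_apply, Finsupp.linearCombination_apply, Finsupp.sum, Finsupp.sum, smul_sum]
  refine sum_congr rfl fun q' _ => ?_
  split_ifs
  · simp only [smul_eq_mul]; ring
  · simp

theorem pairQuad_add_right {E : GrSMod k} (x : QuadTerm E.signDual →₀ k)
    (r r' : QuadTerm E →₀ k) : pairQuad x (r + r') = pairQuad x r + pairQuad x r' := by
  simp only [pairQuad_eq, map_add]

theorem pairQuad_sub_right {E : GrSMod k} (x : QuadTerm E.signDual →₀ k)
    (r r' : QuadTerm E →₀ k) : pairQuad x (r - r') = pairQuad x r - pairQuad x r' := by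
  simp only [pairQuad_eq, map_sub]

theorem pairQuad_neg_right {E : GrSMod k} (x : QuadTerm E.signDual →₀ k)
    (r : QuadTerm E →₀ k) : pairQuad x (-r) = - pairQuad x r := by
  simp only [pairQuad_eq, map_neg]

theorem pairQuad_add_left {E : GrSMod k} (x x' : QuadTerm E.signDual →₀ k)
    (r : QuadTerm E →₀ k) : pairQuad (x + x') r = pairQuad x r + pairQuad x' r := by
  simp only [pairQuad_eq, map_add, LinearMap.add_apply]

theorem pairQuad_single {E : GrSMod k} (q : QuadTerm E.signDual) (q' : QuadTerm E) (a b : k) :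
    pairQuad (Finsupp.single q a) (Finsupp.single q' b) = if q.1 = q'.1 then
      a * b * (sg k (unshuffleExp (fun _ => 1) ({q.1}ᶜ : Finset (Fin 3))) *
        pairGen q.2.1 q'.2.1 * pairGen q.2.2 q'.2.2) else 0 := by
  rw [pairQuad_eq, Finsupp.linearCombination_single, LinearMap.smul_apply,
    Finsupp.linearCombination_single]
  split_ifs <;> simp [mul_assoc]

theorem act_circ : (preLieGen k).act 2 0 (Equiv.swap 0 1) (circ k)
    = Finsupp.single (.circ (Equiv.swap 0 1)) 1 := by
  change Finsupp.lmapDomain k k _ (Finsupp.single _ _) = _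
  rw [Finsupp.lmapDomain_apply, Finsupp.mapDomain_single]
  rfl

theorem act_bullet : (preLieGen k).act 2 1 (Equiv.swap 0 1) (bullet k)
    = Finsupp.single .bullet 1 := by
  change Finsupp.lmapDomain k k _ (Finsupp.single _ _) = _
  rw [Finsupp.lmapDomain_apply, Finsupp.mapDomain_single]
  rfl

/-- The standard relators. -/
inductive StdRel : (QuadTerm (preLieGen k) →₀ k) → Prop
  | c0 : StdRel (elTree k 2 opC opC - elTree k 1 opC opC - elTree k 0 opS opC + elTree k 0 opS opS)
  | c1 : StdRel (elTree k 2 opC opS - elTree k 0 opC opC - elTree k 1 opS opC + elTree k 1 opS opS)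
  | c2 : StdRel (elTree k 0 opC opS - elTree k 1 opC opS - elTree k 2 opS opS + elTree k 2 opS opC)
  | b : StdRel (elTree k 2 opB opB + elTree k 1 opB opB + elTree k 0 opB opB)
  | m2 : StdRel (elTree k 2 opC opB + elTree k 0 opS opB + elTree k 1 opS opB
      - elTree k 0 opB opC - elTree k 1 opB opC)
  | m1 : StdRel (elTree k 1 opC opB + elTree k 0 opS opB + elTree k 2 opS opB
      - elTree k 0 opB opS - elTree k 2 opB opC)
  | m0 : StdRel (elTree k 0 opC opB + elTree k 2 opS opB + elTree k 1 opS opB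
      - elTree k 2 opB opS - elTree k 1 opB opS)

theorem perm_three (σ : Equiv.Perm (Fin 3)) :
    σ = 1 ∨ σ = Equiv.swap 0 1 ∨ σ = Equiv.swap 0 2 ∨ σ = Equiv.swap 1 2 ∨
      σ = Equiv.swap 0 1 * Equiv.swap 1 2 ∨ σ = Equiv.swap 1 2 * Equiv.swap 0 1 := by
  revert σ; decide

theorem leftTree_circ_circ (i j l : Fin 3) :
    leftTree (circ k) (circ k) i j l = elTree k l opC (if i < j then opC else opS) := by
  unfold leftTree
  rw [act_circ]
  split_ifs <;> rfl

theorem rightTree_circ_circ (i j l : Fin 3) :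
    rightTree (circ k) (circ k) i j l = elTree k i opS (if j < l then opC else opS) := by
  unfold rightTree leftTree
  rw [act_circ]
  split_ifs <;> rfl

theorem leftTree_bullet (f : BinOp) (i j l : Fin 3) :
    leftTree (f.elt k).2 (bullet k) i j l = elTree k l f opB := by
  unfold leftTree
  rw [act_bullet]
  split_ifs <;> rfl

theorem rightTree_circ_bullet (i j l : Fin 3) :
    rightTree (circ k) (bullet k) i j l = elTree k i opS opB := by
  unfold rightTree leftTree
  rw [act_circ, act_bullet]
  split_ifs <;> rfl

theorem rightTree_bullet_circ (i j l : Fin 3) :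
    rightTree (bullet k) (circ k) i j l = elTree k i opB (if j < l then opC else opS) := by
  unfold rightTree leftTree
  rw [act_circ, act_bullet]
  split_ifs <;> rfl

theorem stdRel_mem {r : QuadTerm (preLieGen k) →₀ k} (h : StdRel r) : r ∈ (preLieTwo k).R := by
  have lb : ∀ i j l, leftTree (bullet k) (bullet k) i j l = elTree k l opB opB :=
    leftTree_bullet opB
  have lc : ∀ i j l, leftTree (circ k) (bullet k) i j l = elTree k l opC opB :=
    leftTree_bullet opC
  cases h with
  | c0 => exact .inl (.inl ⟨1, by simp [leftTree_circ_circ, rightTree_circ_circ]⟩)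
  | c1 => exact .inl (.inl ⟨Equiv.swap 0 1, by
      simp [leftTree_circ_circ, rightTree_circ_circ, Equiv.swap_apply_of_ne_of_ne]⟩)
  | c2 => exact .inl (.inl ⟨Equiv.swap 0 2, by
      simp [leftTree_circ_circ, rightTree_circ_circ, Equiv.swap_apply_of_ne_of_ne]⟩)
  | b => exact .inl (.inr (by simp only [lb]; rfl))
  | m2 => exact .inr ⟨1, by simp [lc, rightTree_circ_bullet, rightTree_bullet_circ]⟩
  | m1 => exact .inr ⟨Equiv.swap 1 2, by
      simp [lc, rightTree_circ_bullet, rightTree_bullet_circ, Equiv.swap_apply_of_ne_of_ne]⟩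
  | m0 => exact .inr ⟨Equiv.swap 0 2, by
      simp [lc, rightTree_circ_bullet, rightTree_bullet_circ, Equiv.swap_apply_of_ne_of_ne]⟩

/-- The pre-Lie identity is antisymmetric in its last two inputs and the compatibility identity
symmetric in its first two, so the six permutations give each of three relators twice, up to sign.
-/
theorem stdRel_of_mem {r : QuadTerm (preLieGen k) →₀ k} (h : r ∈ (preLieTwo k).R) :
    StdRel r ∨ StdRel (-r) := by
  have lb : ∀ i j l, leftTree (bullet k) (bullet k) i j l = elTree k l opB opB :=
    leftTree_bullet opB
  have lc : ∀ i j l, leftTree (circ k) (bullet k) i j l = elTree k l opC opB :=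
    leftTree_bullet opC
  have e1 : ∀ r r' : QuadTerm (preLieGen k) →₀ k, StdRel r → r' = r → StdRel r' ∨ StdRel (-r') :=
    fun r r' h e => .inl (e ▸ h)
  have e2 : ∀ r r' : QuadTerm (preLieGen k) →₀ k, StdRel r → -r' = r → StdRel r' ∨ StdRel (-r') :=
    fun r r' h e => .inr (e ▸ h)
  rcases h with (⟨σ, rfl⟩ | h) | ⟨σ, rfl⟩
  · simp only [leftTree_circ_circ, rightTree_circ_circ]
    rcases perm_three σ with rfl | rfl | rfl | rfl | rfl | rfl
    · refine e1 _ _ .c0 ?_; simp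
    · refine e1 _ _ .c1 ?_; simp [Equiv.swap_apply_of_ne_of_ne]
    · refine e1 _ _ .c2 ?_; simp [Equiv.swap_apply_of_ne_of_ne]
    · refine e2 _ _ .c0 ?_; simp [Equiv.swap_apply_of_ne_of_ne]; abel
    · refine e2 _ _ .c1 ?_; simp [Equiv.swap_apply_of_ne_of_ne]; abel
    · refine e2 _ _ .c2 ?_; simp [Equiv.swap_apply_of_ne_of_ne]; abel
  · rw [Set.mem_singleton_iff] at h
    subst h
    simp only [lb]
    refine e1 _ _ .b (by abel)
  · simp only [lc, rightTree_circ_bullet, rightTree_bullet_circ]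
    rcases perm_three σ with rfl | rfl | rfl | rfl | rfl | rfl
    · refine e1 _ _ .m2 ?_; simp
    · refine e1 _ _ .m2 ?_; simp [Equiv.swap_apply_of_ne_of_ne]; abel
    · refine e1 _ _ .m0 ?_; simp [Equiv.swap_apply_of_ne_of_ne]
    · refine e1 _ _ .m1 ?_; simp [Equiv.swap_apply_of_ne_of_ne]
    · refine e1 _ _ .m0 ?_; simp [Equiv.swap_apply_of_ne_of_ne]; abel
    · refine e1 _ _ .m1 ?_; simp [Equiv.swap_apply_of_ne_of_ne]; abel

/-- Reduces membership in the annihilator to seven linear equations. -/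
theorem mem_dual_relators_iff {x : QuadTerm (preLieGen k).signDual →₀ k} :
    x ∈ (dualPreLieTwo k).R ↔ ∀ r, StdRel r → pairQuad x r = 0 := by
  constructor
  · exact fun h r hr => h r (stdRel_mem hr)
  · intro h r hr
    rcases stdRel_of_mem hr with hr | hr
    · exact h r hr
    · rw [← neg_neg r, pairQuad_neg_right, h _ hr, neg_zero]

end Relators

/-! ### The relators of the dual operad vanish in the model. -/

section Model

variable {k : Type u} [Field k] {L L' : Type}

theorem sum_eq_pairGen {V : Type*} [AddCommGroup V] [Module k V] {a : ℤ}
    (g : (preLieGen k).signDual.X 2 a) (Y : BinOp → V) :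
    ∑ o : Op 2 (-a), g (Finsupp.single o 1) • Y ⟨-a, o⟩ = pairGen ⟨a, g⟩ (opC.elt k) • Y opC
      + pairGen ⟨a, g⟩ (opS.elt k) • Y opS + pairGen ⟨a, g⟩ (opB.elt k) • Y opB := by
  -- With `-a` replaced by a variable, the cases of degree `0` and `1` can be treated by
  -- substitution; the transport inside `pairGen` is hidden in `Z`.
  have key : ∀ (δ : ℤ) (g : Module.Dual k (Op 2 δ →₀ k)) (Z : BinOp → k),
      (∀ o : BinOp, Z o = if h : o.1 = δ then g (h ▸ (o.elt k).2) else 0) →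
      ∑ o : Op 2 δ, g (Finsupp.single o 1) • Y ⟨δ, o⟩
        = Z opC • Y opC + Z opS • Y opS + Z opB • Y opB := by
    intro δ g Z hZ
    rw [hZ, hZ, hZ]
    by_cases h0 : δ = 0
    · subst h0
      rw [Op.univ_zero, sum_pair (by simp; decide)]
      simp [BinOp.elt]
    by_cases h1 : δ = 1
    · subst h1
      rw [Op.univ_one, sum_singleton]
      simp [BinOp.elt]
    · have : IsEmpty (Op 2 δ) := ⟨fun o => by cases o <;> simp at h0 h1⟩
      simp [Ne.symm h0, Ne.symm h1]
  exact key (-a) g (fun o => pairGen ⟨a, g⟩ (o.elt k)) fun o => rfl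

/-- The value of the operation `o (o' (m i, m j), m c)`. -/
def opTreeVal (m : Fin 3 → Ext k L) (c : Fin 3) (o o' : BinOp) : Ext k L :=
  opVal o.2 ![opVal o'.2 ![m (c.succAbove 0), m (c.succAbove 1)], m c]

theorem mul_swap_last {b c : ℤ} (u : Ext k L) {y z : Ext k L} (hy : y ∈ parity k L b)
    (hz : z ∈ parity k L c) : u * y * z = sg k (b * c) • (u * z * y) := by
  rw [mul_assoc, mul_comm_of_parity hy hz, mul_smul_comm, mul_assoc]

theorem mul_rotate {a b c : ℤ} {x y z : Ext k L} (hx : x ∈ parity k L a)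
    (hy : y ∈ parity k L b) (hz : z ∈ parity k L c) :
    x * y * z = sg k ((a + b) * c) • (z * x * y) := by
  rw [mul_comm_of_parity (parity_mul hx hy) hz, mul_assoc]

theorem sg_smul_eq {a b : ℤ} (h : Even (a - b)) (x : Ext k L) : sg k a • x = sg k b • x := by
  rw [sg_congr k h]

section Three

variable (m : Fin 3 → Ext k L) (t : Fin 3 → ℤ) (h : ∀ i, m i ∈ parity k L (1 + t i))

/-- The composite in which only the input `i` is not differentiated. -/
def solidOne (m : Fin 3 → Ext k L) : Fin 3 → Ext k L :=
  ![m 0 * dd (m 1) * dd (m 2), - (inv (dd (m 0)) * m 1 * dd (m 2)),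
    inv (dd (m 0)) * inv (dd (m 1)) * m 2]

/-- The composite in which only the input `i` is differentiated. -/
def wavyOne (m : Fin 3 → Ext k L) : Fin 3 → Ext k L :=
  ![dd (m 0) * inv (m 1) * m 2, inv (m 0) * inv (dd (m 1)) * m 2, inv (m 0) * m 1 * dd (m 2)]

/-- The composite in which no input is differentiated. -/
def wavyNone (m : Fin 3 → Ext k L) : Ext k L := m 0 * inv (m 1) * m 2

/-- Expand by Leibniz and `dd² = 0`. Two `∘` leave exactly one factor undifferentiated, one `∘` and
one `•` differentiate exactly one, two `•` none; only `opS` over `opB` differentiates a product and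
gives two terms. -/
theorem opTreeVal_eq (c : Fin 3) : let m' := ![m (c.succAbove 0), m (c.succAbove 1), m c]
    opTreeVal m c opC opC = solidOne m' 0 ∧
    opTreeVal m c opC opS = solidOne m' 1 ∧
    opTreeVal m c opS opC = - solidOne m' 2 ∧
    opTreeVal m c opS opS = solidOne m' 2 ∧
    opTreeVal m c opC opB = - wavyOne m' 2 ∧
    opTreeVal m c opS opB = wavyOne m' 1 - wavyOne m' 0 ∧
    opTreeVal m c opB opC = - wavyOne m' 1 ∧
    opTreeVal m c opB opS = wavyOne m' 0 ∧
    opTreeVal m c opB opB = wavyNone m' := by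
  have hs : (Equiv.swap (0 : Fin 2) 1) ≠ 1 := by decide
  intro m'
  simp only [m', opTreeVal, opVal, solidOne, wavyOne, wavyNone, hs, if_true, if_false,
    Matrix.cons_val_zero, Matrix.cons_val_one, Matrix.cons_val]
  simp only [ctr_mul, ctr_ctr, ctr_inv, inv_inv, map_mul, map_neg, map_add, map_zero, mul_zero,
    add_zero, neg_mul, neg_neg, add_mul, neg_add_rev, mul_assoc, true_and, zero_mul, neg_zero,
    zero_add, sub_eq_add_neg]
  exact ⟨add_comm _ _, trivial⟩

-- In the shape with outer leaf `1` the factors come in the order `0, 2, 1`. Graded commutativity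
-- restores the order, and the sign left over next to the Koszul sign of tree degrees is found by
-- cases on the parities of `t`.
include h in
theorem reorder_one :
    let m' := ![m 0, m 2, m 1]
    let s := sg k (t 1 * t 2)
    s • solidOne m' 0 = solidOne m 0 ∧ s • solidOne m' 1 = - solidOne m 2 ∧
    s • solidOne m' 2 = - solidOne m 1 ∧
    s • wavyOne m' 2 = wavyOne m 1 ∧ s • wavyOne m' 1 = wavyOne m 2 ∧
    s • wavyOne m' 0 = - wavyOne m 0 ∧ s • wavyNone m' = - wavyNone m := by
  intro m' s
  have hd := fun i => parity_ctr (coordSum k L) (h i)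
  simp only [m', s, solidOne, wavyOne, wavyNone, Matrix.cons_val_zero, Matrix.cons_val_one,
    Matrix.cons_val]
  simp only [inv_of_parity (h _), inv_of_parity (hd _)]
  rw [mul_swap_last _ (hd 2) (hd 1), mul_swap_last _ (h 2) (hd 1)]
  simp only [mul_smul_comm, smul_mul_assoc]
  rw [mul_swap_last _ (hd 2) (h 1), mul_swap_last _ (h 2) (hd 1), mul_swap_last _ (hd 2) (h 1),
    mul_swap_last _ (h 2) (h 1), mul_swap_last _ (h 2) (h 1)]
  simp only [smul_smul, ← sg_add, ← neg_smul, ← sg_add_one]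
  refine ⟨?_, ?_, ?_, ?_, ?_, ?_, ?_⟩
  · rw [sg_even, one_smul]
    simp only [Int.even_add, Int.even_mul, Int.not_even_one]
    by_cases h0 : Even (t 0) <;> by_cases h1 : Even (t 1) <;> by_cases h2 : Even (t 2) <;>
      simp [h1, h2]
  all_goals
    apply sg_smul_eq
    simp only [Int.even_add, Int.even_mul, Int.even_sub, Int.not_even_one]
    by_cases h0 : Even (t 0) <;> by_cases h1 : Even (t 1) <;> by_cases h2 : Even (t 2) <;>
      simp [h0, h1, h2]

include h in
theorem reorder_zero :
    let m' := ![m 1, m 2, m 0]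
    let s := sg k (t 0 * t 1 + t 0 * t 2)
    s • solidOne m' 0 = - solidOne m 1 ∧ s • solidOne m' 1 = - solidOne m 2 ∧
    s • solidOne m' 2 = solidOne m 0 ∧
    s • wavyOne m' 2 = wavyOne m 0 ∧ s • wavyOne m' 1 = - wavyOne m 2 ∧
    s • wavyOne m' 0 = - wavyOne m 1 ∧ s • wavyNone m' = wavyNone m := by
  intro m' s
  have hd := fun i => parity_ctr (coordSum k L) (h i)
  simp only [m', s, solidOne, wavyOne, wavyNone, Matrix.cons_val_zero, Matrix.cons_val_one,
    Matrix.cons_val]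
  simp only [inv_of_parity (h _), inv_of_parity (hd _)]
  simp only [mul_smul_comm, smul_mul_assoc]
  rw [mul_rotate (h 1) (hd 2) (hd 0), mul_rotate (hd 1) (h 2) (hd 0),
    mul_rotate (hd 1) (hd 2) (h 0), mul_rotate (h 1) (h 2) (hd 0), mul_rotate (h 1) (hd 2) (h 0),
    mul_rotate (hd 1) (h 2) (h 0), mul_rotate (h 1) (h 2) (h 0)]
  simp only [smul_smul, ← sg_add, ← neg_smul, ← sg_add_one]
  refine ⟨?_, ?_, ?_, ?_, ?_, ?_, ?_⟩
  case refine_3 =>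
    rw [sg_even, one_smul]
    simp only [Int.even_add, Int.even_mul, Int.not_even_one]
    by_cases h0 : Even (t 0) <;> by_cases h1 : Even (t 1) <;> by_cases h2 : Even (t 2) <;>
      simp [h0, h1, h2]
  all_goals
    apply sg_smul_eq
    simp only [Int.even_add, Int.even_mul, Int.even_sub, Int.not_even_one]
    by_cases h0 : Even (t 0) <;> by_cases h1 : Even (t 1) <;> by_cases h2 : Even (t 2) <;>
      simp [h0, h1, h2]

end Three

/-- The sign with which an operadic tree of shape `c` occurs in a relator. -/
theorem unshuffleExp_three (t : Fin 3 → ℤ) :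
    unshuffleExp t ({2}ᶜ : Finset (Fin 3)) = 0 ∧
    unshuffleExp t ({1}ᶜ : Finset (Fin 3)) = t 1 * t 2 ∧
    unshuffleExp t ({0}ᶜ : Finset (Fin 3)) = t 0 * t 1 + t 0 * t 2 := by
  have h2 : ({2}ᶜ : Finset (Fin 3)) = {0, 1} := by decide
  have h1 : ({1}ᶜ : Finset (Fin 3)) = {0, 2} := by decide
  have h0 : ({0}ᶜ : Finset (Fin 3)) = {1, 2} := by decide
  refine ⟨?_, ?_, ?_⟩
  · rw [unshuffleExp, compl_compl, h2, sum_pair (by decide), sum_singleton, sum_singleton]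
    simp
  · rw [unshuffleExp, compl_compl, h1, sum_pair (by decide), sum_singleton, sum_singleton]
    simp [mul_comm]
  · rw [unshuffleExp, compl_compl, h0, sum_pair (by decide), sum_singleton, sum_singleton]
    simp [mul_comm]

/-- The value of a tree with two vertices. -/
theorem QuadTerm.model_tree (q : QuadTerm (preLieGen k).signDual)
    (t : Fin 3 → Tree (preLieGen k).signDual L) :
    (q.tree t).model = ∑ o : Op 2 (-q.2.1.1), ∑ o' : Op 2 (-q.2.2.1),
      (q.2.1.2 (Finsupp.single o 1) * q.2.2.2 (Finsupp.single o' 1)) •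
        opTreeVal (fun i => (t i).model) q.1 ⟨_, o⟩ ⟨_, o'⟩ := by
  rw [QuadTerm.tree, Tree.model]
  refine sum_congr rfl fun o _ => ?_
  obtain ⟨g, hg⟩ := opVal_linear o ![0, (t q.1).model] 0
  have hg' : ∀ x, opVal o ![x, (t q.1).model] = g x := fun x => by
    rw [← hg]; congr 1; ext i; fin_cases i <;> rfl
  have e1 : (fun i => (![Tree.node 2 q.2.2.1 q.2.2.2 ![t (q.1.succAbove 0), t (q.1.succAbove 1)],
      t q.1] i).model) = ![(Tree.node 2 q.2.2.1 q.2.2.2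
        ![t (q.1.succAbove 0), t (q.1.succAbove 1)]).model, (t q.1).model] := by
    ext i; fin_cases i <;> rfl
  rw [e1, hg', Tree.model, map_sum, smul_sum]
  refine sum_congr rfl fun o' _ => ?_
  have e2 : (fun j => (![t (q.1.succAbove 0), t (q.1.succAbove 1)] j).model)
      = ![(t (q.1.succAbove 0)).model, (t (q.1.succAbove 1)).model] := by
    ext j; fin_cases j <;> rfl
  rw [map_smul, smul_smul, ← hg', opTreeVal, e2]

/-- Sum over the three binary operations. -/
def opSum {V : Type*} [AddCommGroup V] (F : BinOp → V) : V := F opC + F opS + F opB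

theorem pairQuad_elTree (q : QuadTerm (preLieGen k).signDual) (a : k) (c : Fin 3) (o o' : BinOp) :
    pairQuad (Finsupp.single q a) (elTree k c o o') = if q.1 = c then
      a * (sg k (unshuffleExp (fun _ => 1) ({c}ᶜ : Finset (Fin 3))) *
        pairGen q.2.1 (o.elt k) * pairGen q.2.2 (o'.elt k)) else 0 := by
  rw [elTree, pairQuad_single]
  by_cases h : q.1 = c
  · simp [h]
  · simp [h]

/-- The value of a combination of two-vertex trees depends only on its pairings with the 27
elementary trees. The unshuffle sign is inserted to cancel the one in the definition of the pairing.
-/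
theorem model_sum (x : QuadTerm (preLieGen k).signDual →₀ k)
    (t : Fin 3 → Tree (preLieGen k).signDual L) :
    (x.sum fun q α => (α * sg k (unshuffleExp (fun i => (t i).deg) {q.1}ᶜ)) • (q.tree t).model)
      = ∑ c : Fin 3, opSum fun o => opSum fun o' => pairQuad x (elTree k c o o') •
        ((sg k (unshuffleExp (fun _ => 1) ({c}ᶜ : Finset (Fin 3))) *
          sg k (unshuffleExp (fun i => (t i).deg) {c}ᶜ)) •
            opTreeVal (fun i => (t i).model) c o o') := by
  induction x using Finsupp.induction_linear with
  | zero => simp [opSum, pairQuad]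
  | add x y hx hy =>
    rw [Finsupp.sum_add_index' (by simp) (by intros; rw [add_mul, add_smul]), hx, hy,
      ← sum_add_distrib]
    refine sum_congr rfl fun c _ => ?_
    simp only [pairQuad_add_left, opSum, add_smul]
    abel
  | single q a =>
    rw [Finsupp.sum_single_index (by simp), QuadTerm.model_tree, sum_eq_single q.1]
    · simp only [pairQuad_elTree, if_true]
      simp only [mul_smul, ← smul_sum]
      have e1 := fun o => sum_eq_pairGen q.2.2.2
        (fun o' => opTreeVal (fun i => (t i).model) q.1 ⟨-q.2.1.1, o⟩ o')
      have e2 := sum_eq_pairGen q.2.1.2 (fun o => opSum fun o' => pairGen q.2.2 (o'.elt k) •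
        opTreeVal (fun i => (t i).model) q.1 o o')
      simp only [opSum] at e2
      simp only [e1, e2, opSum]
      simp only [smul_add, smul_smul]
      have hs := sg_mul_self k (unshuffleExp (fun _ => 1) ({q.1}ᶜ : Finset (Fin 3)))
      generalize sg k (unshuffleExp (fun _ => 1) ({q.1}ᶜ : Finset (Fin 3))) = s at *
      have hr : ∀ u v w : k, a * s * u * v * s * w = a * w * (u * v) := fun u v w => by
        linear_combination (a * u * v * w) * hs
      simp only [← mul_assoc, hr]
    · intro c _ hc
      simp [pairQuad_elTree, hc.symm, opSum]
    · simp

/-- After reordering, only seven products of the three factors remain: three with one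
undifferentiated factor, three with one differentiated factor and one with none differentiated.
Their coefficients are the seven pairings with the standard relators. -/
theorem model_relators (x : QuadTerm (preLieGen k).signDual →₀ k) (hx : x ∈ (dualPreLieTwo k).R)
    (t : Fin 3 → Tree (preLieGen k).signDual L) :
    (x.sum fun q α => (α * sg k (unshuffleExp (fun i => (t i).deg) {q.1}ᶜ)) • (q.tree t).model)
      = 0 := by
  rw [model_sum]
  have hp := fun i => (t i).model_parity
  rw [mem_dual_relators_iff] at hx
  have r0 := hx _ .c0
  have r1 := hx _ .c1
  have r2 := hx _ .c2
  have r3 := hx _ .b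
  have r4 := hx _ .m2
  have r5 := hx _ .m1
  have r6 := hx _ .m0
  simp only [pairQuad_add_right, pairQuad_sub_right] at r0 r1 r2 r3 r4 r5 r6
  obtain ⟨u2, u1, u0⟩ := unshuffleExp_three (fun i => (t i).deg)
  obtain ⟨v2, v1, v0⟩ := unshuffleExp_three (fun _ => 1)
  obtain ⟨a1, a2, a3, a4, a5, a6, a7⟩ := reorder_one (fun i => (t i).model) _ hp
  obtain ⟨b1, b2, b3, b4, b5, b6, b7⟩ := reorder_zero (fun i => (t i).model) _ hp
  generalize hm : (fun i => (t i).model) = m at *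
  have hm' : ∀ i, (t i).model = m i := fun i => congrFun hm i
  simp only [hm'] at a1 a2 a3 a4 a5 a6 a7 b1 b2 b3 b4 b5 b6 b7
  rw [Fin.sum_univ_three, u2, u1, u0, v2, v1, v0]
  obtain ⟨c1, c2, c3, c4, c5, c6, c7, c8, c9⟩ := opTreeVal_eq m 0
  obtain ⟨d1, d2, d3, d4, d5, d6, d7, d8, d9⟩ := opTreeVal_eq m 1
  obtain ⟨e1, e2, e3, e4, e5, e6, e7, e8, e9⟩ := opTreeVal_eq m 2
  simp only [show (0 : Fin 3).succAbove 0 = 1 from rfl, show (0 : Fin 3).succAbove 1 = 2 from rfl,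
    show (1 : Fin 3).succAbove 0 = 0 from rfl, show (1 : Fin 3).succAbove 1 = 2 from rfl,
    show (2 : Fin 3).succAbove 0 = 0 from rfl, show (2 : Fin 3).succAbove 1 = 1 from rfl]
    at c1 c2 c3 c4 c5 c6 c7 c8 c9 d1 d2 d3 d4 d5 d6 d7 d8 d9 e1 e2 e3 e4 e5 e6 e7 e8 e9
  have w2 : ![m 0, m 1, m 2] = m := by ext i; fin_cases i <;> rfl
  rw [w2] at e1 e2 e3 e4 e5 e6 e7 e8 e9
  have s1 : sg k ((1 : ℤ) * 1) = -1 := sg_one k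
  have s0 : sg k ((1 : ℤ) * 1 + 1 * 1) = 1 := sg_even k ⟨1, rfl⟩
  simp only [opSum, c1, c2, c3, c4, c5, c6, c7, c8, c9, d1, d2, d3, d4, d5, d6, d7, d8, d9, e1, e2,
    e3, e4, e5, e6, e7, e8, e9, mul_smul, smul_neg, smul_sub, a1, a2, a3, a4, a5, a6, a7, b1, b2,
    b3, b4, b5, b6, b7, s1, s0, sg_zero, one_smul, neg_smul, neg_neg]
  -- Pre-Lie relators match `solidOne`, Jacobi matches `wavyNone`, and the compatibility relators
  -- match `wavyOne`.
  linear_combination (norm := module) r0 • solidOne m 0 + r1 • solidOne m 1 - r2 • solidOne m 2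
    + r3 • wavyNone m - r4 • wavyOne m 2 + r5 • wavyOne m 1 - r6 • wavyOne m 0

theorem model_eq_zero_of_rel {x : Tree (preLieGen k).signDual L →₀ k}
    (hx : OpRel ((dualPreLieTwo k).relators L) x) :
    Finsupp.linearCombination k Tree.model x = 0 := by
  induction hx with
  | rel x hx =>
    obtain ⟨y, hy, t, rfl⟩ := hx
    rw [Finsupp.sum, map_sum]
    simp only [Finsupp.linearCombination_single]
    exact model_relators y hy t
  | add n d e e' ch =>
    simp only [map_sub, Finsupp.linearCombination_single, one_smul]
    simp only [Tree.model, LinearMap.add_apply, add_smul, sum_add_distrib]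
    abel
  | smul n d a e ch =>
    simp only [map_sub, Finsupp.linearCombination_single, one_smul]
    simp only [Tree.model, LinearMap.smul_apply, smul_sum, smul_smul, smul_eq_mul, sub_self]
  | perm n d σ e ch =>
    simp only [map_sub, Finsupp.linearCombination_single, one_smul]
    rw [sub_eq_zero]
    simp only [Tree.model, smul_sum]
    -- After renaming the operations by `σ`, the sign in the dual representation meets the one of
    -- `opVal_perm`, and their product is `1`.
    rw [← Equiv.sum_comp (MulAction.toPerm σ)]
    refine sum_congr rfl fun o _ => ?_
    rw [MulAction.toPerm_apply, opVal_perm o σ _ (fun i => (ch i).deg)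
      (fun i => (ch i).model_parity), smul_smul]
    have : (preLieGen k).signDual.act n d σ e (Finsupp.single (σ • o) 1)
        = ((((Equiv.Perm.sign σ : ℤˣ) : ℤ) : k)) * e (Finsupp.single o 1) := by
      change ((((Equiv.Perm.sign σ : ℤˣ) : ℤ) : k)) •
        e (Finsupp.lmapDomain k k (fun x => σ⁻¹ • x) (Finsupp.single (σ • o) 1)) = _
      rw [Finsupp.lmapDomain_apply, Finsupp.mapDomain_single, inv_smul_smul, smul_eq_mul]
    rw [this, smul_smul]
    have hs : ((((Equiv.Perm.sign σ : ℤˣ) : ℤ) : k)) * ((((Equiv.Perm.sign σ : ℤˣ) : ℤ) : k))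
        = 1 := by
      rw [← Int.cast_mul, ← Units.val_mul, Int.units_mul_self]; simp
    congr 1
    linear_combination (e (Finsupp.single o 1) * sg k (koszulExp (fun i => (ch i).deg) σ)) * hs
  | graft n d e ch i x hx ih =>
    rw [Finsupp.linearCombination_mapDomain]
    have : ∃ g : Ext k L →ₗ[k] Ext k L, ∀ t,
        (Tree.node n d e (Function.update ch i t)).model = g t.model := by
      choose g hg using fun o : Op n (-d) => opVal_linear (k := k) o (fun i => (ch i).model) i
      refine ⟨∑ o, e (Finsupp.single o 1) • g o, fun t => ?_⟩
      rw [Tree.model, LinearMap.sum_apply]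
      refine sum_congr rfl fun o _ => ?_
      rw [LinearMap.smul_apply, ← hg]
      congr 2
      ext1 j
      by_cases hj : j = i
      · subst hj; simp
      · simp [hj]
    obtain ⟨g, hg⟩ := this
    have e1 : Tree.model ∘ (fun t => Tree.node n d e (Function.update ch i t))
        = g ∘ Tree.model := funext hg
    rw [e1, ← LinearMap.map_finsupp_linearCombination, ih, map_zero]

/-- The value in the exterior algebra, on classes of trees. -/
def modelHom (k : Type u) [Field k] (L : Type) : (dualPreLieTwo k).Space L →ₗ[k] Ext k L :=
  Submodule.liftQ _ (Finsupp.linearCombination k Tree.model) (by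
    rw [Submodule.span_le]
    exact fun x hx => model_eq_zero_of_rel hx)

theorem modelHom_cls (T : Tree (preLieGen k).signDual L) :
    modelHom k L (cls _ T) = T.model := by
  change Finsupp.linearCombination k Tree.model (Finsupp.single T 1) = _
  rw [Finsupp.linearCombination_single, one_smul]

end Model

/-! ### Computing with classes of decorated trees. -/

section ClsLemmas

variable {k : Type u} [Field k] {M : GrSMod k} {L : Type} (S : Set (Tree M L →₀ k))

theorem mk_eq_zero_of_rel {x : Tree M L →₀ k} (h : OpRel S x) :
    (Submodule.Quotient.mk x : OpSpace S) = 0 :=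
  (Submodule.Quotient.mk_eq_zero _).2 (Submodule.subset_span h)

theorem mk_single (T : Tree M L) (a : k) :
    (Submodule.Quotient.mk (Finsupp.single T a) : OpSpace S) = a • cls S T := by
  rw [cls, ← Submodule.Quotient.mk_smul, Finsupp.smul_single, smul_eq_mul, mul_one]

theorem cls_node_add (n : ℕ) (d : ℤ) (e e' : M.X n d) (ch : Fin n → Tree M L) :
    cls S (.node n d (e + e') ch) = cls S (.node n d e ch) + cls S (.node n d e' ch) := by
  have h := mk_eq_zero_of_rel S (OpRel.add n d e e' ch)
  rw [Submodule.Quotient.mk_sub, Submodule.Quotient.mk_sub, sub_sub, sub_eq_zero] at h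
  exact h

theorem cls_node_smul (n : ℕ) (d : ℤ) (a : k) (e : M.X n d) (ch : Fin n → Tree M L) :
    cls S (.node n d (a • e) ch) = a • cls S (.node n d e ch) := by
  have h := mk_eq_zero_of_rel S (OpRel.smul n d a e ch)
  rw [Submodule.Quotient.mk_sub, sub_eq_zero, mk_single S _ a] at h
  exact h

theorem cls_node_perm (n : ℕ) (d : ℤ) (σ : Equiv.Perm (Fin n)) (e : M.X n d)
    (ch : Fin n → Tree M L) : cls S (.node n d (M.act n d σ e) ch)
      = sg k (koszulExp (fun i => (ch i).deg) σ) • cls S (.node n d e (ch ∘ σ)) := by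
  have h := mk_eq_zero_of_rel S (OpRel.perm n d σ e ch)
  rw [Submodule.Quotient.mk_sub, sub_eq_zero, mk_single S _ (sg k _)] at h
  exact h

theorem cls_node_neg (n : ℕ) (d : ℤ) (e : M.X n d) (ch : Fin n → Tree M L) :
    cls S (.node n d (-e) ch) = - cls S (.node n d e ch) := by
  rw [← neg_one_smul k, cls_node_smul, neg_one_smul]

theorem cls_node_zero (n : ℕ) (d : ℤ) (ch : Fin n → Tree M L) :
    cls S (.node n d (0 : M.X n d) ch) = 0 := by
  rw [← zero_smul k (0 : M.X n d), cls_node_smul, zero_smul]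

theorem graftAt_cls (n : ℕ) (d : ℤ) (e : M.X n d) (ch : Fin n → Tree M L) (i : Fin n)
    (T : Tree M L) :
    graftAt S n d e ch i (cls S T) = cls S (.node n d e (Function.update ch i T)) := by
  simp [graftAt, cls, Finsupp.lmapDomain_apply, Finsupp.mapDomain_single]

/-- Grafting is linear on classes, so a subtree may be replaced by the elements whose span contains
its class. -/
theorem cls_node_update_mem (n : ℕ) (d : ℤ) (e : M.X n d) (ch : Fin n → Tree M L) (i : Fin n)
    (V : Submodule k (OpSpace S)) (W : Set (OpSpace S)) {T : Tree M L}
    (hT : cls S T ∈ Submodule.span k W) (h : ∀ w ∈ W, graftAt S n d e ch i w ∈ V) :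
    cls S (.node n d e (Function.update ch i T)) ∈ V := by
  rw [← graftAt_cls]
  have : Submodule.span k W ≤ V.comap (graftAt S n d e ch i) := Submodule.span_le.2 h
  exact this hT

end ClsLemmas

/-! ### Generators and explicit relators of the dual operad. -/

section Combs

variable {k : Type u} [Field k] {L : Type}

/-- The generator of `P^!` dual to `x ∘ y`. -/
def dualC (k : Type u) [Field k] : (preLieGen k).signDual.X 2 0 :=
  (Finsupp.lapply (Op.circ 1) : (Op 2 0 →₀ k) →ₗ[k] k)

/-- The generator of `P^!` dual to `y ∘ x`. -/
def dualS (k : Type u) [Field k] : (preLieGen k).signDual.X 2 0 :=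
  (Finsupp.lapply (Op.circ (Equiv.swap 0 1)) : (Op 2 0 →₀ k) →ₗ[k] k)

/-- The generator of `P^!` dual to `[x • y]`. -/
def dualB (k : Type u) [Field k] : (preLieGen k).signDual.X 2 (-1) :=
  (Finsupp.lapply Op.bullet : (Op 2 1 →₀ k) →ₗ[k] k)

/-- The tree with root the dual of `x ∘ y`. -/
def treeC (u v : Tree (preLieGen k).signDual L) : Tree (preLieGen k).signDual L :=
  .node 2 0 (dualC k) ![u, v]

/-- The tree with root the dual of `[x • y]`. -/
def treeB (u v : Tree (preLieGen k).signDual L) : Tree (preLieGen k).signDual L :=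
  .node 2 (-1) (dualB k) ![u, v]

theorem Op.sub_zero_cases (o : Op 2 0) : o = .circ 1 ∨ o = .circ (Equiv.swap 0 1) := by
  have := mem_univ o
  rw [Op.univ_zero] at this
  simpa using this

theorem act_dualC : (preLieGen k).signDual.act 2 0 (Equiv.swap 0 1) (dualC k) = - dualS k := by
  apply Finsupp.lhom_ext'
  intro o
  ext
  change (((Equiv.Perm.sign (Equiv.swap (0 : Fin 2) 1) : ℤˣ) : ℤ) : k) •
    (Finsupp.lmapDomain k k (fun x : Op 2 0 => (Equiv.swap (0 : Fin 2) 1)⁻¹ • x)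
      (Finsupp.single o 1)) (.circ 1) = - (Finsupp.single o (1 : k)) (.circ (Equiv.swap 0 1))
  rw [Finsupp.lmapDomain_apply, Finsupp.mapDomain_single, Equiv.Perm.sign_swap (by decide)]
  have hne : (Op.circ (Equiv.swap 0 1) : Op 2 0) ≠ .circ 1 := by
    intro h; injection h with h; revert h; decide
  rcases o.sub_zero_cases with rfl | rfl
  · have : (Equiv.swap (0 : Fin 2) 1)⁻¹ • (Op.circ 1 : Op 2 0) = .circ (Equiv.swap 0 1) := rfl
    rw [this]
    simp [hne, hne.symm]
  · have : (Equiv.swap (0 : Fin 2) 1)⁻¹ • (Op.circ (Equiv.swap 0 1) : Op 2 0) = .circ 1 := by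
      change Op.circ _ = _
      congr 1
      exact inv_mul_cancel _
    rw [this]
    simp

theorem act_dualB :
    (preLieGen k).signDual.act 2 (-1) (Equiv.swap 0 1) (dualB k) = - dualB k := by
  apply Finsupp.lhom_ext'
  intro o
  ext
  change (((Equiv.Perm.sign (Equiv.swap (0 : Fin 2) 1) : ℤˣ) : ℤ) : k) •
    (Finsupp.lmapDomain k k (fun x : Op 2 1 => (Equiv.swap (0 : Fin 2) 1)⁻¹ • x)
      (Finsupp.single o 1)) .bullet = - (Finsupp.single o (1 : k)) .bullet
  rw [Finsupp.lmapDomain_apply, Finsupp.mapDomain_single, Equiv.Perm.sign_swap (by decide)]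
  have : (Equiv.swap (0 : Fin 2) 1)⁻¹ • o = o := by cases o; rfl
  rw [this]
  simp

theorem dualGen_decomp (d : ℤ) (e : (preLieGen k).signDual.X 2 d) :
    (∃ (h : d = 0) (a b : k), h ▸ e = a • dualC k + b • dualS k) ∨
    (∃ (h : d = -1) (a : k), h ▸ e = a • dualB k) ∨ e = 0 := by
  by_cases h0 : d = 0
  · subst h0
    refine .inl ⟨rfl, e (Finsupp.single (.circ 1) 1),
      e (Finsupp.single (.circ (Equiv.swap 0 1)) 1), ?_⟩
    have hne : (Op.circ (Equiv.swap 0 1) : Op 2 0) ≠ .circ 1 := by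
      intro h; injection h with h; revert h; decide
    refine Finsupp.lhom_ext' fun o => LinearMap.ext_ring ?_
    change e (Finsupp.single o 1) = e _ * (Finsupp.single o (1 : k) : Op 2 0 →₀ k) (.circ 1)
      + e _ * (Finsupp.single o (1 : k) : Op 2 0 →₀ k) (.circ (Equiv.swap 0 1))
    rcases Op.sub_zero_cases o with rfl | rfl
    · simp [hne]
    · simp [hne.symm]
  by_cases h1 : d = -1
  · subst h1
    refine .inr (.inl ⟨rfl, e (Finsupp.single (.bullet : Op 2 1) 1), ?_⟩)
    refine Finsupp.lhom_ext' fun o => LinearMap.ext_ring ?_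
    change e (Finsupp.single o 1) = e _ * (Finsupp.single o (1 : k) : Op 2 1 →₀ k) .bullet
    change Op 2 1 at o
    cases o
    simp
  · refine .inr (.inr ?_)
    have : IsEmpty (Op 2 (-d)) := by
      refine ⟨fun o => ?_⟩
      have key : ∀ δ, Op 2 δ → δ = 0 ∨ δ = 1 := by rintro _ (_ | _) <;> simp
      rcases key _ o with h | h <;> omega
    apply Finsupp.lhom_ext'
    intro o
    exact this.elim o

/-- The space of classes of trees in `P^!`. -/
abbrev DSpace (k : Type u) [Field k] (L : Type) : Type u := (dualPreLieTwo k).Space L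

/-- The class of a tree in `P^!`. -/
abbrev dcls (T : Tree (preLieGen k).signDual L) : DSpace k L :=
  cls ((dualPreLieTwo k).relators L) T

theorem comp_swap_two {α : Type*} (u v : α) : ![u, v] ∘ (Equiv.swap (0 : Fin 2) 1) = ![v, u] := by
  ext i; fin_cases i <;> rfl

/-- Spans of one element absorb the Koszul signs, which are irrelevant for showing that combs
generate. -/
theorem dcls_treeB_swap (u v : Tree (preLieGen k).signDual L) :
    dcls (treeB u v) ∈ Submodule.span k {dcls (treeB v u)} := by
  have h := cls_node_perm ((dualPreLieTwo k).relators L) 2 (-1) (Equiv.swap 0 1) (dualB k) ![u, v]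
  rw [act_dualB, cls_node_neg, comp_swap_two] at h
  rw [Submodule.mem_span_singleton]
  exact ⟨_, by rw [neg_smul]; exact neg_eq_iff_eq_neg.2 h.symm⟩

theorem dcls_dualS (u v : Tree (preLieGen k).signDual L) :
    dcls (.node 2 0 (dualS k) ![u, v]) ∈ Submodule.span k {dcls (treeC v u)} := by
  have h := cls_node_perm ((dualPreLieTwo k).relators L) 2 0 (Equiv.swap 0 1) (dualC k) ![u, v]
  rw [act_dualC, cls_node_neg, comp_swap_two] at h
  rw [Submodule.mem_span_singleton]
  exact ⟨_, by rw [neg_smul]; exact neg_eq_iff_eq_neg.2 h.symm⟩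

theorem dcls_treeC_swap (u v : Tree (preLieGen k).signDual L) :
    dcls (treeC u v) ∈ Submodule.span k {dcls (.node 2 0 (dualS k) ![v, u])} := by
  have h := cls_node_perm ((dualPreLieTwo k).relators L) 2 0 (Equiv.swap 0 1) (dualC k) ![v, u]
  rw [act_dualC, cls_node_neg, comp_swap_two] at h
  rw [Submodule.mem_span_singleton]
  have hs := sg_mul_self k (koszulExp (fun i => ((![v, u] : Fin 2 → Tree _ L) i).deg)
    (Equiv.swap 0 1))
  refine ⟨- sg k (koszulExp (fun i => ((![v, u] : Fin 2 → Tree _ L) i).deg) (Equiv.swap 0 1)), ?_⟩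
  rw [neg_smul, ← smul_neg]
  erw [h]
  rw [smul_smul, hs, one_smul]
  rfl

/-- Rewriting by a relator of `P^!` with at most three terms. -/
theorem dcls_mem_of_relator {q₁ q₂ q₃ : QuadTerm (preLieGen k).signDual} {a b : k}
    (h : Finsupp.single q₁ 1 + Finsupp.single q₂ a + Finsupp.single q₃ b ∈ (dualPreLieTwo k).R)
    (t : Fin 3 → Tree (preLieGen k).signDual L) :
    dcls (q₁.tree t) ∈ Submodule.span k {dcls (q₂.tree t), dcls (q₃.tree t)} := by
  have hr := mk_eq_zero_of_rel ((dualPreLieTwo k).relators L) (OpRel.rel _ ⟨_, h, t, rfl⟩)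
  set s := fun q : QuadTerm (preLieGen k).signDual =>
    sg k (unshuffleExp (fun i => (t i).deg) {q.1}ᶜ) with hs
  have hadd : ∀ x y : QuadTerm (preLieGen k).signDual →₀ k,
      ((x + y).sum fun q α => Finsupp.single (q.tree t) (α * s q))
      = (x.sum fun q α => Finsupp.single (q.tree t) (α * s q))
        + y.sum fun q α => Finsupp.single (q.tree t) (α * s q) := fun x y =>
    Finsupp.sum_add_index' (by simp) (by intros; rw [add_mul, Finsupp.single_add])
  have hsingle : ∀ (q : QuadTerm (preLieGen k).signDual) (c : k),
      ((Finsupp.single q c).sum fun q α => Finsupp.single (q.tree t) (α * s q))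
        = Finsupp.single (q.tree t) (c * s q) := fun q c =>
    Finsupp.sum_single_index (by simp)
  erw [hadd, hadd, hsingle, hsingle, hsingle] at hr
  rw [Submodule.Quotient.mk_add, Submodule.Quotient.mk_add, mk_single, mk_single, mk_single,
    one_mul] at hr
  rw [Submodule.mem_span_pair]
  have hne : s q₁ * s q₁ = 1 := sg_mul_self k _
  -- The sign `s q₁` is its own inverse, so multiplying the relation by it isolates the first tree.
  refine ⟨-(s q₁ * (a * s q₂)), -(s q₁ * (b * s q₃)), ?_⟩
  have : s q₁ • (s q₁ • dcls (q₁.tree t) + (a * s q₂) • dcls (q₂.tree t)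
    + (b * s q₃) • dcls (q₃.tree t)) = 0 := by rw [hr, smul_zero]
  rw [smul_add, smul_add, smul_smul, hne, one_smul, smul_smul, smul_smul] at this
  rw [neg_smul, neg_smul, ← sub_eq_zero, ← neg_eq_zero, ← this]
  abel

theorem pairGen_table :
    pairGen ⟨0, dualC k⟩ (opC.elt k) = 1 ∧ pairGen ⟨0, dualC k⟩ (opS.elt k) = 0 ∧
    pairGen ⟨0, dualC k⟩ (opB.elt k) = 0 ∧ pairGen ⟨0, dualS k⟩ (opC.elt k) = 0 ∧
    pairGen ⟨0, dualS k⟩ (opS.elt k) = 1 ∧ pairGen ⟨0, dualS k⟩ (opB.elt k) = 0 ∧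
    pairGen ⟨-1, dualB k⟩ (opC.elt k) = 0 ∧ pairGen ⟨-1, dualB k⟩ (opS.elt k) = 0 ∧
    pairGen ⟨-1, dualB k⟩ (opB.elt k) = 1 := by
  have hne : (Op.circ (Equiv.swap 0 1) : Op 2 0) ≠ .circ 1 := by
    intro h; injection h with h; revert h; decide
  have e0 : ∀ (g : (preLieGen k).signDual.X 2 0) (o : Op 2 0),
      pairGen ⟨0, g⟩ (BinOp.elt k ⟨0, o⟩) = g (Finsupp.single o 1) := fun g o => by
    rw [pairGen, dif_pos]
    · rfl
    · rfl
  have e1 : ∀ (g : (preLieGen k).signDual.X 2 (-1)) (o : Op 2 1),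
      pairGen ⟨-1, g⟩ (BinOp.elt k ⟨1, o⟩) = g (Finsupp.single o 1) := fun g o => by
    rw [pairGen, dif_pos]
    · rfl
    · rfl
  have e2 : ∀ (g : (preLieGen k).signDual.X 2 0) (o : Op 2 1),
      pairGen ⟨0, g⟩ (BinOp.elt k ⟨1, o⟩) = 0 := fun g o => by
    rw [pairGen, dif_neg]
    simp [BinOp.elt]
  have e3 : ∀ (g : (preLieGen k).signDual.X 2 (-1)) (o : Op 2 0),
      pairGen ⟨-1, g⟩ (BinOp.elt k ⟨0, o⟩) = 0 := fun g o => by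
    rw [pairGen, dif_neg]
    simp [BinOp.elt]
  have fC : ∀ o : Op 2 0, dualC k (Finsupp.single o 1) = Finsupp.single o (1 : k) (.circ 1) :=
    fun o => rfl
  have fS : ∀ o : Op 2 0, dualS k (Finsupp.single o 1)
      = Finsupp.single o (1 : k) (.circ (Equiv.swap 0 1)) := fun o => rfl
  have fB : ∀ o : Op 2 1, dualB k (Finsupp.single o 1) = Finsupp.single o (1 : k) .bullet :=
    fun o => rfl
  rw [e0, e0, e2, e0, e0, e2, e3, e3, e1, fC, fC, fS, fS, fB]
  simp [hne, hne.symm]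

/-- The quadratic terms of `P^!`. -/
abbrev qt (c : Fin 3) {a b : ℤ} (g : (preLieGen k).signDual.X 2 a)
    (h : (preLieGen k).signDual.X 2 b) : QuadTerm (preLieGen k).signDual := (c, ⟨a, g⟩, ⟨b, h⟩)

/-- Each is orthogonal to the seven standard relators, by the table of pairings. Terms with
coefficient `0` pad the two-term relators to the common three-term shape of `dcls_mem_of_relator`.
-/
theorem dual_relators :
    (Finsupp.single (qt 0 (dualB k) (dualB k)) 1 + Finsupp.single (qt 2 (dualB k) (dualB k)) (-1)
      + Finsupp.single (qt 2 (dualB k) (dualB k)) 0 ∈ (dualPreLieTwo k).R) ∧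
    (Finsupp.single (qt 0 (dualB k) (dualC k)) 1 + Finsupp.single (qt 2 (dualC k) (dualB k)) 1
      + Finsupp.single (qt 2 (dualC k) (dualB k)) 0 ∈ (dualPreLieTwo k).R) ∧
    (Finsupp.single (qt 0 (dualS k) (dualC k)) 1 + Finsupp.single (qt 2 (dualC k) (dualC k)) 1
      + Finsupp.single (qt 2 (dualC k) (dualC k)) 0 ∈ (dualPreLieTwo k).R) ∧
    (Finsupp.single (qt 0 (dualS k) (dualB k)) 1 + Finsupp.single (qt 2 (dualC k) (dualB k)) (-1)
      + Finsupp.single (qt 1 (dualC k) (dualB k)) 1 ∈ (dualPreLieTwo k).R) ∧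
    (Finsupp.single (qt 1 (dualC k) (dualC k)) 1 + Finsupp.single (qt 2 (dualC k) (dualC k)) (-1)
      + Finsupp.single (qt 2 (dualC k) (dualC k)) 0 ∈ (dualPreLieTwo k).R) ∧
    (Finsupp.single (qt 1 (dualB k) (dualB k)) 1 + Finsupp.single (qt 2 (dualB k) (dualB k)) 1
      + Finsupp.single (qt 2 (dualB k) (dualB k)) 0 ∈ (dualPreLieTwo k).R) := by
  obtain ⟨t1, t2, t3, t4, t5, t6, t7, t8, t9⟩ := pairGen_table (k := k)
  obtain ⟨v2, v1, v0⟩ := unshuffleExp_three (fun _ => 1)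
  have s2 : sg k (unshuffleExp (fun _ => 1) ({2}ᶜ : Finset (Fin 3))) = 1 := by rw [v2, sg_zero]
  have s1 : sg k (unshuffleExp (fun _ => 1) ({1}ᶜ : Finset (Fin 3))) = -1 := by
    rw [v1]; exact sg_one k
  have s0 : sg k (unshuffleExp (fun _ => 1) ({0}ᶜ : Finset (Fin 3))) = 1 := by
    rw [v0]; exact sg_even k ⟨1, rfl⟩
  refine ⟨?_, ?_, ?_, ?_, ?_, ?_⟩ <;> rw [mem_dual_relators_iff] <;> intro r hr <;> cases hr <;>
    simp only [pairQuad_add_left, pairQuad_add_right, pairQuad_sub_right, pairQuad_elTree,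
      t1, t2, t3, t4, t5, t6, t7, t8, t9, s0, s1, s2] <;>
    simp

end Combs

/-! ### Rewriting rules in the dual operad. -/

section Rewriting

variable {k : Type u} [Field k] {L : Type}

theorem dcls_BB_assoc (u v w : Tree (preLieGen k).signDual L) :
    dcls (treeB (treeB v w) u) ∈ Submodule.span k {dcls (treeB (treeB u v) w)} := by
  have h := dcls_mem_of_relator dual_relators.1 ![u, v, w]
  rwa [Set.pair_eq_singleton] at h

theorem dcls_BC (u v w : Tree (preLieGen k).signDual L) :
    dcls (treeB (treeC v w) u) ∈ Submodule.span k {dcls (treeC (treeB u v) w)} := by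
  have h := dcls_mem_of_relator dual_relators.2.1 ![u, v, w]
  rwa [Set.pair_eq_singleton] at h

/-- Quadratic terms carry the upper vertex at the first input, so the relator is stated with `dualS`
and the root is turned around by `dcls_treeC_swap`. -/
theorem dcls_CC_assoc (u v w : Tree (preLieGen k).signDual L) :
    dcls (treeC u (treeC v w)) ∈ Submodule.span k {dcls (treeC (treeC u v) w)} := by
  have h := dcls_mem_of_relator dual_relators.2.2.1 ![u, v, w]
  rw [Set.pair_eq_singleton] at h
  refine Submodule.span_le.2 ?_ (dcls_treeC_swap u (treeC v w))
  rw [Set.singleton_subset_iff]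
  exact h

/-- The only rule with two terms: in the model it is the Leibniz rule for `dd` of a product. -/
theorem dcls_CB (u v w : Tree (preLieGen k).signDual L) :
    dcls (treeC u (treeB v w)) ∈
      Submodule.span k {dcls (treeC (treeB u v) w), dcls (treeC (treeB u w) v)} := by
  have h := dcls_mem_of_relator dual_relators.2.2.2.1 ![u, v, w]
  refine Submodule.span_le.2 ?_ (dcls_treeC_swap u (treeB v w))
  rw [Set.singleton_subset_iff]
  exact h

theorem dcls_CC_swap (u v w : Tree (preLieGen k).signDual L) :
    dcls (treeC (treeC u w) v) ∈ Submodule.span k {dcls (treeC (treeC u v) w)} := by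
  have h := dcls_mem_of_relator dual_relators.2.2.2.2.1 ![u, v, w]
  rwa [Set.pair_eq_singleton] at h

theorem dcls_BB_swap (u v w : Tree (preLieGen k).signDual L) :
    dcls (treeB (treeB u w) v) ∈ Submodule.span k {dcls (treeB (treeB u v) w)} := by
  have h := dcls_mem_of_relator dual_relators.2.2.2.2.2 ![u, v, w]
  rwa [Set.pair_eq_singleton] at h

theorem update_zero_two {α : Type*} (u v w : α) :
    Function.update ![u, v] (0 : Fin 2) w = ![w, v] := by
  ext i; fin_cases i <;> rfl

theorem update_one_two {α : Type*} (u v w : α) :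
    Function.update ![u, v] (1 : Fin 2) w = ![u, w] := by
  ext i; fin_cases i <;> rfl

/-- A submodule which contains `op w v` for the trees `w` whose classes span contains `op u v`
whenever the class of `u` is in that span. -/
theorem dcls_node_left {d : ℤ} (g : (preLieGen k).signDual.X 2 d)
    {u v : Tree (preLieGen k).signDual L} {W : Set (Tree (preLieGen k).signDual L)}
    {V : Submodule k (DSpace k L)} (hu : dcls u ∈ Submodule.span k (dcls '' W))
    (h : ∀ w ∈ W, dcls (.node 2 d g ![w, v]) ∈ V) : dcls (.node 2 d g ![u, v]) ∈ V := by
  have := cls_node_update_mem ((dualPreLieTwo k).relators L) 2 d g ![u, v] 0 V _ hu (by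
    rintro _ ⟨w, hw, rfl⟩
    rw [graftAt_cls, update_zero_two]
    exact h w hw)
  rwa [update_zero_two] at this

theorem dcls_node_right {d : ℤ} (g : (preLieGen k).signDual.X 2 d)
    {u v : Tree (preLieGen k).signDual L} {W : Set (Tree (preLieGen k).signDual L)}
    {V : Submodule k (DSpace k L)} (hv : dcls v ∈ Submodule.span k (dcls '' W))
    (h : ∀ w ∈ W, dcls (.node 2 d g ![u, w]) ∈ V) : dcls (.node 2 d g ![u, v]) ∈ V := by
  have := cls_node_update_mem ((dualPreLieTwo k).relators L) 2 d g ![u, v] 1 V _ hv (by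
    rintro _ ⟨w, hw, rfl⟩
    rw [graftAt_cls, update_one_two]
    exact h w hw)
  rwa [update_one_two] at this

end Rewriting

/-! ### Combs generate the dual operad. -/

section Combs

variable {k : Type u} [Field k] {L : Type}

/-- `(…(u • i₁) • …) • iₚ`. -/
def combB (u : Tree (preLieGen k).signDual L) (is : List L) : Tree (preLieGen k).signDual L :=
  is.foldl (fun u i => treeB u (.leaf i)) u

/-- `(…(u ∘ j₁) ∘ …) ∘ jₚ`. -/
def combC (u : Tree (preLieGen k).signDual L) (js : List L) : Tree (preLieGen k).signDual L :=
  js.foldl (fun u j => treeC u (.leaf j)) u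

/-- The comb `((…(i₀ • i₁) • …) ∘ j₁) ∘ …` -/
def comb (k : Type u) [Field k] : List L → List L → Tree (preLieGen k).signDual L
  | [], _ => .node 0 0 0 Fin.elim0
  | i :: is, js => combC (combB (.leaf i) is) js

/-- The combs with a given multiset of leaves and a given number of `•`. -/
def combSet (k : Type u) [Field k] (s : Multiset L) (q : ℕ) :
    Set (Tree (preLieGen k).signDual L) :=
  {T | ∃ is js : List L, is.length = q + 1 ∧ ((is ++ js : List L) : Multiset L) = s ∧
    T = comb k is js}

/-- The span of the classes of these combs. -/
def combSpan (k : Type u) [Field k] (s : Multiset L) (q : ℕ) : Submodule k (DSpace k L) :=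
  Submodule.span k (dcls '' combSet k s q)

theorem combC_append (u : Tree (preLieGen k).signDual L) (js : List L) (j : L) :
    combC u (js ++ [j]) = treeC (combC u js) (.leaf j) := by
  simp [combC, List.foldl_append]

theorem combB_append (u : Tree (preLieGen k).signDual L) (js : List L) (j : L) :
    combB u (js ++ [j]) = treeB (combB u js) (.leaf j) := by
  simp [combB, List.foldl_append]

theorem comb_append_right {is : List L} (his : is ≠ []) (js : List L) (j : L) :
    comb k is (js ++ [j]) = treeC (comb k is js) (.leaf j) := by
  cases is with
  | nil => exact absurd rfl his
  | cons i is => exact combC_append _ _ _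

theorem comb_append_left {is : List L} (his : is ≠ []) (i : L) :
    comb k (is ++ [i]) [] = treeB (comb k is []) (.leaf i) := by
  cases is with
  | nil => exact absurd rfl his
  | cons i is => exact combB_append _ _ _

/-- Composition with `v` on the right maps combs to combinations of combs. -/
def CombClosed (v : Tree (preLieGen k).signDual L) (s : Multiset L) (q : ℕ) : Prop :=
  ∀ (s' : Multiset L) (q' : ℕ) (u : Tree (preLieGen k).signDual L), dcls u ∈ combSpan k s' q' →
    dcls (treeC u v) ∈ combSpan k (s' + s) (q' + q) ∧
    dcls (treeB u v) ∈ combSpan k (s' + s) (q' + q + 1)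

theorem mem_of_mem_span_singleton {x y : DSpace k L} {V : Submodule k (DSpace k L)}
    (h : x ∈ Submodule.span k {y}) (hy : y ∈ V) : x ∈ V :=
  (Submodule.span_singleton_le_iff_mem _ _).2 hy h

/-- Composing by `∘` with a leaf lengthens a comb. A leaf joined by `•` has to be moved inwards,
past the leaves appended by `∘`. -/
theorem combClosed_leaf (j : L) : CombClosed (k := k) (.leaf j) {j} 0 := by
  have hC : ∀ (s' : Multiset L) (q' : ℕ) (u : Tree (preLieGen k).signDual L),
      dcls u ∈ combSpan k s' q' → dcls (treeC u (.leaf j)) ∈ combSpan k (s' + {j}) q' := by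
    intro s' q' u hu
    refine dcls_node_left _ hu ?_
    rintro _ ⟨is, js, h1, h2, rfl⟩
    refine Submodule.subset_span ⟨_, ⟨is, js ++ [j], h1, ?_, rfl⟩, ?_⟩
    · rw [← h2, ← List.append_assoc, ← Multiset.coe_add, Multiset.coe_singleton]
    · rw [comb_append_right (by rintro rfl; simp at h1)]
      rfl
  have hC' : ∀ (i : L) (s' : Multiset L) (q' : ℕ) (u : Tree (preLieGen k).signDual L),
      dcls u ∈ combSpan k s' q' → dcls (treeC u (.leaf i)) ∈ combSpan k (s' + {i}) q' := by
    intro i s' q' u hu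
    refine dcls_node_left _ hu ?_
    rintro _ ⟨is, js, h1, h2, rfl⟩
    refine Submodule.subset_span ⟨_, ⟨is, js ++ [i], h1, ?_, rfl⟩, ?_⟩
    · rw [← h2, ← List.append_assoc, ← Multiset.coe_add, Multiset.coe_singleton]
    · rw [comb_append_right (by rintro rfl; simp at h1)]
      rfl
  -- Induction on the leaves appended by `∘`: `dcls_BC` exchanges the new `•` with the outermost
  -- `∘`, whose leaf is put back by `hC'`.
  have hB : ∀ (js is : List L) (q' : ℕ), is.length = q' + 1 →
      dcls (treeB (comb k is js) (.leaf j)) ∈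
        combSpan k (((is ++ js : List L) : Multiset L) + {j}) (q' + 1) := by
    intro js
    induction js using List.reverseRecOn with
    | nil =>
      intro is q' h1
      rw [← comb_append_left (by rintro rfl; simp at h1)]
      refine Submodule.subset_span ⟨_, ⟨is ++ [j], [], by simp [h1], ?_, rfl⟩, rfl⟩
      rw [List.append_nil, List.append_nil, ← Multiset.coe_add, Multiset.coe_singleton]
    | append_singleton js i ih =>
      intro is q' h1
      rw [comb_append_right (by rintro rfl; simp at h1)]
      refine mem_of_mem_span_singleton (dcls_BC _ _ _) ?_
      have e : ((is ++ (js ++ [i]) : List L) : Multiset L) + {j}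
          = ((is ++ js : List L) : Multiset L) + {j} + {i} := by
        rw [← List.append_assoc, ← Multiset.coe_add, Multiset.coe_singleton, add_right_comm]
      rw [e]
      exact hC' _ _ _ _ (mem_of_mem_span_singleton (dcls_treeB_swap _ _) (ih is q' h1))
  intro s' q' u hu
  refine ⟨hC s' q' u hu, dcls_node_left _ hu ?_⟩
  rintro _ ⟨is, js, h1, rfl, rfl⟩
  exact hB js is q' h1

/-- The rules `dcls_CB` and `dcls_BB_assoc` replace multiplication by `v • i` by successive
multiplications by `v` and by the leaf, both known to preserve combs. -/
theorem combClosed_treeB {v : Tree (preLieGen k).signDual L} {s : Multiset L} {q : ℕ}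
    (hv : CombClosed v s q) (i : L) : CombClosed (treeB v (.leaf i)) (s + {i}) (q + 1) := by
  intro s' q' u hu
  constructor
  · refine Submodule.span_le.2 ?_ (dcls_CB u v (.leaf i))
    rintro x (rfl | rfl)
    · have := (combClosed_leaf i _ _ _ (hv _ _ _ hu).2).1
      rwa [add_assoc] at this
    · have := (hv _ _ _ (combClosed_leaf i _ _ _ hu).2).1
      rwa [add_assoc, add_comm ({i} : Multiset L), show q' + 0 + 1 + q = q' + (q + 1) by ring] at this
  · refine mem_of_mem_span_singleton (dcls_treeB_swap _ _) ?_
    refine mem_of_mem_span_singleton (dcls_BB_assoc _ _ _) ?_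
    have := (combClosed_leaf i _ _ _ (hv _ _ _ hu).2).2
    rwa [add_assoc] at this

/-- Same mechanism for `v ∘ j`, with `dcls_CC_assoc` and `dcls_BC`. -/
theorem combClosed_treeC {v : Tree (preLieGen k).signDual L} {s : Multiset L} {q : ℕ}
    (hv : CombClosed v s q) (j : L) : CombClosed (treeC v (.leaf j)) (s + {j}) q := by
  intro s' q' u hu
  constructor
  · refine mem_of_mem_span_singleton (dcls_CC_assoc _ _ _) ?_
    have := (combClosed_leaf j _ _ _ (hv _ _ _ hu).1).1
    rwa [add_assoc] at this
  · refine mem_of_mem_span_singleton (dcls_treeB_swap _ _) ?_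
    refine mem_of_mem_span_singleton (dcls_BC _ _ _) ?_
    have := (combClosed_leaf j _ _ _ (hv _ _ _ hu).2).1
    rwa [add_assoc] at this

theorem combClosed_comb {is : List L} {q : ℕ} (h : is.length = q + 1) (js : List L) :
    CombClosed (comb k is js) ((is ++ js : List L) : Multiset L) q := by
  have hB : ∀ (is : List L) (q : ℕ), is.length = q + 1 →
      CombClosed (comb k is []) ((is : List L) : Multiset L) q := by
    intro is
    induction is using List.reverseRecOn with
    | nil => intro q h; simp at h
    | append_singleton is i ih =>
      intro q h
      -- A comb with a single leaf in its first list is that leaf; otherwise its last `•` is split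
      -- off.
      cases is with
      | nil =>
        have : q = 0 := by simpa using h.symm
        subst this
        exact combClosed_leaf i
      | cons a is =>
        have : q = is.length + 1 := by simpa using h.symm
        subst this
        rw [comb_append_left (by simp), ← Multiset.coe_add, Multiset.coe_singleton]
        exact combClosed_treeB (ih is.length (by simp)) i
  induction js using List.reverseRecOn with
  | nil => rw [List.append_nil]; exact hB is q h
  | append_singleton js j ih =>
    rw [comb_append_right (by rintro rfl; simp at h), ← List.append_assoc, ← Multiset.coe_add,
      Multiset.coe_singleton]
    exact combClosed_treeC ih j

/-- By linearity the right factor may be taken to be a comb, and combs are closed on the right. -/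
theorem combSpan_mul {u v : Tree (preLieGen k).signDual L} {s s' : Multiset L} {q q' : ℕ}
    (hu : dcls u ∈ combSpan k s q) (hv : dcls v ∈ combSpan k s' q') :
    dcls (treeC u v) ∈ combSpan k (s + s') (q + q') ∧
    dcls (treeB u v) ∈ combSpan k (s + s') (q + q' + 1) := by
  constructor
  · refine dcls_node_right _ hv ?_
    rintro _ ⟨is, js, h1, rfl, rfl⟩
    exact (combClosed_comb h1 js _ _ _ hu).1
  · refine dcls_node_right _ hv ?_
    rintro _ ⟨is, js, h1, rfl, rfl⟩
    exact (combClosed_comb h1 js _ _ _ hu).2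

/-- The multiset of labels of the leaves. -/
def Tree.labels {M : GrSMod k} : Tree M L → Multiset L
  | .leaf l => {l}
  | .node _ _ _ ch => ∑ i, (ch i).labels

theorem Tree.count_eq_labels {M : GrSMod k} [DecidableEq L] (l : L) (T : Tree M L) :
    T.count l = T.labels.count l := by
  induction T with
  | leaf l' => simp [Tree.count, labels, Multiset.count_singleton, eq_comm]
  | node n d e ch ih => simp [Tree.count, labels, ih, Multiset.count_sum']

/-- Structural induction with `combSpan_mul`. The first alternative absorbs vertices whose
decoration vanishes because there are no generators in its arity or degree; in the second, every `•`
accounts for degree `-1`. -/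
theorem dcls_eq_zero_or (T : Tree (preLieGen k).signDual L) :
    dcls T = 0 ∨ ∃ q : ℕ, T.deg = -q ∧ dcls T ∈ combSpan k T.labels q := by
  induction T with
  | leaf l =>
    refine .inr ⟨0, by simp [Tree.deg], Submodule.subset_span ⟨_, ⟨[l], [], rfl, rfl, rfl⟩, rfl⟩⟩
  | node n d e ch ih =>
    by_cases hn : n = 2
    swap
    · have := (dualPreLieTwo k).binary n d hn
      have he : e = 0 := Subsingleton.elim (h := this) _ _
      subst he
      exact .inl (cls_node_zero _ _ _ _)
    subst hn
    have hch : ch = ![ch 0, ch 1] := by ext1 i; fin_cases i <;> rfl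
    have hz : ∀ i, dcls (ch i) = 0 → dcls (.node 2 d e ch) = 0 := by
      intro i hi
      have := graftAt_cls ((dualPreLieTwo k).relators L) 2 d e ch i (ch i)
      rwa [show cls _ (ch i) = 0 from hi, map_zero, Function.update_eq_self, eq_comm] at this
    rcases ih 0 with h0 | ⟨q0, d0, h0⟩
    · exact .inl (hz 0 h0)
    rcases ih 1 with h1 | ⟨q1, d1, h1⟩
    · exact .inl (hz 1 h1)
    have hl : (Tree.node 2 d e ch).labels = (ch 0).labels + (ch 1).labels := by
      rw [Tree.labels, Fin.sum_univ_two]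
    have hd : (Tree.node 2 d e ch).deg = d - (q0 + q1 : ℕ) := by
      rw [Tree.deg, Fin.sum_univ_two, d0, d1]; push_cast; ring
    rw [hl, hd]
    rcases dualGen_decomp d e with ⟨h, a, b, he⟩ | ⟨h, a, he⟩ | he
    · subst h
      simp only at he
      refine .inr ⟨q0 + q1, by ring, ?_⟩
      rw [hch, he, dcls, cls_node_add, cls_node_smul, cls_node_smul]
      refine Submodule.add_mem _ (Submodule.smul_mem _ _ (combSpan_mul h0 h1).1)
        (Submodule.smul_mem _ _ ?_)
      refine mem_of_mem_span_singleton (dcls_dualS _ _) ?_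
      have := (combSpan_mul h1 h0).1
      rwa [add_comm q1, add_comm (ch 1).labels] at this
    · subst h
      simp only at he
      refine .inr ⟨q0 + q1 + 1, by push_cast; ring, ?_⟩
      rw [hch, he, dcls, cls_node_smul]
      exact Submodule.smul_mem _ _ (combSpan_mul h0 h1).2
    · rw [he]
      exact .inl (cls_node_zero _ _ _ _)

theorem dcls_foldl_mem {d : ℤ} (g : (preLieGen k).signDual.X 2 d) (js : List L)
    {u v : Tree (preLieGen k).signDual L} (h : dcls u ∈ Submodule.span k {dcls v}) :
    dcls (js.foldl (fun u j => .node 2 d g ![u, .leaf j]) u) ∈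
      Submodule.span k {dcls (js.foldl (fun u j => .node 2 d g ![u, .leaf j]) v)} := by
  induction js generalizing u v with
  | nil => exact h
  | cons j js ih =>
    refine ih (dcls_node_left (W := {v}) _ (by simpa using h) ?_)
    rintro w rfl
    exact Submodule.mem_span_singleton_self _

/-- Adjacent transpositions suffice, and each is one use of `hg` below the remaining fold. Applied
both to `•` and to `∘`. -/
theorem dcls_foldl_perm {d : ℤ} (g : (preLieGen k).signDual.X 2 d)
    (hg : ∀ u v w : Tree (preLieGen k).signDual L, dcls (.node 2 d g ![.node 2 d g ![u, w], v]) ∈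
      Submodule.span k {dcls (.node 2 d g ![.node 2 d g ![u, v], w])})
    {js js' : List L} (h : js.Perm js') (u : Tree (preLieGen k).signDual L) :
    dcls (js.foldl (fun u j => .node 2 d g ![u, .leaf j]) u) ∈
      Submodule.span k {dcls (js'.foldl (fun u j => .node 2 d g ![u, .leaf j]) u)} := by
  induction h generalizing u with
  | nil => exact Submodule.mem_span_singleton_self _
  | cons j _ ih => exact ih _
  | swap a b l => exact dcls_foldl_mem g l (hg u (.leaf a) (.leaf b))
  | trans _ _ ih1 ih2 => exact mem_of_mem_span_singleton (ih1 u) (ih2 u)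

/-- Up to sign, a comb does not depend on the order of its leaves. -/
theorem dcls_comb_perm {is is' js js' : List L} (h : is.Perm is') (h' : js.Perm js') :
    dcls (comb k is js) ∈ Submodule.span k {dcls (comb k is' js')} := by
  have h1 : dcls (comb k is js) ∈ Submodule.span k {dcls (comb k is' js)} := by
    induction h with
    | nil => exact Submodule.mem_span_singleton_self _
    -- The head of the list is the innermost leaf. With a common head, permuting the tail needs
    -- `dcls_BB_swap`; exchanging the two innermost leaves is the symmetry of `•`.
    | cons a p _ => exact dcls_foldl_mem _ js (dcls_foldl_perm _ dcls_BB_swap p _)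
    | swap a b l =>
      exact dcls_foldl_mem _ js (dcls_foldl_mem _ l (dcls_treeB_swap (.leaf b) (.leaf a)))
    | trans _ _ ih1 ih2 => exact mem_of_mem_span_singleton ih1 ih2
  refine mem_of_mem_span_singleton h1 ?_
  cases is' with
  | nil => exact Submodule.mem_span_singleton_self _
  | cons a is' => exact dcls_foldl_perm _ dcls_CC_swap h' _

end Combs

/-! ### Coefficients of monomials in the exterior algebra. -/

section Coefficients

variable {k : Type u} [Field k] {L L' : Type}

/-- The coefficient of the product of the generators in a list. -/
def coefL (k : Type u) [Field k] : List L → Ext k L →ₗ[k] k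
  | [] => scal.toLinearMap
  | i :: l => coefL k l ∘ₗ pd i

theorem coefL_nil (x : Ext k L) : coefL k [] x = scal x := rfl

theorem coefL_cons (i : L) (l : List L) (x : Ext k L) : coefL k (i :: l) x = coefL k l (pd i x) :=
  rfl

/-- Contractions anticommute, so the one with `i` can be moved next to `x`. -/
theorem coefL_eq_zero {l : List L} {i : L} (hi : i ∈ l) {x : Ext k L} (hx : pd i x = 0) :
    coefL k l x = 0 := by
  induction l generalizing x with
  | nil => simp at hi
  | cons a l ih =>
    rw [coefL_cons]
    rcases List.mem_cons.1 hi with rfl | h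
    · rw [hx, map_zero]
    · refine ih h ?_
      rw [pd, ctr_comm, hx, map_zero, neg_zero]

theorem inversions_cons {n : ℕ} (a : Fin n) (l : List (Fin n)) :
    inversions (a :: l) = l.countP (fun b => decide (b < a)) + inversions l := rfl

/-- An adjacent transposition changes the sign of two anticommuting contractions and, its entries
being distinct, also the parity of the number of inversions. -/
theorem coefL_perm {n : ℕ} {l l' : List (Fin n)} (h : l.Perm l') (hl : l.Nodup)
    (x : Ext k (Fin n)) :
    sg k (inversions l) * coefL k l x = sg k (inversions l') * coefL k l' x := by
  induction h generalizing x with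
  | nil => rfl
  | @cons a l l' p ih =>
    rw [inversions_cons, inversions_cons, p.countP_eq]
    push_cast
    rw [sg_add, sg_add, coefL_cons, coefL_cons, mul_assoc, mul_assoc,
      ih (List.nodup_cons.1 hl).2]
  | swap a b l =>
    have hab : a ≠ b := by
      rintro rfl
      simp at hl
    have e : (inversions (b :: a :: l) : ℤ) + inversions (a :: b :: l)
        = 2 * (l.countP (fun c => decide (c < a)) + l.countP (fun c => decide (c < b))
          + inversions l) + 1 := by
      simp only [inversions_cons, List.countP_cons]
      rcases lt_or_gt_of_ne hab with h | h
      · simp [h, h.not_gt]; ring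
      · simp [h, h.not_gt]; ring
    have e2 : sg k (inversions (b :: a :: l)) = - sg k (inversions (a :: b :: l)) := by
      rw [← sg_add_one]
      refine sg_congr k ?_
      rw [show ((inversions (b :: a :: l) : ℤ)) - (inversions (a :: b :: l) + 1)
        = (inversions (b :: a :: l) + inversions (a :: b :: l) - 1)
          - 2 * inversions (a :: b :: l) by ring, e]
      exact ⟨(l.countP (fun c => decide (c < a)) + l.countP (fun c => decide (c < b))
          + inversions l) - inversions (a :: b :: l), by ring⟩
    rw [e2, coefL_cons, coefL_cons, coefL_cons, coefL_cons, pd, pd, ctr_comm, map_neg]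
    ring
  | trans p q ih1 ih2 => rw [ih1 hl, ih2 (p.nodup_iff.1 hl)]

theorem lapply_comp_lmapDomain {f : L → L'} (hf : Function.Injective f) (i : L) :
    (Finsupp.lapply (f i) : (L' →₀ k) →ₗ[k] k) ∘ₗ Finsupp.lmapDomain k k f = Finsupp.lapply i := by
  ext j
  simp only [LinearMap.comp_apply, Finsupp.lsingle_apply, Finsupp.lmapDomain_apply,
    Finsupp.mapDomain_single, Finsupp.lapply_apply]
  classical
  simp only [Finsupp.single_apply, hf.eq_iff]

theorem coefL_map {f : L → L'} (hf : Function.Injective f) (l : List L) (x : Ext k L) :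
    coefL k (l.map f) (ExteriorAlgebra.map (Finsupp.lmapDomain k k f) x) = coefL k l x := by
  induction l generalizing x with
  | nil => exact scal_map _ _
  | cons i l ih =>
    rw [List.map_cons, coefL_cons, coefL_cons, pd, ctr_map, lapply_comp_lmapDomain hf, ih]

/-- The product of the generators in a list. -/
def prodGen (k : Type u) [Field k] (l : List L) : Ext k L := (l.map (gen k)).prod

theorem prodGen_cons (i : L) (l : List L) : prodGen k (i :: l) = gen k i * prodGen k l := by
  simp [prodGen]

theorem pd_prodGen {i : L} {l : List L} (h : i ∉ l) : pd i (prodGen k l) = 0 := by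
  induction l with
  | nil => exact ctr_one _
  | cons a l ih =>
    rw [List.mem_cons, not_or] at h
    rw [prodGen_cons, pd, ctr_ι_mul, ih h.2]
    classical
    simp [Ne.symm h.1]

theorem coefL_prodGen {l : List L} (h : l.Nodup) : coefL k l (prodGen k l) = 1 := by
  induction l with
  | nil => simp [prodGen, coefL_nil]
  | cons a l ih =>
    rw [List.nodup_cons] at h
    rw [coefL_cons, prodGen_cons, pd, ctr_ι_mul, pd_prodGen h.1]
    simpa using ih h.2

/-- A coefficient sees only the coordinates in its list, so other generators may be altered or
killed. -/
theorem coefL_map_erase {f : (L →₀ k) →ₗ[k] (L →₀ k)} {l : List L}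
    (hf : ∀ i ∈ l, (Finsupp.lapply i : (L →₀ k) →ₗ[k] k) ∘ₗ f = Finsupp.lapply i)
    (x : Ext k L) : coefL k l (ExteriorAlgebra.map f x) = coefL k l x := by
  induction l generalizing x with
  | nil => exact scal_map _ _
  | cons i l ih =>
    rw [coefL_cons, coefL_cons, pd, ctr_map, hf i (by simp), ih fun j hj => hf j (by simp [hj])]

/-- An index of `l` outside `l'` gives a contraction that kills the product; an index of `l'`
outside `l` names a generator that may be set to zero without changing the coefficient. -/
theorem coefL_prodGen_eq_zero {l l' : List L} (hl : l.Nodup) (hl' : l'.Nodup)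
    (h : ¬ l.Perm l') : coefL k l (prodGen k l') = 0 := by
  by_cases h1 : ∃ i ∈ l, i ∉ l'
  · obtain ⟨i, hi, hi'⟩ := h1
    exact coefL_eq_zero hi (pd_prodGen hi')
  by_cases h2 : ∃ i ∈ l', i ∉ l
  · obtain ⟨i, hi, hi'⟩ := h2
    classical
    let f : (L →₀ k) →ₗ[k] (L →₀ k) := Finsupp.linearCombination k
      (fun j => if j = i then 0 else Finsupp.single j 1)
    have hfs : ∀ j, f (Finsupp.single j 1) = if j = i then 0 else Finsupp.single j 1 := fun j => by
      simp only [f, Finsupp.linearCombination_single, one_smul]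
    rw [← coefL_map_erase (f := f)]
    · have : ExteriorAlgebra.map f (prodGen k l') = 0 := by
        rw [prodGen, map_list_prod, List.prod_eq_zero]
        rw [List.map_map, List.mem_map]
        refine ⟨i, hi, ?_⟩
        rw [Function.comp, ExteriorAlgebra.map_apply_ι, hfs, if_pos rfl, map_zero]
      rw [this, map_zero]
    · intro a ha
      ext j
      simp only [LinearMap.comp_apply, Finsupp.lsingle_apply, hfs]
      split_ifs with hj
      · subst hj
        have : j ≠ a := fun h => hi' (h ▸ ha)
        simp [this]
      · rfl
  · push Not at h1 h2
    exact absurd ((List.perm_ext_iff_of_nodup hl hl').2 fun a => ⟨h1 a, h2 a⟩) h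

end Coefficients

/-! ### Naturality of the model and its values on combs. -/

section ModelMap

variable {k : Type u} [Field k] {L L' : Type}

theorem opVal_map {n : ℕ} {d : ℤ} (o : Op n d) (g : (L →₀ k) →ₗ[k] (L' →₀ k))
    (hg : coordSum k L' ∘ₗ g = coordSum k L) (a : Fin n → Ext k L) :
    opVal o (fun i => ExteriorAlgebra.map g (a i)) = ExteriorAlgebra.map g (opVal o a) := by
  cases o with
  | circ σ =>
    by_cases hσ : σ = 1
    · simp only [opVal, hσ, if_true, map_mul, dd, ctr_map, hg]
    · simp only [opVal, hσ, if_false, map_mul, map_neg, dd, ctr_map, hg, inv_map]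
  | bullet => simp only [opVal, map_mul, map_neg, inv_map]

theorem Tree.model_map (f : L → L') (T : Tree (preLieGen k).signDual L) :
    (T.map f).model = ExteriorAlgebra.map (Finsupp.lmapDomain k k f) T.model := by
  induction T with
  | leaf l => simp [Tree.map, Tree.model]
  | node n d e ch ih =>
    simp only [Tree.map, Tree.model, ih, map_sum, map_smul]
    refine sum_congr rfl fun o _ => ?_
    rw [opVal_map]
    ext i; simp

theorem model_relabel (f : L → L') (x : DSpace k L) :
    modelHom k L' (relabel _ _ f ((dualPreLieTwo k).relators_map f) x)
      = ExteriorAlgebra.map (Finsupp.lmapDomain k k f) (modelHom k L x) := by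
  have : modelHom k L' ∘ₗ relabel _ _ f ((dualPreLieTwo k).relators_map f)
      = (ExteriorAlgebra.map (Finsupp.lmapDomain k k f)).toLinearMap ∘ₗ modelHom k L :=
    OpSpace.ext_cls fun T => by
      rw [LinearMap.comp_apply, relabel_cls, modelHom_cls, Tree.model_map, LinearMap.comp_apply,
        modelHom_cls]
      rfl
  exact congrArg (fun F => F x) this

theorem model_node_zero (d : ℤ) (g : (preLieGen k).signDual.X 2 d)
    (ch : Fin 2 → Tree (preLieGen k).signDual L) :
    (Tree.node 2 d g ch).model = pairGen ⟨d, g⟩ (opC.elt k) • ((ch 0).model * dd (ch 1).model)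
      + pairGen ⟨d, g⟩ (opS.elt k) • -(inv (dd (ch 0).model) * (ch 1).model)
      + pairGen ⟨d, g⟩ (opB.elt k) • -(inv (ch 0).model * (ch 1).model) := by
  rw [Tree.model]
  have := sum_eq_pairGen g (fun o => opVal o.2 fun i => (ch i).model)
  rw [this]
  have hs : (Equiv.swap (0 : Fin 2) 1) ≠ 1 := by decide
  simp only [opVal, hs, if_true, if_false]

theorem model_treeC (u v : Tree (preLieGen k).signDual L) :
    (treeC u v).model = u.model * dd v.model := by
  obtain ⟨t1, t2, t3, -⟩ := pairGen_table (k := k)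
  rw [treeC, model_node_zero, t1, t2, t3]
  simp

theorem model_treeB (u v : Tree (preLieGen k).signDual L) :
    (treeB u v).model = - (inv u.model * v.model) := by
  obtain ⟨-, -, -, -, -, -, t1, t2, t3⟩ := pairGen_table (k := k)
  rw [treeB, model_node_zero, t1, t2, t3]
  simp

/-- `dd` of a leaf is `1`, so leaves appended by `∘` leave no trace, while each `•` appends a
generator up to sign. The precise sign is never needed, only that it squares to one. -/
theorem model_comb {is : List L} (h : is ≠ []) (js : List L) :
    ∃ z : ℤ, (comb k is js).model = sg k z • prodGen k is := by
  induction js using List.reverseRecOn with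
  | nil =>
    induction is using List.reverseRecOn with
    | nil => exact absurd rfl h
    | append_singleton is i ih =>
      cases is with
      | nil => exact ⟨0, by simp [comb, combC, combB, Tree.model, prodGen, sg_zero]⟩
      | cons a is =>
        obtain ⟨z, hz⟩ := ih (by simp)
        have hinv : ∀ l : List L, inv (prodGen k l) = sg k l.length • prodGen k l := by
          intro l
          induction l with
          | nil => simp [prodGen, sg_zero]
          | cons a l ih =>
            rw [prodGen_cons, map_mul, inv_ι, ih, List.length_cons]
            push_cast
            rw [sg_add_one]
            simp
        refine ⟨z + (a :: is).length + 1, ?_⟩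
        rw [comb_append_left (by simp), model_treeB, hz, map_smul, hinv, smul_smul, ← sg_add,
          sg_add_one, neg_smul, smul_mul_assoc]
        congr 2
        simp [prodGen, Tree.model, mul_assoc]
  | append_singleton js j ih =>
    obtain ⟨z, hz⟩ := ih
    refine ⟨z, ?_⟩
    rw [comb_append_right h, model_treeC, hz]
    have : dd (Tree.leaf j : Tree (preLieGen k).signDual L).model = 1 := by
      rw [Tree.model, dd, ctr_ι]
      simp
    rw [this, mul_one]

theorem count_comb [DecidableEq L] (l : L) {is : List L} (h : is ≠ []) (js : List L) :
    (comb k is js).count l = (is ++ js).count l := by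
  have h2 : ∀ (d : ℤ) (g : (preLieGen k).signDual.X 2 d) (js : List L) (u : Tree _ L),
      (js.foldl (fun u j => Tree.node 2 d g ![u, .leaf j]) u).count l = u.count l + js.count l := by
    intro d g js
    induction js with
    | nil => intro u; rfl
    | cons j js ih =>
      intro u
      rw [List.foldl_cons, ih]
      simp [Tree.count, List.count_cons]
      ring
  cases is with
  | nil => exact absurd rfl h
  | cons i is =>
    rw [comb, combC, combB]
    refine (h2 0 (dualC k) js _).trans ?_
    have e1 := h2 (-1) (dualB k) is (.leaf i)
    refine (congrArg (· + js.count l) e1).trans ?_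
    simp [Tree.count, List.count_cons, List.count_append]
    ring

theorem deg_comb {is : List L} (h : is ≠ []) (js : List L) :
    (comb k is js).deg = 1 - is.length := by
  have h2 : ∀ (d : ℤ) (g : (preLieGen k).signDual.X 2 d) (js : List L) (u : Tree _ L),
      (js.foldl (fun u j => Tree.node 2 d g ![u, .leaf j]) u).deg = u.deg + d * js.length := by
    intro d g js
    induction js with
    | nil => intro u; simp
    | cons j js ih =>
      intro u
      rw [List.foldl_cons, ih]
      simp [Tree.deg]
      ring
  cases is with
  | nil => exact absurd rfl h
  | cons i is =>
    rw [comb, combC, combB]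
    refine (h2 0 (dualC k) js _).trans ?_
    rw [zero_mul, add_zero]
    refine (h2 (-1) (dualB k) is _).trans ?_
    simp [Tree.deg]

end ModelMap

/-! ### Evaluating generators of the cobar construction on trees. -/

section Evaluation

variable {k : Type u} [Field k] (Q : QuadData k) {n : ℕ} {a : ℤ}

theorem ev_of_eq (φ : Q.cobarGen.X n a) {T : Tree Q.E (Fin n)}
    (h : 2 ≤ n ∧ T.Multilinear ∧ T.deg = 2 - n - a) :
    Q.ev φ T = φ ⟨cls _ T, Submodule.subset_span ⟨T, h.1, h.2.1, h.2.2, rfl⟩⟩ := dif_pos h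

theorem ev_of_deg_ne (φ : Q.cobarGen.X n a) {T : Tree Q.E (Fin n)} (h : T.deg ≠ 2 - n - a) :
    Q.ev φ T = 0 := dif_neg fun h' => h h'.2.2

theorem ev_add (φ ψ : Q.cobarGen.X n a) (T : Tree Q.E (Fin n)) :
    Q.ev (φ + ψ) T = Q.ev φ T + Q.ev ψ T := by
  unfold QuadData.ev
  split_ifs with h
  · rfl
  · rw [add_zero]

theorem ev_smul (r : k) (φ : Q.cobarGen.X n a) (T : Tree Q.E (Fin n)) :
    Q.ev (r • φ) T = r * Q.ev φ T := by
  unfold QuadData.ev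
  split_ifs with h
  · rfl
  · rw [mul_zero]

theorem ev_zero (T : Tree Q.E (Fin n)) : Q.ev (0 : Q.cobarGen.X n a) T = 0 := by
  rw [← zero_smul k (0 : Q.cobarGen.X n a), ev_smul, zero_mul]

theorem ev_sum {ι : Type*} (s : Finset ι) (φ : ι → Q.cobarGen.X n a) (T : Tree Q.E (Fin n)) :
    Q.ev (∑ i ∈ s, φ i) T = ∑ i ∈ s, Q.ev (φ i) T := by
  classical
  induction s using Finset.induction_on with
  | empty => rw [sum_empty, sum_empty, ev_zero]
  | insert i s hi ih => rw [sum_insert hi, sum_insert hi, ev_add, ih]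

theorem ev_act (σ : Equiv.Perm (Fin n)) (φ : Q.cobarGen.X n a) (T : Tree Q.E (Fin n)) :
    Q.ev (Q.cobarGen.act n a σ φ) T
      = (((Equiv.Perm.sign σ : ℤˣ) : ℤ) : k) * Q.ev φ (T.map σ.symm) := by
  unfold QuadData.ev
  by_cases h : 2 ≤ n ∧ T.Multilinear ∧ T.deg = 2 - n - a
  · have h' : 2 ≤ n ∧ (T.map σ.symm).Multilinear ∧ (T.map σ.symm).deg = 2 - n - a := by
      refine ⟨h.1, fun l => ?_, ?_⟩
      · rw [Tree.count_map]; exact h.2.1 _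
      · rw [Tree.deg_map]; exact h.2.2
    rw [dif_pos h, dif_pos h']
    change _ * φ _ = _ * φ _
    congr 2
    apply Subtype.ext
    exact relabel_cls _ _ _ (Q.relators_map (σ⁻¹ : Equiv.Perm (Fin n))) T
  · have h' : ¬ (2 ≤ n ∧ (T.map σ.symm).Multilinear ∧ (T.map σ.symm).deg = 2 - n - a) := by
      rintro ⟨h1, h2, h3⟩
      refine h ⟨h1, fun l => ?_, ?_⟩
      · have := h2 (σ.symm l)
        rw [Tree.count_map] at this
        simpa using this
      · rwa [Tree.deg_map] at h3
    rw [dif_neg h, dif_neg h', mul_zero]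

/-- Extending the form to the whole quotient makes evaluation linear in the class, without carrying
membership in the graded part. -/
theorem exists_ev_eq (φ : Q.cobarGen.X n a) : ∃ g : Q.Space (Fin n) →ₗ[k] k,
    g ∘ₗ (Q.part n (2 - n - a)).subtype = φ ∧
    ∀ T : Tree Q.E (Fin n), 2 ≤ n → T.Multilinear → T.deg = 2 - n - a →
      Q.ev φ T = g (cls _ T) := by
  obtain ⟨g, hg⟩ := LinearMap.exists_extend φ
  refine ⟨g, hg, fun T h1 h2 h3 => ?_⟩
  rw [ev_of_eq Q φ ⟨h1, h2, h3⟩, ← hg]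
  rfl

end Evaluation

/-! ### Standard combs, one for each nonempty set of inputs. -/

section StandardCombs

variable {k : Type u} [Field k] {n : ℕ}

theorem Tree.labels_eq_univ {M : GrSMod k} {T : Tree M (Fin n)} (h : T.Multilinear) :
    T.labels = (univ : Finset (Fin n)).val := by
  ext l
  rw [← Tree.count_eq_labels, h l, Multiset.count_eq_one_of_mem univ.nodup (mem_univ l)]

/-- The comb whose leaves in `I` are joined by `•` and followed by the other leaves. -/
def stdComb (k : Type u) [Field k] (I : Finset (Fin n)) : Tree (preLieGen k).signDual (Fin n) :=
  comb k (I.sort (· ≤ ·)) (Iᶜ.sort (· ≤ ·))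

theorem sort_ne_nil {I : Finset (Fin n)} (h : I.Nonempty) : I.sort (· ≤ ·) ≠ [] := by
  intro h'
  have := I.length_sort (· ≤ ·)
  rw [h'] at this
  simp at this
  exact h.ne_empty (card_eq_zero.1 this.symm)

theorem stdComb_multilinear {I : Finset (Fin n)} (h : I.Nonempty) : (stdComb k I).Multilinear := by
  intro l
  rw [stdComb, count_comb l (sort_ne_nil h), List.count_append]
  have hc : ∀ I : Finset (Fin n), (I.sort (· ≤ ·)).count l = if l ∈ I then 1 else 0 := by
    intro I
    rw [(I.sort_nodup (· ≤ ·)).count]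
    simp
  rw [hc, hc]
  by_cases hl : l ∈ I <;> simp [hl]

theorem stdComb_deg {I : Finset (Fin n)} (h : I.Nonempty) : (stdComb k I).deg = 1 - #I := by
  rw [stdComb, deg_comb (sort_ne_nil h), length_sort]

/-- Every label occurs once, so up to order, hence up to sign, a comb is determined by the set of
its leaves joined by `•`, whose size is read off the degree. -/
theorem dcls_mem_span_stdComb {T : Tree (preLieGen k).signDual (Fin n)} (hT : T.Multilinear) :
    dcls T ∈ Submodule.span k
      {x | ∃ I : Finset (Fin n), I.Nonempty ∧ (#I : ℤ) = 1 - T.deg ∧ x = dcls (stdComb k I)} := by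
  rcases dcls_eq_zero_or T with h | ⟨q, hq, h⟩
  · rw [h]; exact Submodule.zero_mem _
  refine Submodule.span_le.2 ?_ h
  rintro _ ⟨_, ⟨is, js, h1, h2, rfl⟩, rfl⟩
  rw [Tree.labels_eq_univ hT] at h2
  have hnd : (is ++ js).Nodup := by
    rw [← Multiset.coe_nodup, h2]; exact univ.nodup
  rw [List.nodup_append'] at hnd
  have hmem : ∀ l, l ∈ is ∨ l ∈ js := fun l => by
    have : l ∈ (univ : Finset (Fin n)).val := mem_univ l
    rw [← h2, Multiset.mem_coe, List.mem_append] at this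
    exact this
  have p1 : is.Perm (is.toFinset.sort (· ≤ ·)) :=
    (List.perm_ext_iff_of_nodup hnd.1 (sort_nodup _ _)).2 fun l => by simp
  have p2 : js.Perm (is.toFinsetᶜ.sort (· ≤ ·)) :=
    (List.perm_ext_iff_of_nodup hnd.2.1 (sort_nodup _ _)).2 fun l => by
      simp only [mem_sort, mem_compl, List.mem_toFinset]
      exact ⟨fun h h' => hnd.2.2 h' h, fun h => (hmem l).resolve_left h⟩
  refine mem_of_mem_span_singleton (dcls_comb_perm p1 p2) (Submodule.subset_span
    ⟨is.toFinset, ?_, ?_, rfl⟩)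
  · rw [← card_pos, List.toFinset_card_of_nodup hnd.1, h1]; omega
  · rw [List.toFinset_card_of_nodup hnd.1, h1, hq]; push_cast; ring

/-- Values of trees are homogeneous in the number of generators, since this holds for the combs that
span. -/
theorem coefL_model_eq_zero {l : List (Fin n)} (hl : l.Nodup)
    {T : Tree (preLieGen k).signDual (Fin n)} (hT : T.Multilinear)
    (h : T.deg ≠ 1 - l.length) : coefL k l T.model = 0 := by
  have key : dcls T ∈ LinearMap.ker (coefL k l ∘ₗ modelHom k (Fin n)) := by
    refine Submodule.span_le.2 ?_ (dcls_mem_span_stdComb hT)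
    rintro _ ⟨I, hI, hd, rfl⟩
    rw [SetLike.mem_coe, LinearMap.mem_ker, LinearMap.comp_apply, modelHom_cls]
    obtain ⟨z, hz⟩ := model_comb (k := k) (sort_ne_nil hI) (Iᶜ.sort (· ≤ ·))
    rw [stdComb, hz, map_smul, coefL_prodGen_eq_zero hl (sort_nodup _ _), smul_zero]
    intro hp
    have := hp.length_eq
    rw [length_sort] at this
    apply h
    rw [this, hd]
    ring
  rwa [LinearMap.mem_ker, LinearMap.comp_apply, modelHom_cls] at key

end StandardCombs

/-! ### Coefficient forms as dual basis of the standard combs. -/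

section CoefficientForms

variable {k : Type u} [Field k] {n : ℕ} {a : ℤ}

/-- The coefficient of a product of generators, as a linear form on `P^!`. -/
def coefF (k : Type u) [Field k] (n : ℕ) (a : ℤ) (l : List (Fin n)) : (infGen k).X n a :=
  coefL k l ∘ₗ modelHom k (Fin n) ∘ₗ Submodule.subtype _

/-- No condition on the degree of `T` is needed: in the wrong degree the left side is zero by
definition and the right side by homogeneity. -/
theorem ev_coefF (hn : 2 ≤ n) {l : List (Fin n)} (hl : l.Nodup) (ha : a + n = 1 + l.length)
    {T : Tree (preLieGen k).signDual (Fin n)} (hT : T.Multilinear) :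
    (dualPreLieTwo k).ev (coefF k n a l) T = coefL k l T.model := by
  by_cases h : T.deg = 2 - n - a
  · rw [ev_of_eq (dualPreLieTwo k) (coefF k n a l) ⟨hn, hT, h⟩]
    change coefL k l (modelHom k (Fin n) (cls _ T)) = _
    rw [modelHom_cls]
  · rw [ev_of_deg_ne (dualPreLieTwo k) _ h, coefL_model_eq_zero hl hT]
    intro h'
    apply h
    rw [h']
    linarith

theorem coefF_perm {l l' : List (Fin n)} (h : l.Perm l') (hl : l.Nodup) :
    sg k (inversions l) • coefF k n a l = sg k (inversions l') • coefF k n a l' :=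
  LinearMap.ext fun _ => coefL_perm h hl _

theorem act_coefF (σ : Equiv.Perm (Fin n)) (l : List (Fin n)) :
    (infGen k).act n a σ (coefF k n a l)
      = (((Equiv.Perm.sign σ : ℤˣ) : ℤ) : k) • coefF k n a (l.map σ) := by
  refine LinearMap.ext fun x => ?_
  change _ * coefL k l (modelHom k _ (relabel _ _ (σ⁻¹ : Equiv.Perm (Fin n))
      ((dualPreLieTwo k).relators_map _) x.1))
    = _ * coefL k (l.map σ) (modelHom k _ x.1)
  congr 1
  rw [model_relabel, ← coefL_map σ.injective, map_map_ext, ← Finsupp.lmapDomain_comp]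
  have : (σ : Fin n → Fin n) ∘ (σ⁻¹ : Equiv.Perm (Fin n)) = id := by ext; simp
  rw [this, Finsupp.lmapDomain_id, ExteriorAlgebra.map_id]
  rfl

theorem infGen_eq_zero (hn : 2 ≤ n) {φ : (infGen k).X n a}
    (h : ∀ I : Finset (Fin n), I.Nonempty → (#I : ℤ) = a + n - 1 →
      (dualPreLieTwo k).ev φ (stdComb k I) = 0) : φ = 0 := by
  obtain ⟨g, rfl, hg⟩ := exists_ev_eq (dualPreLieTwo k) φ
  refine LinearMap.ext fun ⟨x, hx⟩ => ?_
  change g x = 0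
  rw [← LinearMap.mem_ker]
  refine Submodule.span_le.2 ?_ hx
  rintro _ ⟨T, -, hT, hd, rfl⟩
  refine Submodule.span_le.2 ?_ (dcls_mem_span_stdComb hT)
  rintro _ ⟨I, hI, hc, rfl⟩
  rw [SetLike.mem_coe, LinearMap.mem_ker]
  rw [hd] at hc
  have hc' : (#I : ℤ) = a + n - 1 := by rw [hc]; ring
  rw [← h I hI hc', hg _ hn (stdComb_multilinear hI)]
  rw [stdComb_deg hI, hc]; ring

/-- The exponent of the sign in the value of a standard comb. -/
def combSign (k : Type u) [Field k] (I : Finset (Fin n)) : ℤ :=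
  if hI : I.Nonempty then (model_comb (k := k) (sort_ne_nil hI) (Iᶜ.sort (· ≤ ·))).choose else 0

theorem model_stdComb {I : Finset (Fin n)} (hI : I.Nonempty) :
    (stdComb k I).model = sg k (combSign k I) • prodGen k (I.sort (· ≤ ·)) := by
  rw [combSign, dif_pos hI]
  exact (model_comb (k := k) (sort_ne_nil hI) (Iᶜ.sort (· ≤ ·))).choose_spec

/-- Standard combs span, so it is enough to compare both sides on them; there coefficient forms take
the value `0` off the diagonal and the sign `sg k (combSign k I)` on it. -/
theorem infGen_expand (hn : 2 ≤ n) (φ : (infGen k).X n a) :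
    φ = ∑ I : Finset (Fin n) with I.Nonempty ∧ (#I : ℤ) = a + n - 1,
        (sg k (combSign k I) * (dualPreLieTwo k).ev φ (stdComb k I)) •
          coefF k n a (I.sort (· ≤ ·)) := by
  rw [← sub_eq_zero]
  refine infGen_eq_zero hn fun I hI hc => ?_
  have hev : ∀ I' : Finset (Fin n), I'.Nonempty → (#I' : ℤ) = a + n - 1 →
      (dualPreLieTwo k).ev (coefF k n a (I'.sort (· ≤ ·))) (stdComb k I)
        = if I' = I then sg k (combSign k I) else 0 := by
    intro I' hI' hc'
    rw [ev_coefF hn (sort_nodup _ _) (by rw [length_sort, hc']; ring) (stdComb_multilinear hI),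
      model_stdComb hI, map_smul]
    split_ifs with h
    · rw [h, coefL_prodGen (sort_nodup _ _), smul_eq_mul, mul_one]
    · rw [coefL_prodGen_eq_zero (sort_nodup _ _) (sort_nodup _ _), smul_zero]
      intro hp
      apply h
      ext i
      rw [← mem_sort (· ≤ ·), hp.mem_iff, mem_sort]
  rw [sub_eq_add_neg, ← neg_one_smul k, ev_add, ev_smul, ev_sum,
    sum_congr rfl (g := fun I' => if I' = I then (dualPreLieTwo k).ev φ (stdComb k I) else 0)]
  · rw [sum_ite_eq' _ I (fun _ => (dualPreLieTwo k).ev φ (stdComb k I)), if_pos (by simp [hI, hc])]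
    ring
  · intro I' hI'
    simp only [mem_filter, mem_univ, true_and] at hI'
    rw [ev_smul, hev I' hI'.1 hI'.2]
    split_ifs with h
    · subst h
      rw [mul_right_comm, sg_mul_self, one_mul]
    · rw [mul_zero]

theorem infGen_expansion (hn : 2 ≤ n) (φ : (infGen k).X n a) :
    ∃ r : Finset (Fin n) → k,
      φ = ∑ I : Finset (Fin n) with I.Nonempty ∧ (#I : ℤ) = a + n - 1,
        r I • coefF k n a (I.sort (· ≤ ·)) := ⟨_, infGen_expand hn φ⟩

theorem coefF_linearIndependent (hn : 2 ≤ n) {m : ℕ} (hm : 1 ≤ m) (ha : (m : ℤ) = a + n - 1) :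
    LinearIndependent k (fun I : {I : Finset (Fin n) // #I = m} =>
      coefF k n a (I.1.sort (· ≤ ·))) := by
  rw [Fintype.linearIndependent_iff]
  intro g hg I
  have hI : I.1.Nonempty := by rw [← card_pos, I.2]; omega
  have h : ∑ I' : {I : Finset (Fin n) // #I = m},
      g I' * (dualPreLieTwo k).ev (coefF k n a (I'.1.sort (· ≤ ·))) (stdComb k I.1) = 0 := by
    rw [← ev_zero (dualPreLieTwo k) (a := a) (stdComb k I.1), ← hg, ev_sum]
    exact sum_congr rfl fun I' _ => (ev_smul _ _ _ _).symm
  obtain ⟨z, hz⟩ := model_comb (k := k) (sort_ne_nil hI) (I.1ᶜ.sort (· ≤ ·))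
  rw [Fintype.sum_eq_single I] at h
  · rw [ev_coefF hn (sort_nodup _ _) (by rw [length_sort, I.2, ha]; ring) (stdComb_multilinear hI),
      stdComb, hz, map_smul, coefL_prodGen (sort_nodup _ _), smul_eq_mul, mul_one] at h
    exact (mul_eq_zero.1 h).resolve_right (sg_ne_zero k z)
  · intro I' hne
    rw [ev_coefF hn (sort_nodup _ _) (by rw [length_sort, I'.2, ha]; ring) (stdComb_multilinear hI),
      stdComb, hz, map_smul, coefL_prodGen_eq_zero (sort_nodup _ _) (sort_nodup _ _), smul_zero,
      mul_zero]
    intro hp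
    apply hne
    apply Subtype.ext
    ext i
    rw [← mem_sort (· ≤ ·), hp.mem_iff, mem_sort]

/-- Moving `i` and `j` to the front costs the same sign on both sides; there the swap just exchanges
two contractions. -/
theorem coefL_map_swap {l : List (Fin n)} (hl : l.Nodup) {i j : Fin n} (hi : i ∈ l) (hj : j ∈ l)
    (hij : i ≠ j) (x : Ext k (Fin n)) :
    coefL k (l.map (Equiv.swap i j)) x = - coefL k l x := by
  have p1 := List.perm_cons_erase hi
  have hj' : j ∈ l.erase i := (List.mem_erase_of_ne hij.symm).2 hj
  have p := p1.trans ((List.perm_cons_erase hj').cons i)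
  set l' := (l.erase i).erase j with hl'
  have hnd := p.nodup_iff.1 hl
  have hfix : l'.map (Equiv.swap i j) = l' := by
    rw [List.map_congr_left (g := id), List.map_id]
    intro a ha
    simp only [List.nodup_cons, List.mem_cons, not_or] at hnd
    exact Equiv.swap_apply_of_ne_of_ne (fun h => hnd.1.2 (h ▸ ha)) (fun h => hnd.2.1 (h ▸ ha))
  have h1 : ∀ y, coefL k l y = sg k (inversions l) * sg k (inversions (i :: j :: l'))
      * coefL k (i :: j :: l') y := fun y => by
    rw [mul_assoc, ← coefL_perm p hl, ← mul_assoc, sg_mul_self, one_mul]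
  have hσ : ∀ l'' : List (Fin n), coefL k (l''.map (Equiv.swap i j)) x = coefL k l''
      (ExteriorAlgebra.map (Finsupp.lmapDomain k k (Equiv.swap i j)) x) := fun l'' => by
    rw [← coefL_map (Equiv.swap i j).injective l''
      (ExteriorAlgebra.map (Finsupp.lmapDomain k k (Equiv.swap i j)) x), map_map_ext, ← Finsupp.lmapDomain_comp]
    have : (Equiv.swap i j : Fin n → Fin n) ∘ Equiv.swap i j = id := by ext; simp
    rw [this, Finsupp.lmapDomain_id, ExteriorAlgebra.map_id]
    rfl
  rw [hσ, h1, ← hσ, h1 x, List.map_cons, List.map_cons, hfix, Equiv.swap_apply_left,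
    Equiv.swap_apply_right, coefL_cons, coefL_cons, coefL_cons, coefL_cons, pd, pd, ctr_comm,
    map_neg]
  ring

end CoefficientForms

/-! ### The corollas and their symmetries. -/

section StandardCorollas

variable {k : Type u} [Field k] {n : ℕ}

/-- The first `n - p` inputs. -/
def stdList (n p : ℕ) : List (Fin n) := (List.finRange n).take (n - p)

theorem stdList_nodup (n p : ℕ) : (stdList n p).Nodup :=
  (List.nodup_finRange n).sublist (List.take_sublist _ _)

theorem length_stdList {n p : ℕ} : (stdList n p).length = n - p := by
  simp [stdList]

theorem mem_stdList {n p : ℕ} {i : Fin n} : i ∈ stdList n p ↔ (i : ℕ) < n - p := by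
  rw [stdList, List.mem_take_iff_getElem]
  constructor
  · rintro ⟨j, hj, rfl⟩
    simpa using (lt_min_iff.1 hj).1
  · intro h
    exact ⟨i, by simp [h], by simp⟩

theorem exists_perm_map_eq {l l' : List (Fin n)} (hl : l.Nodup) (hl' : l'.Nodup)
    (h : l.length = l'.length) : ∃ σ : Equiv.Perm (Fin n), l.map σ = l' := by
  classical
  let f : {x // x ∈ l} ≃ {x // x ∈ l'} :=
    (hl.getEquiv l).symm.trans ((finCongr h).trans (hl'.getEquiv l'))
  obtain ⟨σ, hσ⟩ : ∃ σ : Equiv.Perm (Fin n), ∀ x : {x // x ∈ l}, σ x = f x :=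
    ⟨f.extendSubtype, fun x => f.extendSubtype_apply_of_mem x.1 x.2⟩
  refine ⟨σ, List.ext_getElem (by simp [h]) fun i h1 h2 => ?_⟩
  have hi : i < l.length := by simpa using h1
  rw [List.getElem_map]
  have := hσ ⟨l[i], List.getElem_mem _⟩
  simp only at this
  rw [this]
  have e : (hl.getEquiv l).symm ⟨l[i], List.getElem_mem _⟩ = ⟨i, hi⟩ := by
    rw [Equiv.symm_apply_eq]
    rfl
  simp only [f, Equiv.trans_apply, e]
  rfl

/-- The sign exponent in the normalization of the corollas of arity `n`. -/
def cornorm (n : ℕ) : ℤ := ((n - 1).choose 2 : ℕ)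

/-- The binomial coefficient is chosen for this defect: it cancels the product of arities in the
sign of a two-vertex tree. -/
theorem cornorm_add (a b : ℕ) : cornorm (a + b + 1) = cornorm (a + 1) + cornorm (b + 1) + a * b := by
  simp only [cornorm, Nat.add_sub_cancel]
  induction b with
  | zero => simp
  | succ b ih =>
    rw [← add_assoc, Nat.choose_succ_succ, Nat.choose_succ_succ b, Nat.choose_one_right,
      Nat.choose_one_right]
    push_cast
    rw [ih]
    ring

/-- The corollas. -/
def stdCor (k : Type u) [Field k] (n p : ℕ) : (infGen k).X n (1 - p) :=
  sg k (cornorm n) • coefF k n (1 - p) (stdList n p)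

theorem sign_smul_sign_smul {M : GrSMod k} {m : ℕ} {d : ℤ}
    (σ : Equiv.Perm (Fin n)) (x : M.X m d) :
    (((Equiv.Perm.sign σ : ℤˣ) : ℤ) : k) • (((Equiv.Perm.sign σ : ℤˣ) : ℤ) : k) • x = x := by
  rcases Int.units_eq_one_or (Equiv.Perm.sign σ) with h | h <;> simp [h]

theorem sg_smul_sg_smul {M : GrSMod k} {m : ℕ} {d : ℤ} (z : ℤ) (x : M.X m d) :
    sg k z • sg k z • x = x := by rw [smul_smul, sg_mul_self, one_smul]

/-- Up to sign, all coefficient forms are obtained from a corolla. -/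
theorem coefF_eq_act {p : ℕ} {l : List (Fin n)} (hl : l.Nodup) (h : l.length = n - p) :
    ∃ σ : Equiv.Perm (Fin n), coefF k n (1 - p) l = sg k (cornorm n) •
      (((Equiv.Perm.sign σ : ℤˣ) : ℤ) : k) • (infGen k).act n (1 - p) σ (stdCor k n p) := by
  obtain ⟨σ, hσ⟩ := exists_perm_map_eq (stdList_nodup n p) hl (by rw [length_stdList, h])
  refine ⟨σ, ?_⟩
  rw [stdCor, map_smul, act_coefF, hσ, smul_comm (sg k _) (((_ : ℤˣ) : ℤ) : k),
    sg_smul_sg_smul (M := infGen k), sign_smul_sign_smul (M := infGen k)]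

/-- The sign twist of the action turns the antisymmetry of the coefficient in the solid inputs into
symmetry, and makes the corolla antisymmetric in the wavy inputs, which do not occur in its list.
Dimensions count the sets of `n - p` solid inputs. -/
theorem isCorollas_stdCor : IsCorollas (stdCor k) where
  symm n p hn hp i j hi hj := by
    by_cases hij : i = j
    · subst hij
      rw [Equiv.swap_self]
      exact congrArg (fun F => F (stdCor k n p)) (map_one ((infGen k).act n (1 - p)))
    · rw [stdCor, map_smul, act_coefF, Equiv.Perm.sign_swap hij]
      congr 1
      refine LinearMap.ext fun x => ?_
      change _ * coefL k _ _ = coefL k _ _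
      rw [coefL_map_swap (stdList_nodup n p) (mem_stdList.2 hi) (mem_stdList.2 hj) hij]
      simp
  antisymm n p hn hp i j hi hj hij := by
    rw [stdCor, map_smul, act_coefF, Equiv.Perm.sign_swap hij, List.map_congr_left (g := id),
      List.map_id]
    · refine LinearMap.ext fun x => ?_
      change _ * (_ * coefL k _ _) = -(_ * coefL k _ _)
      simp
    · intro a ha
      rw [mem_stdList] at ha
      refine Equiv.swap_apply_of_ne_of_ne ?_ ?_ <;> rintro rfl <;> omega
  span n p hn hp := by
    refine eq_top_iff.2 fun φ _ => ?_
    obtain ⟨r, rfl⟩ := infGen_expansion hn φ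
    refine Submodule.sum_mem _ fun I hI => Submodule.smul_mem _ _ ?_
    simp only [mem_filter, mem_univ, true_and] at hI
    obtain ⟨σ, hσ⟩ := coefF_eq_act (k := k) (p := p) (sort_nodup I (· ≤ ·)) (by
      rw [length_sort]; omega)
    rw [hσ]
    exact Submodule.smul_mem _ _ (Submodule.smul_mem _ _ (Submodule.subset_span ⟨σ, rfl⟩))
  finrank n p hn hp := by
    have hm : ((n - p : ℕ) : ℤ) = (1 - p : ℤ) + n - 1 := by omega
    have hli := coefF_linearIndependent (k := k) hn (by omega) hm
    have hsp : Submodule.span k (Set.range fun I : {I : Finset (Fin n) // #I = n - p} =>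
        coefF k n (1 - p) (I.1.sort (· ≤ ·))) = ⊤ := by
      refine eq_top_iff.2 fun φ _ => ?_
      obtain ⟨r, rfl⟩ := infGen_expansion hn φ
      refine Submodule.sum_mem _ fun I hI => Submodule.smul_mem _ _ (Submodule.subset_span ?_)
      simp only [mem_filter, mem_univ, true_and] at hI
      exact ⟨⟨I, by omega⟩, rfl⟩
    rw [← finrank_top, ← hsp, finrank_span_eq_card hli, Fintype.card_finset_len, Fintype.card_fin,
      Nat.choose_symm hp.le]
  other n d hn hd := by
    refine ⟨fun φ ψ => ?_⟩
    obtain ⟨r, rfl⟩ := infGen_expansion hn φ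
    obtain ⟨s, rfl⟩ := infGen_expansion hn ψ
    -- A nonempty set of that size would make `d = 1 - p` for `p = n - #I < n`.
    have : (univ.filter fun I : Finset (Fin n) => I.Nonempty ∧ (#I : ℤ) = d + n - 1) = ∅ := by
      refine filter_eq_empty_iff.2 fun I _ h => ?_
      have h1 := card_pos.2 h.1
      have h2 := card_le_univ I
      rw [Fintype.card_fin] at h2
      exact hd (n - #I) (by omega) (by omega)
    rw [this, sum_empty, sum_empty]
  two_zero g := by
    have hm : (Tree.node 2 (-1) g ![.leaf 0, .leaf 1] :
        Tree (preLieGen k).signDual (Fin 2)).Multilinear := by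
      intro l
      fin_cases l <;> simp [Tree.count, Fin.sum_univ_two]
    rw [stdCor, ev_smul]
    rw [ev_coefF le_rfl (stdList_nodup 2 0) (by rw [length_stdList]; norm_num) hm, model_node_zero]
    have h1 : pairGen ⟨-1, g⟩ (opC.elt k) = 0 := dif_neg (by simp [BinOp.elt])
    have h2 : pairGen ⟨-1, g⟩ (opS.elt k) = 0 := dif_neg (by simp [BinOp.elt])
    have hl : stdList 2 0 = [0, 1] := rfl
    have := coefL_prodGen (k := k) (stdList_nodup 2 0)
    rw [hl] at this ⊢
    rw [h1, h2, zero_smul, zero_smul, zero_add, zero_add, map_smul]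
    simp only [Matrix.cons_val_zero, Matrix.cons_val_one, Tree.model, inv_ι, neg_mul, neg_neg]
    simp only [prodGen, List.map_cons, List.map_nil, List.prod_cons, List.prod_nil, mul_one] at this
    rw [this]
    simp only [cornorm, smul_eq_mul, mul_one]
    rw [sg_even k (by decide), one_mul]
    rfl
  two_one g := by
    have hm : (Tree.node 2 0 g ![.leaf 0, .leaf 1] :
        Tree (preLieGen k).signDual (Fin 2)).Multilinear := by
      intro l
      fin_cases l <;> simp [Tree.count, Fin.sum_univ_two]
    rw [stdCor, ev_smul]
    rw [ev_coefF le_rfl (stdList_nodup 2 1) (by rw [length_stdList]; norm_num) hm, model_node_zero]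
    have h2 : pairGen ⟨0, g⟩ (opB.elt k) = 0 := dif_neg (by simp [BinOp.elt])
    have hl : stdList 2 1 = [0] := rfl
    rw [hl, h2]
    simp only [Matrix.cons_val_zero, Matrix.cons_val_one, Tree.model, inv_ι, neg_mul, neg_neg,
      ctr_ι, coordSum_single, map_one, mul_one, one_mul, zero_smul, add_zero, map_add, map_smul,
      coefL_cons, coefL_nil, map_neg]
    simp only [cornorm, smul_eq_mul]
    rw [sg_even k (by decide), one_mul]
    simp
    rfl

end StandardCorollas

/-! ### Operadic composition inside the exterior algebra. -/

section Substitution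

variable {k : Type u} [Field k] {L L' : Type} {m : ℕ}

/-- The parity of the first factor is known only in its source algebra, so the orthogonality
argument is run with `f` as one of the isometries. -/
theorem map_mul_comm_of_parity (f : (L' →₀ k) →ₗ[k] (L →₀ k)) {a b : ℤ} {x : Ext k L'}
    {y : Ext k L} (hx : x ∈ parity k L' a) (hy : y ∈ parity k L b) :
    ExteriorAlgebra.map f x * y = sg k (a * b) • (y * ExteriorAlgebra.map f x) := by
  have h := CliffordAlgebra.map_mul_map_of_isOrtho_of_mem_evenOdd
    (Q₁ := (0 : QuadraticForm k (L' →₀ k))) (Q₂ := (0 : QuadraticForm k (L →₀ k)))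
    (Qₙ := (0 : QuadraticForm k (L →₀ k)))
    ⟨f, fun _ => rfl⟩ (QuadraticMap.Isometry.id _)
    (fun x y => by simp [QuadraticMap.IsOrtho]) x y hx hy
  rw [CliffordAlgebra.map_id] at h
  refine Eq.trans h ?_
  rcases int_cast_zmod_two a with ⟨h1, e1⟩ | ⟨h1, e1⟩ <;>
  rcases int_cast_zmod_two b with ⟨h2, e2⟩ | ⟨h2, e2⟩
  · rw [h1, h2, sg_even k (e1.mul_right _)]; simp; rfl
  · rw [h1, h2, sg_even k (e1.mul_right _)]; simp; rfl
  · rw [h1, h2, sg_even k (e2.mul_left _)]; simp; rfl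
  · rw [h1, h2, sg_congr k (b := 1) ((e1.mul e2).sub_odd odd_one), sg_one]
    simp; rfl

/-- The linear map that kills the generator `0` and renames the others. -/
def dropZero (k : Type u) [Field k] (g : Fin m → L) : (Fin (m + 1) →₀ k) →ₗ[k] (L →₀ k) :=
  Finsupp.linearCombination k (Fin.cons 0 fun j => Finsupp.single (g j) 1)

theorem dropZero_zero (g : Fin m → L) : dropZero k g (Finsupp.single 0 1) = 0 := by
  simp [dropZero]

theorem dropZero_succ (g : Fin m → L) (j : Fin m) :
    dropZero k g (Finsupp.single j.succ 1) = Finsupp.single (g j) 1 := by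
  simp [dropZero]

theorem coordSum_dropZero (g : Fin m → L) :
    coordSum k L ∘ₗ dropZero k g = coordSum k (Fin (m + 1)) - Finsupp.lapply 0 := by
  ext j
  cases j using Fin.cases with
  | zero => simp [dropZero_zero]
  | succ j => simp [dropZero_succ, (Fin.succ_ne_zero j).symm]

/-- The induced map of exterior algebras. -/
def dropMap (k : Type u) [Field k] (g : Fin m → L) : Ext k (Fin (m + 1)) →ₐ[k] Ext k L :=
  ExteriorAlgebra.map (dropZero k g)

/-- Generator `0` is killed, so the differential of the target misses its contraction. -/
theorem dd_dropMap (g : Fin m → L) (x : Ext k (Fin (m + 1))) :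
    dd (dropMap k g x) = dropMap k g (dd x) - dropMap k g (pd 0 x) := by
  rw [dropMap, dd, ctr_map, coordSum_dropZero, ctr_sub_left, map_sub]

theorem inv_dropMap (g : Fin m → L) (x : Ext k (Fin (m + 1))) :
    inv (dropMap k g x) = dropMap k g (inv x) := inv_map _ _

/-- Composition at the input `0`, in the exterior algebra. -/
def subst (g : Fin m → L) (w : Ext k L) : Ext k (Fin (m + 1)) →ₗ[k] Ext k L :=
  LinearMap.mulRight k w ∘ₗ (dropMap k g).toLinearMap ∘ₗ inv.toLinearMap ∘ₗ pd 0
    + LinearMap.mulRight k (dd w) ∘ₗ (dropMap k g).toLinearMap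

theorem subst_apply (g : Fin m → L) (w : Ext k L) (x : Ext k (Fin (m + 1))) :
    subst g w x = dropMap k g (inv (pd 0 x)) * w + dropMap k g x * dd w := rfl

/-- Differentiating `w` in the first summand yields exactly the correction of `dd_dropMap` in the
second, with opposite sign; the other terms match because contractions anticommute. -/
theorem dd_subst (g : Fin m → L) (w : Ext k L) (x : Ext k (Fin (m + 1))) :
    dd (subst g w x) = subst g w (dd x) := by
  have h0 : pd 0 (inv (pd 0 x)) = 0 := by rw [pd, ctr_inv, ctr_ctr, map_zero, neg_zero]
  rw [subst_apply, subst_apply, map_add, dd, ctr_mul, ctr_mul, ctr_ctr, mul_zero, add_zero]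
  rw [← dd, dd_dropMap, dd_dropMap, h0, map_zero, sub_zero, inv_dropMap, inv_inv, sub_mul,
    pd, ctr_comm (Finsupp.lapply 0), ctr_inv, map_neg]
  simp only [map_neg]
  abel

theorem subst_mul_left (g : Fin m → L) (w : Ext k L) {x : Ext k (Fin (m + 1))}
    (hx : pd 0 x = 0) (y : Ext k (Fin (m + 1))) :
    subst g w (x * y) = dropMap k g x * subst g w y := by
  rw [subst_apply, subst_apply, pd, ctr_mul, hx, zero_mul, zero_add, map_mul, inv_inv, map_mul,
    map_mul, mul_add, mul_assoc, mul_assoc]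

/-- Moving `y` past `dd w` costs `q * (r + 1)`; moving it past `w` costs `q * r`, and the parity
automorphism adds the missing `q`. -/
theorem subst_mul_right (g : Fin m → L) {q r : ℤ} {w : Ext k L} (hw : w ∈ parity k L r)
    (x : Ext k (Fin (m + 1))) {y : Ext k (Fin (m + 1))} (hy : pd 0 y = 0)
    (hq : y ∈ parity k _ q) :
    subst g w (x * y) = sg k (q * (r + 1)) • (subst g w x * dropMap k g y) := by
  rw [subst_apply, subst_apply, pd, ctr_mul, hy, mul_zero, add_zero, map_mul, inv_of_parity hq,
    map_mul, map_mul, mul_assoc, mul_assoc, map_smul, smul_mul_assoc]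
  have h1 := map_mul_comm_of_parity (dropZero k g) hq hw
  have h2 := map_mul_comm_of_parity (dropZero k g) hq (parity_ctr (coordSum k L) hw)
  rw [← dropMap] at h1 h2
  rw [h1, h2, smul_smul, ← sg_add, mul_smul_comm, mul_smul_comm, ← mul_assoc, ← mul_assoc, add_mul,
    smul_add, show q + q * r = q * (r + 1) by ring]

/-- An odd generator is replaced by an element of parity `r`, or the scalar `1` by `dd w`: both
change the parity by `r + 1`. -/
theorem subst_inv (g : Fin m → L) {r : ℤ} {w : Ext k L} (hw : w ∈ parity k L r)
    (x : Ext k (Fin (m + 1))) : subst g w (inv x) = sg k (r + 1) • inv (subst g w x) := by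
  rw [subst_apply, subst_apply, map_add, map_mul, map_mul, inv_dropMap, inv_dropMap, inv_inv,
    inv_of_parity hw, inv_of_parity (parity_ctr (coordSum k L) hw), pd, ctr_inv, map_neg, inv_inv,
    map_neg, mul_smul_comm, mul_smul_comm, smul_add, smul_smul, smul_smul, sg_mul_self, one_smul,
    sg_add_one, neg_mul, neg_mul, sg_mul_self]
  simp

theorem pd_zero_opVal {n : ℕ} {d : ℤ} (o : Op n d) (a : Fin n → Ext k L) (l : L)
    (h : ∀ i, pd l (a i) = 0) : pd l (opVal o a) = 0 := by
  have hdd : ∀ x : Ext k L, pd l x = 0 → pd l (dd x) = 0 := fun x hx => by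
    rw [pd, ctr_comm, hx, map_zero, neg_zero]
  have hinv : ∀ x : Ext k L, pd l x = 0 → pd l (inv x) = 0 := fun x hx => by
    rw [pd, ctr_inv, hx, map_zero, neg_zero]
  have hmul : ∀ x y : Ext k L, pd l x = 0 → pd l y = 0 → pd l (x * y) = 0 := fun x y hx hy => by
    rw [pd, ctr_mul, hx, hy, zero_mul, mul_zero, add_zero]
  cases o with
  | circ σ =>
    by_cases hσ : σ = 1
    · simp only [opVal, hσ, if_true]
      exact hmul _ _ (h 0) (hdd _ (h 1))
    · simp only [opVal, hσ, if_false, map_neg]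
      rw [hmul _ _ (hinv _ (hdd _ (h 0))) (h 1), neg_zero]
  | bullet =>
    simp only [opVal, map_neg]
    rw [hmul _ _ (hinv _ (h 0)) (h 1), neg_zero]

theorem Tree.pd_model [DecidableEq L] {T : Tree (preLieGen k).signDual L} {l : L}
    (h : T.count l = 0) : pd l T.model = 0 := by
  induction T with
  | leaf l' =>
    rw [Tree.count] at h
    rw [Tree.model, pd, ctr_ι]
    have : l' ≠ l := by simpa using h
    simp [this]
  | node n d e ch ih =>
    rw [Tree.count, sum_eq_zero_iff] at h
    rw [Tree.model, map_sum]
    refine sum_eq_zero fun o _ => ?_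
    rw [map_smul, pd_zero_opVal _ _ _ fun i => ih i (h i (mem_univ i)), smul_zero]

/-- The trees to be glued to the inputs: `T'` to the input `0`, leaves to the other inputs. -/
def plug {M : GrSMod k} (g : Fin m → L) (T' : Tree M L) : Fin (m + 1) → Tree M L :=
  Fin.cons T' fun j => .leaf (g j)

theorem opVal_dropMap {n : ℕ} {d : ℤ} (o : Op n d) (g : Fin m → L)
    (a : Fin n → Ext k (Fin (m + 1))) (h : ∀ i, pd 0 (a i) = 0) :
    opVal o (fun i => dropMap k g (a i)) = dropMap k g (opVal o a) := by
  have hdd : ∀ i, dd (dropMap k g (a i)) = dropMap k g (dd (a i)) := fun i => by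
    rw [dd_dropMap, h, map_zero, sub_zero]
  cases o with
  | circ σ =>
    by_cases hσ : σ = 1
    · simp only [opVal, hσ, if_true, map_mul, hdd]
    · simp only [opVal, hσ, if_false, map_mul, map_neg, hdd, inv_dropMap]
  | bullet => simp only [opVal, map_mul, map_neg, inv_dropMap]

theorem model_bind_of_count_zero {T : Tree (preLieGen k).signDual (Fin (m + 1))}
    (h : T.count 0 = 0) (g : Fin m → L) (T' : Tree (preLieGen k).signDual L) :
    (T.bind (plug g T')).model = dropMap k g T.model := by
  induction T with
  | leaf l =>
    cases l using Fin.cases with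
    | zero => simp [Tree.count] at h
    | succ j =>
      simp only [Tree.bind, plug, Fin.cons_succ, Tree.model, dropMap, ExteriorAlgebra.map_apply_ι,
        dropZero_succ]
  | node n d e ch ih =>
    rw [Tree.count, sum_eq_zero_iff] at h
    rw [Tree.bind, Tree.model, Tree.model, map_sum]
    refine sum_congr rfl fun o _ => ?_
    rw [map_smul, ← opVal_dropMap o g _ fun i => Tree.pd_model (h i (mem_univ i))]
    congr 2
    funext i
    exact ih i (h i (mem_univ i))

/-- The inductive step for gluing. The sum over `j` is the cost of moving the inserted vertices past
the siblings to the right: it arises from `subst_mul_right` when `i₀ = 0`, while for `i₀ = 1` the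
sibling is on the left and `subst_mul_left` costs nothing. -/
theorem opVal_subst {n : ℕ} {d : ℤ} (o : Op n d) (g : Fin m → L) {r : ℤ} {w : Ext k L}
    (hw : w ∈ parity k L (1 + r)) (a : Fin n → Ext k (Fin (m + 1))) (a' : Fin n → Ext k L)
    (t : Fin n → ℤ) (ht : ∀ i, a i ∈ parity k _ (1 + t i)) (i₀ : Fin n)
    (h : ∀ i, i ≠ i₀ → pd 0 (a i) = 0) (ha : ∀ i, i ≠ i₀ → a' i = dropMap k g (a i)) (z : ℤ)
    (hz : sg k (r * z) • a' i₀ = subst g w (a i₀)) :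
    sg k (r * (z + ∑ j, if i₀ < j then t j else 0)) • opVal o a' = subst g w (opVal o a) := by
  have hdd : ∀ i, i ≠ i₀ → dd (a' i) = dropMap k g (dd (a i)) := fun i hi => by
    rw [ha i hi, dd_dropMap, h i hi, map_zero, sub_zero]
  have hpd : ∀ i, i ≠ i₀ → pd 0 (dd (a i)) = 0 := fun i hi => by
    rw [pd, ctr_comm, h i hi, map_zero, neg_zero]
  have hpi : ∀ x : Ext k (Fin (m + 1)), pd 0 x = 0 → pd 0 (inv x) = 0 := fun x hx => by
    rw [pd, ctr_inv, hx, map_zero, neg_zero]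
  have hn : n = 2 := by cases o <;> rfl
  subst hn
  have hcases : i₀ = 0 ∨ i₀ = 1 := by fin_cases i₀ <;> simp
  have hS : ∀ u v : k, ∀ x y : Ext k L, u = v → x = y → u • x = v • y := by
    rintro u v x y rfl rfl; rfl
  rw [Fin.sum_univ_two]
  rcases hcases with rfl | rfl
  · have n1 : (1 : Fin 2) ≠ 0 := by decide
    simp only [lt_irrefl, if_false, zero_add, Fin.zero_lt_one, if_true]
    cases o with
    | circ σ =>
      by_cases hσ : σ = 1
      · simp only [opVal, hσ, if_true]
        rw [subst_mul_right g hw _ (hpd 1 n1) (parity_ctr _ (ht 1)), ← hz, hdd 1 n1,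
          smul_mul_assoc, smul_smul, ← sg_add]
        exact sg_smul_eq ⟨-(t 1 + 2 + r), by ring⟩ _
      · simp only [opVal, hσ, if_false]
        rw [map_neg, subst_mul_right g hw _ (h 1 n1) (ht 1), subst_inv g hw, ← dd_subst, ← hz,
          ha 1 n1, map_smul, map_smul, smul_mul_assoc, smul_smul, smul_mul_assoc, smul_smul,
          smul_neg, ← sg_add, ← sg_add]
        congr 1
        exact sg_smul_eq ⟨-(t 1 + 2 + r), by ring⟩ _
    | bullet =>
      simp only [opVal]
      rw [map_neg, subst_mul_right g hw _ (h 1 n1) (ht 1), subst_inv g hw, ← hz,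
        ha 1 n1, map_smul, smul_mul_assoc, smul_smul, smul_mul_assoc, smul_smul,
        smul_neg, ← sg_add, ← sg_add]
      congr 1
      exact sg_smul_eq ⟨-(t 1 + 2 + r), by ring⟩ _
  · have n0 : (0 : Fin 2) ≠ 1 := by decide
    simp only [lt_irrefl, if_false, add_zero, Fin.not_lt_zero]
    cases o with
    | circ σ =>
      by_cases hσ : σ = 1
      · simp only [opVal, hσ, if_true]
        rw [subst_mul_left g w (h 0 n0), ← dd_subst, ← hz, ha 0 n0, map_smul, mul_smul_comm]
      · simp only [opVal, hσ, if_false]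
        rw [map_neg, subst_mul_left g w (hpi _ (hpd 0 n0)), ← hz, hdd 0 n0, inv_dropMap,
          mul_smul_comm, smul_neg]
    | bullet =>
      simp only [opVal]
      rw [map_neg, subst_mul_left g w (hpi _ (h 0 n0)), ← hz, ha 0 n0, inv_dropMap,
        mul_smul_comm, smul_neg]

/-- Gluing of a tree at the input `0`, in the exterior algebra. -/
theorem model_bind {T : Tree (preLieGen k).signDual (Fin (m + 1))}
    (h : T.count 0 = 1) (g : Fin m → L) (T' : Tree (preLieGen k).signDual L) :
    sg k (T'.deg * T.degAfter 0) • (T.bind (plug g T')).model = subst g T'.model T.model := by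
  induction T with
  | leaf l =>
    cases l using Fin.cases with
    | zero =>
      simp only [Tree.bind, plug, Fin.cons_zero, Tree.model, Tree.degAfter, mul_zero, sg_zero,
        one_smul]
      rw [subst_apply, pd, ctr_ι, dropMap, ExteriorAlgebra.map_apply_ι, dropZero_zero]
      simp
    | succ j => simp [Tree.count] at h
  | node n d e ch ih =>
    -- The leaf `0` lies in exactly one subtree; only there does the induction hypothesis apply.
    have hex : ∃ i₀, (ch i₀).count 0 = 1 ∧ ∀ i, i ≠ i₀ → (ch i).count 0 = 0 := by
      rw [Tree.count] at h
      obtain ⟨i₀, -, hi⟩ : ∃ i ∈ univ, (ch i).count 0 ≠ 0 := by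
        by_contra! h'
        rw [sum_eq_zero h'] at h
        exact absurd h (by decide)
      have h1 := add_sum_erase univ (fun i => (ch i).count 0) (mem_univ i₀)
      simp only [h] at h1
      refine ⟨i₀, by omega, fun i hi' => ?_⟩
      have h2 : ∑ i ∈ univ.erase i₀, (ch i).count 0 = 0 := by omega
      exact sum_eq_zero_iff.1 h2 i (mem_erase.2 ⟨hi', mem_univ _⟩)
    obtain ⟨i₀, h0, h1⟩ := hex
    have hdeg : (Tree.node n d e ch).degAfter 0
        = (ch i₀).degAfter 0 + ∑ j : Fin n, if i₀ < j then (ch j).deg else 0 := by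
      rw [Tree.degAfter, sum_eq_single i₀]
      · rw [if_neg (by rw [h0]; decide)]
      · intro i _ hi
        rw [if_pos (h1 i hi)]
      · simp
    rw [hdeg, Tree.bind, Tree.model, Tree.model, map_sum, smul_sum]
    refine sum_congr rfl fun o _ => ?_
    rw [map_smul, smul_comm]
    congr 1
    exact opVal_subst o g T'.model_parity _ _ (fun j => (ch j).deg) (fun i => (ch i).model_parity)
      i₀ (fun i hi => Tree.pd_model (h1 i hi)) (fun i hi => model_bind_of_count_zero (h1 i hi) g T')
      _ (ih i₀ h0)

end Substitution

/-! ### Coefficients of a composite. -/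

section CoefficientsOfSubstitution

variable {k : Type u} [Field k] {L : Type} {m m' : ℕ}

theorem coefL_inv (l : List L) (x : Ext k L) : coefL k l (inv x) = sg k l.length * coefL k l x := by
  induction l generalizing x with
  | nil => rw [coefL_nil, coefL_nil, scal_inv]; simp [sg_zero]
  | cons i l ih =>
    rw [coefL_cons, coefL_cons, pd, ctr_inv, map_neg, ih, List.length_cons]
    push_cast
    rw [sg_add_one, neg_mul]

theorem coordSum_eq_sum [Fintype L] (k : Type u) [Field k] :
    coordSum k L = ∑ j : L, Finsupp.lapply j := by
  classical
  ext i
  simp [Finsupp.single_apply]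

theorem coefL_dd [Fintype L] (l : List L) (x : Ext k L) :
    coefL k l (dd x) = ∑ j : L, coefL k (j :: l) x := by
  simp only [coefL_cons, dd, coordSum_eq_sum, pd, ← map_sum]
  rw [ctr, map_sum, LinearMap.sum_apply]

/-- Contractions with inputs from `β` kill the second factor, so they act on the first alone.
Afterwards all generators outside the image of `α` may be set to zero, which leaves the scalar part
of the first factor. -/
theorem coefL_split {β : Fin m → L} (hβ : Function.Injective β) {α : Fin m' → L}
    (hα : Function.Injective α) (h : ∀ i j, β i ≠ α j) (l₁ : List (Fin m)) (l₂ : List (Fin m'))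
    (y : Ext k (Fin (m + 1))) (w : Ext k (Fin m')) :
    coefL k (l₁.map β ++ l₂.map α)
        (dropMap k β y * ExteriorAlgebra.map (Finsupp.lmapDomain k k α) w)
      = coefL k (l₁.map Fin.succ) y * coefL k l₂ w := by
  classical
  induction l₁ generalizing y with
  | nil =>
    let f : (L →₀ k) →ₗ[k] (L →₀ k) := Finsupp.linearCombination k
      (fun j => if j ∈ Set.range α then Finsupp.single j 1 else 0)
    have hf : ∀ j, f (Finsupp.single j 1) = if j ∈ Set.range α then Finsupp.single j 1 else 0 :=
      fun j => by simp only [f, Finsupp.linearCombination_single, one_smul]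
    have h1 : f ∘ₗ dropZero k β = 0 := by
      refine Finsupp.lhom_ext' fun j => LinearMap.ext_ring ?_
      simp only [LinearMap.comp_apply, Finsupp.lsingle_apply, LinearMap.zero_apply]
      cases j using Fin.cases with
      | zero => rw [dropZero_zero, map_zero]
      | succ j =>
        rw [dropZero_succ, hf, if_neg]
        rintro ⟨i, hi⟩
        exact h j i hi.symm
    have h2 : f ∘ₗ Finsupp.lmapDomain k k α = Finsupp.lmapDomain k k α := by
      refine Finsupp.lhom_ext' fun j => LinearMap.ext_ring ?_
      simp only [LinearMap.comp_apply, Finsupp.lsingle_apply, Finsupp.lmapDomain_apply,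
        Finsupp.mapDomain_single]
      rw [hf, if_pos ⟨j, rfl⟩]
    rw [List.map_nil, List.nil_append, ← coefL_map_erase (f := f), map_mul, dropMap, map_map_ext,
      map_map_ext, h1, h2, map_zero_ext, ← Algebra.smul_def, map_smul, coefL_map hα, List.map_nil,
      coefL_nil, smul_eq_mul]
    intro i hi
    obtain ⟨j, -, rfl⟩ := List.mem_map.1 hi
    refine Finsupp.lhom_ext' fun a => LinearMap.ext_ring ?_
    simp only [LinearMap.comp_apply, Finsupp.lsingle_apply, hf]
    split_ifs with ha
    · rfl
    · have : a ≠ α j := fun h => ha ⟨j, h.symm⟩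
      simp [this]
  | cons i l₁ ih =>
    have h1 : (Finsupp.lapply (β i) : (L →₀ k) →ₗ[k] k) ∘ₗ Finsupp.lmapDomain k k α = 0 := by
      refine Finsupp.lhom_ext' fun a => LinearMap.ext_ring ?_
      simp [Finsupp.mapDomain_single, (h i a).symm]
    have h2 : (Finsupp.lapply (β i) : (L →₀ k) →ₗ[k] k) ∘ₗ dropZero k β
        = Finsupp.lapply i.succ := by
      refine Finsupp.lhom_ext' fun a => LinearMap.ext_ring ?_
      simp only [LinearMap.comp_apply, Finsupp.lsingle_apply]
      cases a using Fin.cases with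
      | zero => simp [dropZero_zero]
      | succ a => simp [dropZero_succ, Finsupp.single_apply, hβ.eq_iff]
    rw [List.map_cons, List.cons_append, coefL_cons, pd, ctr_mul, ctr_map _ (Finsupp.lmapDomain _ _ _),
      h1, ctr_zero_left, map_zero, mul_zero, add_zero, dropMap, ctr_map, h2, ← dropMap, ih]
    rfl

/-- The origin of the two sums: either the input `0` is among the contracted generators of the lower
tree, or `dd` of the inserted value is expanded into all partial contractions. -/
theorem coefL_subst {β : Fin m → L} (hβ : Function.Injective β) {α : Fin m' → L}
    (hα : Function.Injective α) (h : ∀ i j, β i ≠ α j) (l₁ : List (Fin m)) (l₂ : List (Fin m'))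
    (y : Ext k (Fin (m + 1))) (w : Ext k (Fin m')) :
    coefL k (l₁.map β ++ l₂.map α)
        (subst β (ExteriorAlgebra.map (Finsupp.lmapDomain k k α) w) y)
      = sg k l₁.length * coefL k (0 :: l₁.map Fin.succ) y * coefL k l₂ w
        + ∑ j, coefL k (l₁.map Fin.succ) y * coefL k (j :: l₂) w := by
  have hc : coordSum k L ∘ₗ Finsupp.lmapDomain k k α = coordSum k (Fin m') := by
    refine Finsupp.lhom_ext' fun a => LinearMap.ext_ring ?_
    simp [Finsupp.mapDomain_single]
  rw [subst_apply, map_add, coefL_split hβ hα h, coefL_inv, dd, ctr_map, hc, coefL_split hβ hα h,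
    coefL_dd, mul_sum, List.length_map]
  rfl

end CoefficientsOfSubstitution

/-! ### Gluing trees along two complementary sets of inputs. -/

section Insertion

variable {k : Type u} [Field k] {m m' n : ℕ}

/-- Gluing of a tree to the leaf `0`, with inputs renamed by `β` and `α`. -/
def glue {M : GrSMod k} (β : Fin m → Fin n) (α : Fin m' → Fin n) (T : Tree M (Fin (m + 1)))
    (T' : Tree M (Fin m')) : Tree M (Fin n) := T.bind (plug β (T'.map α))

/-- The two maps are the inclusions of two complementary subsets. -/
structure Shuffle (β : Fin m → Fin n) (α : Fin m' → Fin n) : Prop where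
  left : Function.Injective β
  right : Function.Injective α
  disjoint : ∀ i j, β i ≠ α j
  cover : ∀ l, (∃ i, β i = l) ∨ ∃ j, α j = l

theorem shuffle_orderEmb {A : Finset (Fin n)} (h : #Aᶜ = m) (h' : #A = m') :
    Shuffle (Aᶜ.orderEmbOfFin h) (A.orderEmbOfFin h') where
  left := (Aᶜ.orderEmbOfFin h).injective
  right := (A.orderEmbOfFin h').injective
  disjoint i j hij := by
    have h1 := Aᶜ.orderEmbOfFin_mem h i
    rw [hij, mem_compl] at h1
    exact h1 (A.orderEmbOfFin_mem h' j)
  cover l := by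
    by_cases hl : l ∈ A
    · have : l ∈ Set.range (A.orderEmbOfFin h') := by rw [range_orderEmbOfFin]; exact hl
      exact .inr this
    · have : l ∈ Set.range (Aᶜ.orderEmbOfFin h) := by rw [range_orderEmbOfFin]; simpa using hl
      exact .inl this

theorem Shuffle.add_eq {β : Fin m → Fin n} {α : Fin m' → Fin n} (h : Shuffle β α) : m + m' = n := by
  have hb : Function.Bijective (Sum.elim β α) := by
    constructor
    · exact h.left.sumElim h.right h.disjoint
    · intro l
      rcases h.cover l with ⟨i, hi⟩ | ⟨j, hj⟩
      · exact ⟨.inl i, hi⟩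
      · exact ⟨.inr j, hj⟩
  simpa using Fintype.card_of_bijective hb

theorem Tree.count_map_of_injective {M : GrSMod k} {L L' : Type} [DecidableEq L] [DecidableEq L']
    {f : L → L'} (hf : Function.Injective f) (T : Tree M L) (l : L) :
    (T.map f).count (f l) = T.count l := by
  induction T with
  | leaf l' => simp [Tree.map, Tree.count, hf.eq_iff]
  | node n d e ch ih => simp [Tree.map, Tree.count, ih]

theorem Tree.count_map_of_notMem {M : GrSMod k} {L L' : Type} [DecidableEq L']
    {f : L → L'} (T : Tree M L) {l : L'} (h : ∀ a, f a ≠ l) :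
    (T.map f).count l = 0 := by
  induction T with
  | leaf l' => simp [Tree.map, Tree.count, h]
  | node n d e ch ih => simp [Tree.map, Tree.count, ih]

theorem Tree.count_bind {M : GrSMod k} {L L' : Type} [DecidableEq L] [Fintype L] [DecidableEq L']
    (f : L → Tree M L') (T : Tree M L) (l : L') :
    (T.bind f).count l = ∑ a, T.count a * (f a).count l := by
  induction T with
  | leaf l' => simp [Tree.bind, Tree.count]
  | node n d e ch ih =>
    simp only [Tree.bind, Tree.count, ih, sum_mul]
    rw [sum_comm]

theorem glue_multilinear {M : GrSMod k} {β : Fin m → Fin n} {α : Fin m' → Fin n} (h : Shuffle β α)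
    {T : Tree M (Fin (m + 1))} (hT : T.Multilinear) {T' : Tree M (Fin m')} (hT' : T'.Multilinear) :
    (glue β α T T').Multilinear := by
  intro l
  rw [glue, Tree.count_bind, Fin.sum_univ_succ]
  simp only [plug, Fin.cons_zero, Fin.cons_succ, hT _, one_mul, Tree.count]
  rcases h.cover l with ⟨i, rfl⟩ | ⟨j, rfl⟩
  · rw [Tree.count_map_of_notMem _ fun a ha => h.disjoint i a ha.symm]
    simp [h.left.eq_iff]
  · rw [Tree.count_map_of_injective h.right, hT']
    simp [h.disjoint]

/-- Every comb has at least one leaf counted by `•`. In degree `1`, where homogeneity alone says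
nothing, there are no standard combs at all. -/
theorem coefL_model_nil {T : Tree (preLieGen k).signDual (Fin n)} (hT : T.Multilinear) :
    coefL k [] T.model = 0 := by
  by_cases h : T.deg = 1
  · have h0 := dcls_mem_span_stdComb hT
    have : {x | ∃ I : Finset (Fin n), I.Nonempty ∧ (#I : ℤ) = 1 - T.deg ∧ x = dcls (stdComb k I)}
        = ∅ := by
      refine Set.eq_empty_iff_forall_notMem.2 ?_
      rintro x ⟨I, hI, hc, -⟩
      have := card_pos.2 hI
      omega
    rw [this, Submodule.span_empty, Submodule.mem_bot] at h0
    rw [← modelHom_cls]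
    exact (congrArg (fun x => coefL k [] (modelHom k _ x)) h0).trans (by simp)
  · exact coefL_model_eq_zero List.nodup_nil hT (by simpa using h)

/-- The dual of the composition, on a coefficient form. -/
theorem coefL_glue {β : Fin m → Fin n} {α : Fin m' → Fin n} (h : Shuffle β α)
    (l₁ : List (Fin m)) (l₂ : List (Fin m'))
    {T : Tree (preLieGen k).signDual (Fin (m + 1))} (hT : T.Multilinear)
    (T' : Tree (preLieGen k).signDual (Fin m')) :
    sg k (T'.deg * T.degAfter 0) * coefL k (l₁.map β ++ l₂.map α) (glue β α T T').model
      = sg k l₁.length * coefL k (0 :: l₁.map Fin.succ) T.model * coefL k l₂ T'.model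
        + ∑ j, coefL k (l₁.map Fin.succ) T.model * coefL k (j :: l₂) T'.model := by
  rw [← coefL_subst h.left h.right h.disjoint, ← Tree.model_map, ← model_bind (hT 0), map_smul,
    Tree.deg_map]
  rfl

end Insertion

/-! ### Cocompositions of coefficient forms. -/

section Cocomposition

variable {k : Type u} [Field k] {m m' n : ℕ}

/-- Finite sums of tensors of generators of arities `m + 1` and `m'`. -/
abbrev Tens (k : Type u) [Field k] (m m' : ℕ) : Type u :=
  List (Σ a : ℤ, Σ b : ℤ, (infGen k).X (m + 1) a × (infGen k).X m' b)

/-- `Δ` is the image of `f` under the dual of the composition. -/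
def IsCoc {d : ℤ} (f : (infGen k).X n d) (β : Fin m → Fin n) (α : Fin m' → Fin n)
    (Δ : Tens k m m') : Prop :=
  ∀ (T : Tree (preLieGen k).signDual (Fin (m + 1))) (T' : Tree (preLieGen k).signDual (Fin m')),
    T.Multilinear → T'.Multilinear →
    sg k (T'.deg * T.degAfter 0) * (dualPreLieTwo k).ev f (glue β α T T')
      = (Δ.map fun s => (dualPreLieTwo k).ev s.2.2.1 T * (dualPreLieTwo k).ev s.2.2.2 T').sum

/-- The cocomposition of the coefficient form of a list, in the case that the glued tree
has all the `•` of its inputs. -/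
def coTensLeft (r : k) (l₁ : List (Fin m)) (l₂ : List (Fin m')) : Tens k m m' :=
  -- The coefficient of the empty list vanishes on values of trees, so this term would be zero.
  if l₂ = [] then [] else
    [⟨1 + l₁.length - m, 1 + l₂.length - m',
      (r * sg k l₁.length) • coefF k (m + 1) _ (0 :: l₁.map Fin.succ), coefF k m' _ l₂⟩]

/-- The other summand of the cocomposition. -/
def coTensRight (r : k) (l₁ : List (Fin m)) (l₂ : List (Fin m')) : Tens k m m' :=
  if l₁ = [] then [] else
    -- An index already in `l₂` would be contracted twice, which gives zero.
    ((List.finRange m').filter (· ∉ l₂)).map fun j => ⟨l₁.length - m, 2 + l₂.length - m',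
      r • coefF k (m + 1) _ (l₁.map Fin.succ), coefF k m' _ (j :: l₂)⟩

theorem isCoc_coefF {d : ℤ} {β : Fin m → Fin n} {α : Fin m' → Fin n} (h : Shuffle β α)
    (hm : 1 ≤ m) (hm' : 2 ≤ m') {l₁ : List (Fin m)} {l₂ : List (Fin m')} (h₁ : l₁.Nodup)
    (h₂ : l₂.Nodup) (hd : d + n = 1 + l₁.length + l₂.length) (r : k) :
    IsCoc (r • coefF k n d (l₁.map β ++ l₂.map α)) β α
      (coTensLeft r l₁ l₂ ++ coTensRight r l₁ l₂) := by
  intro T T' hT hT'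
  have hn := h.add_eq
  have hnd : (l₁.map β ++ l₂.map α).Nodup := by
    rw [List.nodup_append']
    refine ⟨h₁.map h.left, h₂.map h.right, fun a ha hb => ?_⟩
    obtain ⟨i, -, rfl⟩ := List.mem_map.1 ha
    obtain ⟨j, -, hj⟩ := List.mem_map.1 hb
    exact h.disjoint i j hj.symm
  have hs : (l₁.map (Fin.succ (n := m))).Nodup := h₁.map (Fin.succ_injective _)
  have hs0 : (0 :: l₁.map (Fin.succ (n := m))).Nodup := by
    rw [List.nodup_cons]
    refine ⟨fun h0 => ?_, hs⟩
    obtain ⟨i, -, hi⟩ := List.mem_map.1 h0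
    exact Fin.succ_ne_zero i hi
  have hlen : d + n = 1 + ((l₁.map β ++ l₂.map α).length : ℤ) := by
    rw [List.length_append, List.length_map, List.length_map, hd, Nat.cast_add, add_assoc]
  rw [ev_smul, ev_coefF (by omega) hnd hlen (glue_multilinear h hT hT'), mul_left_comm,
    coefL_glue h l₁ l₂ hT, List.map_append, List.sum_append, mul_add]
  congr 1
  · rw [coTensLeft]
    split_ifs with hl
    · subst hl
      rw [coefL_model_nil hT']
      simp
    · rw [List.map_singleton, List.sum_singleton, ev_smul, ev_coefF (by omega) hs0 _ hT,
        ev_coefF hm' h₂ (by ring) hT']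
      · ring
      · rw [List.length_cons, List.length_map]; push_cast; ring
  · rw [coTensRight]
    split_ifs with hl
    · subst hl
      rw [List.map_nil, coefL_model_nil hT]
      simp
    · have e : ∀ j, j ∉ l₂ → (dualPreLieTwo k).ev (coefF k m' (2 + l₂.length - m') (j :: l₂)) T'
          = coefL k (j :: l₂) T'.model := fun j hj => by
        rw [ev_coefF hm' (List.nodup_cons.2 ⟨hj, h₂⟩) _ hT']
        rw [List.length_cons]; push_cast; ring
      have e2 : (dualPreLieTwo k).ev (r • coefF k (m + 1) (l₁.length - m) (l₁.map Fin.succ)) T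
          = r * coefL k (l₁.map Fin.succ) T.model := by
        rw [ev_smul, ev_coefF (by omega) hs _ hT]
        rw [List.length_map]; push_cast; ring
      rw [List.map_map, List.map_congr_left (g := fun j => r * (coefL k (l₁.map Fin.succ) T.model
        * coefL k (j :: l₂) T'.model))]
      -- `coefL_glue` sums over all `j`; those in `l₂` contribute nothing and extend the filtered
      -- sum.
      · rw [mul_sum, ← List.sum_toFinset _ ((List.nodup_finRange _).filter _)]
        symm
        refine sum_subset (subset_univ _) fun j _ hj => ?_
        have hj' : j ∈ l₂ := by simpa using hj
        rw [coefL_cons, coefL_eq_zero hj' (ctr_ctr _ _), mul_zero, mul_zero]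
      · intro j hj
        have hj' : j ∉ l₂ := by simpa using hj
        simp only [Function.comp]
        rw [e j hj', e2, mul_assoc]

/-- Records that the resulting differential has degree one, on which the Koszul signs rely. -/
theorem coTens_homogeneous {d : ℤ} (hn : m + m' = n) {l₁ : List (Fin m)} {l₂ : List (Fin m')}
    (hd : d + n = 1 + l₁.length + l₂.length) (r : k) :
    ∀ s ∈ coTensLeft r l₁ l₂ ++ coTensRight r l₁ l₂, s.1 + s.2.1 = d + 1 := by
  intro s hs
  rw [List.mem_append, coTensLeft, coTensRight] at hs
  rcases hs with hs | hs
  · split_ifs at hs with hl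
    · simp at hs
    · rw [List.mem_singleton] at hs
      subst hs
      simp only
      omega
  · split_ifs at hs with hl
    · simp at hs
    · obtain ⟨j, -, rfl⟩ := List.mem_map.1 hs
      simp only
      omega

/-- The sorted preimage of a set of inputs. -/
def pre (β : Fin m → Fin n) (I : Finset (Fin n)) : List (Fin m) :=
  (univ.filter fun i => β i ∈ I).sort (· ≤ ·)

theorem mem_pre {β : Fin m → Fin n} {I : Finset (Fin n)} {i : Fin m} : i ∈ pre β I ↔ β i ∈ I := by
  simp [pre]

theorem pre_nodup (β : Fin m → Fin n) (I : Finset (Fin n)) : (pre β I).Nodup := sort_nodup _ _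

theorem perm_pre {β : Fin m → Fin n} {α : Fin m' → Fin n} (h : Shuffle β α) (I : Finset (Fin n)) :
    (I.sort (· ≤ ·)).Perm ((pre β I).map β ++ (pre α I).map α) := by
  refine (List.perm_ext_iff_of_nodup (sort_nodup _ _) ?_).2 fun l => ?_
  · rw [List.nodup_append']
    refine ⟨(pre_nodup β I).map h.left, (pre_nodup α I).map h.right, fun a ha hb => ?_⟩
    obtain ⟨i, -, rfl⟩ := List.mem_map.1 ha
    obtain ⟨j, -, hj⟩ := List.mem_map.1 hb
    exact h.disjoint i j hj.symm
  · rw [mem_sort, List.mem_append, List.mem_map, List.mem_map]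
    simp only [mem_pre]
    constructor
    · intro hl
      rcases h.cover l with ⟨i, rfl⟩ | ⟨j, rfl⟩
      · exact .inl ⟨i, hl, rfl⟩
      · exact .inr ⟨j, hl, rfl⟩
    · rintro (⟨i, hi, rfl⟩ | ⟨i, hi, rfl⟩) <;> exact hi

theorem inversions_of_pairwise {l : List (Fin n)} (h : l.Pairwise (· ≤ ·)) : inversions l = 0 := by
  induction l with
  | nil => rfl
  | cons a l ih =>
    rw [List.pairwise_cons] at h
    rw [inversions_cons, ih h.2, List.countP_eq_zero.2]
    intro b hb
    simpa using h.1 b hb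

theorem inversions_sort (I : Finset (Fin n)) : inversions (I.sort (· ≤ ·)) = 0 :=
  inversions_of_pairwise (pairwise_sort I (· ≤ ·))

theorem coefF_sort_eq {d : ℤ} {l : List (Fin n)} {I : Finset (Fin n)}
    (h : (I.sort (· ≤ ·)).Perm l) :
    coefF k n d (I.sort (· ≤ ·)) = sg k (inversions l) • coefF k n d l := by
  rw [← coefF_perm h (sort_nodup _ _), inversions_sort, Nat.cast_zero, sg_zero]
  exact (one_smul _ _).symm

/-- The cocomposition of a multiple of a standard coefficient form. -/
theorem isCoc_coefF_sort {d : ℤ} {β : Fin m → Fin n} {α : Fin m' → Fin n} (h : Shuffle β α)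
    (hm : 1 ≤ m) (hm' : 2 ≤ m') {I : Finset (Fin n)} (hd : d + n = 1 + #I) (r : k) :
    let r' := r * sg k (inversions ((pre β I).map β ++ (pre α I).map α))
    IsCoc (r • coefF k n d (I.sort (· ≤ ·))) β α
        (coTensLeft r' (pre β I) (pre α I) ++ coTensRight r' (pre β I) (pre α I)) ∧
      ∀ s ∈ coTensLeft r' (pre β I) (pre α I) ++ coTensRight r' (pre β I) (pre α I),
        s.1 + s.2.1 = d + 1 := by
  intro r'
  have hl : d + n = 1 + (pre β I).length + (pre α I).length := by
    have := (perm_pre h I).length_eq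
    rw [length_sort, List.length_append, List.length_map, List.length_map] at this
    rw [hd, this]; push_cast; ring
  refine ⟨?_, coTens_homogeneous h.add_eq hl _⟩
  rw [coefF_sort_eq (perm_pre h I)]
  have e : r • sg k (inversions ((pre β I).map β ++ (pre α I).map α)) •
      coefF k n d ((pre β I).map β ++ (pre α I).map α)
      = r' • coefF k n d ((pre β I).map β ++ (pre α I).map α) := (mul_smul _ _ _).symm
  exact e ▸ isCoc_coefF h hm hm' (pre_nodup _ _) (pre_nodup _ _) hl r'

theorem IsCoc.add {d : ℤ} {f f' : (infGen k).X n d} {β : Fin m → Fin n} {α : Fin m' → Fin n}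
    {Δ Δ' : Tens k m m'} (h : IsCoc f β α Δ) (h' : IsCoc f' β α Δ') :
    IsCoc (f + f') β α (Δ ++ Δ') := by
  intro T T' hT hT'
  rw [ev_add, mul_add, h T T' hT hT', h' T T' hT hT', List.map_append, List.sum_append]

/-- Cocompositions add up, and coefficient forms have explicit ones. -/
theorem exists_isCoc {d : ℤ} {β : Fin m → Fin n} {α : Fin m' → Fin n} (h : Shuffle β α)
    (hm : 1 ≤ m) (hm' : 2 ≤ m') (f : (infGen k).X n d) :
    ∃ Δ : Tens k m m', IsCoc f β α Δ ∧ ∀ s ∈ Δ, s.1 + s.2.1 = d + 1 := by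
  have hn := h.add_eq
  obtain ⟨r, rfl⟩ := infGen_expansion (by omega) f
  refine Finset.sum_induction _ (fun f : (infGen k).X n d =>
    ∃ Δ : Tens k m m', IsCoc f β α Δ ∧ ∀ s ∈ Δ, s.1 + s.2.1 = d + 1) ?_ ?_ ?_
  · rintro f f' ⟨Δ, h1, h2⟩ ⟨Δ', h1', h2'⟩
    refine ⟨Δ ++ Δ', h1.add h1', fun s hs => ?_⟩
    rcases List.mem_append.1 hs with hs | hs
    · exact h2 s hs
    · exact h2' s hs
  · refine ⟨[], fun T T' _ _ => ?_, by simp⟩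
    rw [ev_zero]
    simp
  · intro I hI
    simp only [mem_filter, mem_univ, true_and] at hI
    exact ⟨_, isCoc_coefF_sort h hm hm' (by rw [hI.2]; ring) (r I)⟩

end Cocomposition

/-! ### Sums over a cocomposition do not depend on its choice. -/

section Uniqueness

variable {k : Type u} [Field k] {m m' n : ℕ} {V : Type u} [AddCommGroup V] [Module k V]

/-- The degree of the coefficient form of a set. -/
def setDeg (m : ℕ) (I : Finset (Fin m)) : ℤ := 1 + #I - m

/-- The coefficient form of a set. -/
def setForm (k : Type u) [Field k] (I : Finset (Fin m)) : (infGen k).X m (setDeg m I) :=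
  coefF k m (setDeg m I) (I.sort (· ≤ ·))

/-- The coefficient of a generator with respect to a set. -/
def setCoef {a : ℤ} (φ : (infGen k).X m a) (I : Finset (Fin m)) : k :=
  sg k (combSign k I) * (dualPreLieTwo k).ev φ (stdComb k I)

/-- The sum runs over all nonempty sets, whatever `a` is: coefficients of sets of the wrong size
vanish. This frees later formulas from transport between equal degrees. -/
theorem expand_apply (hm : 2 ≤ m) (Ψ : ∀ a : ℤ, (infGen k).X m a →ₗ[k] V) {a : ℤ}
    (φ : (infGen k).X m a) : Ψ a φ = ∑ I : Finset (Fin m) with I.Nonempty,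
      setCoef φ I • Ψ _ (setForm k I) := by
  have h0 : (univ.filter fun I : Finset (Fin m) => I.Nonempty ∧ (#I : ℤ) = a + m - 1)
      ⊆ univ.filter fun I : Finset (Fin m) => I.Nonempty := by
    intro I hI
    simp only [mem_filter, mem_univ, true_and] at hI ⊢
    exact hI.1
  rw [← sum_subset h0]
  · conv_lhs => rw [infGen_expand hm φ]
    rw [map_sum]
    refine sum_congr rfl fun I hI => ?_
    simp only [mem_filter, mem_univ, true_and] at hI
    rw [map_smul, setCoef]
    have ha : a = setDeg m I := by rw [setDeg]; linarith [hI.2]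
    subst ha
    rfl
  · intro I hI hI'
    simp only [mem_filter, mem_univ, true_and] at hI hI'
    rw [setCoef, ev_of_deg_ne, mul_zero, zero_smul]
    rw [stdComb_deg hI]
    intro h
    exact hI' ⟨hI, by linarith⟩

/-- The sum of `Φ` over a cocomposition of `f`. -/
def coSum {d : ℤ} (f : (infGen k).X n d) (β : Fin m → Fin n) (α : Fin m' → Fin n)
    (Φ : ∀ a b : ℤ, (infGen k).X (m + 1) a →ₗ[k] (infGen k).X m' b →ₗ[k] V) : V :=
  ∑ I : Finset (Fin (m + 1)) with I.Nonempty, ∑ I' : Finset (Fin m') with I'.Nonempty,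
    (sg k (combSign k I) * sg k (combSign k I') *
      (sg k ((stdComb k I').deg * (stdComb k I).degAfter 0) *
        (dualPreLieTwo k).ev f (glue β α (stdComb k I) (stdComb k I')))) •
      Φ _ _ (setForm k I) (setForm k I')

theorem list_sum_sum {ι κ : Type*} (Δ : List ι) (s : Finset κ) (g : ι → κ → V) :
    (Δ.map fun i => ∑ j ∈ s, g i j).sum = ∑ j ∈ s, (Δ.map fun i => g i j).sum := by
  induction Δ with
  | nil => simp
  | cons i Δ ih => simp only [List.map_cons, List.sum_cons, ih, sum_add_distrib]

theorem list_sum_smul {ι : Type*} (Δ : List ι) (c : ι → k) (v : V) :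
    (Δ.map fun i => c i • v).sum = (Δ.map c).sum • v := by
  induction Δ with
  | nil => simp
  | cons i Δ ih => simp only [List.map_cons, List.sum_cons, ih, add_smul]

theorem list_sum_mul {ι : Type*} (Δ : List ι) (c : ι → k) (v : k) :
    (Δ.map fun i => v * c i).sum = v * (Δ.map c).sum := by
  induction Δ with
  | nil => simp
  | cons i Δ ih => simp only [List.map_cons, List.sum_cons, ih, mul_add]

/-- Expand both tensor factors in coefficient forms. The coefficients are evaluations on pairs of
standard combs, and these are what the defining identity of a cocomposition prescribes. -/
theorem coSum_eq (hm : 1 ≤ m) (hm' : 2 ≤ m') {d : ℤ} {f : (infGen k).X n d} {β : Fin m → Fin n}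
    {α : Fin m' → Fin n} {Δ : Tens k m m'} (h : IsCoc f β α Δ)
    (Φ : ∀ a b : ℤ, (infGen k).X (m + 1) a →ₗ[k] (infGen k).X m' b →ₗ[k] V) :
    (Δ.map fun s => Φ s.1 s.2.1 s.2.2.1 s.2.2.2).sum = coSum f β α Φ := by
  have e : ∀ s : Σ a : ℤ, Σ b : ℤ, (infGen k).X (m + 1) a × (infGen k).X m' b,
      Φ s.1 s.2.1 s.2.2.1 s.2.2.2 = ∑ I : Finset (Fin (m + 1)) with I.Nonempty,
        ∑ I' : Finset (Fin m') with I'.Nonempty, (setCoef s.2.2.1 I * setCoef s.2.2.2 I') •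
          Φ _ _ (setForm k I) (setForm k I') := by
    rintro ⟨a, b, φ, ψ⟩
    simp only
    have h1 := expand_apply (m := m + 1) (by omega) (fun a => (Φ a b).flip ψ) φ
    simp only [LinearMap.flip_apply] at h1
    rw [h1]
    refine sum_congr rfl fun I _ => ?_
    rw [expand_apply hm' (fun b => Φ _ b (setForm k I)) ψ, smul_sum]
    exact sum_congr rfl fun I' _ => smul_smul _ _ _
  simp only [e]
  rw [list_sum_sum, coSum]
  refine sum_congr rfl fun I hI => ?_
  rw [list_sum_sum]
  refine sum_congr rfl fun I' hI' => ?_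
  simp only [mem_filter, mem_univ, true_and] at hI hI'
  rw [list_sum_smul, h _ _ (stdComb_multilinear hI) (stdComb_multilinear hI'), ← list_sum_mul]
  congr 4
  funext s
  rw [setCoef, setCoef]
  ring

theorem coSum_add {d : ℤ} (f f' : (infGen k).X n d) (β : Fin m → Fin n) (α : Fin m' → Fin n)
    (Φ : ∀ a b : ℤ, (infGen k).X (m + 1) a →ₗ[k] (infGen k).X m' b →ₗ[k] V) :
    coSum (f + f') β α Φ = coSum f β α Φ + coSum f' β α Φ := by
  have e : ∀ T, (dualPreLieTwo k).ev (f + f') T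
      = (dualPreLieTwo k).ev f T + (dualPreLieTwo k).ev f' T := ev_add _ _ _
  simp only [coSum, e, mul_add, add_smul, sum_add_distrib]

theorem coSum_smul {d : ℤ} (r : k) (f : (infGen k).X n d) (β : Fin m → Fin n) (α : Fin m' → Fin n)
    (Φ : ∀ a b : ℤ, (infGen k).X (m + 1) a →ₗ[k] (infGen k).X m' b →ₗ[k] V) :
    coSum (r • f) β α Φ = r • coSum f β α Φ := by
  have e : ∀ T, (dualPreLieTwo k).ev (r • f) T = r * (dualPreLieTwo k).ev f T := ev_smul _ _ _
  simp only [coSum, e, smul_sum, smul_smul]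
  refine sum_congr rfl fun I _ => sum_congr rfl fun I' _ => ?_
  congr 1
  ring

end Uniqueness

/-! ### Koszul signs of permutations and shuffles. -/

section PermutationSigns

variable {k : Type u} [Field k] {m m' n : ℕ}

theorem Shuffle.sum_eq {V : Type*} [AddCommMonoid V] {β : Fin m → Fin n} {α : Fin m' → Fin n}
    (h : Shuffle β α) (f : Fin n → V) : ∑ i, f i = ∑ y, f (β y) + ∑ x, f (α x) := by
  have hb : Function.Bijective (Sum.elim β α) := by
    constructor
    · exact h.left.sumElim h.right h.disjoint
    · intro l
      rcases h.cover l with ⟨i, hi⟩ | ⟨j, hj⟩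
      · exact ⟨.inl i, hi⟩
      · exact ⟨.inr j, hj⟩
  rw [← Fintype.sum_bijective _ hb _ f fun _ => rfl, Fintype.sum_sum_type]
  rfl

/-- The exponent of the Koszul sign of a shuffle. -/
def shuffleExp (d : Fin n → ℤ) (β : Fin m → Fin n) (α : Fin m' → Fin n) : ℤ :=
  ∑ x, ∑ y, if β y < α x then d (α x) * d (β y) else 0

theorem unshuffleExp_eq (d : Fin n → ℤ) {A : Finset (Fin n)} (h : #Aᶜ = m) (h' : #A = m') :
    unshuffleExp d A = shuffleExp d (Aᶜ.orderEmbOfFin h) (A.orderEmbOfFin h') := by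
  have key : ∀ (A : Finset (Fin n)) {m : ℕ} (h : #A = m) (f : Fin n → ℤ),
      ∑ i ∈ A, f i = ∑ x, f (A.orderEmbOfFin h x) := fun A m h f => by
    conv_lhs => rw [← A.image_orderEmbOfFin_univ h]
    rw [sum_image fun a _ b _ hab => (A.orderEmbOfFin h).injective hab]
  rw [unshuffleExp, key A h', shuffleExp]
  exact sum_congr rfl fun x _ => key Aᶜ h _

/-- Two ways of reordering the same factors. Pairs within one block cancel because the embeddings
are monotone; a pair from different blocks is checked in the four possible combinations of its
orders before and after `σ`. -/
theorem koszulExp_shuffle (d : Fin n → ℤ) (σ : Equiv.Perm (Fin n))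
    {β β' : Fin m → Fin n} {α α' : Fin m' → Fin n} (h : Shuffle β α) (hβ : StrictMono β)
    (hα : StrictMono α) (hβ' : StrictMono β') (hα' : StrictMono α') (τ : Equiv.Perm (Fin m'))
    (τ₁ : Equiv.Perm (Fin m)) (hτ : ∀ x, σ (α x) = α' (τ x)) (hτ₁ : ∀ y, σ (β y) = β' (τ₁ y)) :
    Even (koszulExp d σ + shuffleExp (d ∘ σ) β α
      - (shuffleExp d β' α' + koszulExp (d ∘ α') τ + koszulExp (d ∘ β') τ₁)) := by
  have e1 : koszulExp (d ∘ α') τ = ∑ x, ∑ x', if α x < α x' ∧ σ (α x') < σ (α x) then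
      d (σ (α x)) * d (σ (α x')) else 0 := by
    simp only [koszulExp, hτ, hα.lt_iff_lt, hα'.lt_iff_lt, Function.comp]
  have e2 : koszulExp (d ∘ β') τ₁ = ∑ x, ∑ x', if β x < β x' ∧ σ (β x') < σ (β x) then
      d (σ (β x)) * d (σ (β x')) else 0 := by
    simp only [koszulExp, hτ₁, hβ.lt_iff_lt, hβ'.lt_iff_lt, Function.comp]
  have e3 : shuffleExp d β' α' = ∑ x, ∑ y, if σ (β y) < σ (α x) then
      d (σ (α x)) * d (σ (β y)) else 0 := by
    rw [shuffleExp, ← Equiv.sum_comp τ]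
    refine sum_congr rfl fun x _ => ?_
    rw [← Equiv.sum_comp τ₁]
    simp only [hτ, hτ₁]
  have e4 : koszulExp d σ = (koszulExp (d ∘ β') τ₁ + ∑ x, ∑ y, if β y < α x ∧ σ (α x) < σ (β y) then
      d (σ (β y)) * d (σ (α x)) else 0) + ((∑ x, ∑ y, if α x < β y ∧ σ (β y) < σ (α x) then
      d (σ (α x)) * d (σ (β y)) else 0) + koszulExp (d ∘ α') τ) := by
    rw [koszulExp, h.sum_eq]
    simp only [h.sum_eq (fun j => ite _ _ _), sum_add_distrib]
    rw [← e1, ← e2, sum_comm (s := univ (α := Fin m)) (t := univ (α := Fin m'))]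
  rw [e4, e3, shuffleExp]
  rw [show ∀ a b c e f g : ℤ, (a + b) + (c + e) + f - (g + e + a) = b + c + f - g by intros; ring,
    ← sum_add_distrib, ← sum_add_distrib, ← sum_sub_distrib]
  refine Finset.even_sum _ fun x _ => ?_
  rw [← sum_add_distrib, ← sum_add_distrib, ← sum_sub_distrib]
  refine Finset.even_sum _ fun y _ => ?_
  have hne : β y ≠ α x := h.disjoint y x
  have hne' : σ (β y) ≠ σ (α x) := fun h' => hne (σ.injective h')
  simp only [Function.comp]
  rcases lt_or_gt_of_ne hne with h1 | h1 <;> rcases lt_or_gt_of_ne hne' with h2 | h2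
  · simp [h1, h2, h1.not_gt, h2.not_gt]
  · simp [h1, h2, h1.not_gt, h2.not_gt]
    exact ⟨d (σ (β y)) * d (σ (α x)), by ring⟩
  · simp [h1, h2, h1.not_gt, h2.not_gt]
  · simp [h1, h2, h1.not_gt, h2.not_gt]

theorem sg_sum {ι : Type*} (s : Finset ι) (f : ι → ℤ) : sg k (∑ i ∈ s, f i) = ∏ i ∈ s, sg k (f i) := by
  classical
  induction s using Finset.induction_on with
  | empty => simp [sg_zero]
  | insert i s hi ih => rw [sum_insert hi, prod_insert hi, sg_add, ih]

/-- The sign character is the Koszul sign with all degrees one, so `koszulExp_shuffle` covers both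
kinds of signs. -/
theorem sign_eq_sg (σ : Equiv.Perm (Fin n)) :
    (((Equiv.Perm.sign σ : ℤˣ) : ℤ) : k) = sg k (koszulExp (fun _ => 1) σ) := by
  rw [Equiv.Perm.sign_eq_prod_prod_Ioi, koszulExp, sg_sum, Units.coe_prod, Int.cast_prod]
  refine prod_congr rfl fun i _ => ?_
  rw [sg_sum, Units.coe_prod, Int.cast_prod]
  rw [← prod_subset (subset_univ (Ioi i))]
  · refine prod_congr rfl fun j hj => ?_
    rw [mem_Ioi] at hj
    rcases lt_or_gt_of_ne (fun h => hj.ne (σ.injective h) : σ i ≠ σ j) with h | h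
    · simp [h, h.not_gt, sg_zero]
    · simp [h, h.not_gt, sg_one, hj]
  · intro j _ hj
    rw [mem_Ioi] at hj
    simp [hj, sg_zero]

/-- The extension of a permutation that fixes `0`. -/
def extendPerm (τ : Equiv.Perm (Fin m)) : Equiv.Perm (Fin (m + 1)) :=
  Equiv.Perm.decomposeFin.symm (0, τ)

theorem extendPerm_zero (τ : Equiv.Perm (Fin m)) : extendPerm τ 0 = 0 :=
  Equiv.Perm.decomposeFin_symm_apply_zero _ _

theorem extendPerm_succ (τ : Equiv.Perm (Fin m)) (i : Fin m) :
    extendPerm τ i.succ = (τ i).succ := by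
  rw [extendPerm, Equiv.Perm.decomposeFin_symm_apply_succ, Equiv.swap_self]
  rfl

theorem koszulExp_extendPerm (τ : Equiv.Perm (Fin m)) (d : Fin (m + 1) → ℤ) :
    koszulExp d (extendPerm τ) = koszulExp (fun i => d i.succ) τ := by
  simp only [koszulExp, Fin.sum_univ_succ, extendPerm_zero, extendPerm_succ, Fin.succ_lt_succ_iff,
    Fin.not_lt_zero, and_false, false_and, if_false, sum_const_zero, zero_add]

theorem sign_extendPerm (τ : Equiv.Perm (Fin m)) :
    Equiv.Perm.sign (extendPerm τ) = Equiv.Perm.sign τ := by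
  rw [extendPerm, Equiv.Perm.decomposeFin.symm_sign, if_pos rfl, one_mul]

theorem exists_perm_comp {α α' : Fin m' → Fin n} (σ : Equiv.Perm (Fin n))
    (hα : Function.Injective α)
    (h : ∀ x, ∃ x', σ (α x) = α' x') : ∃ τ : Equiv.Perm (Fin m'), ∀ x, σ (α x) = α' (τ x) := by
  choose f hf using h
  have hi : Function.Injective f := fun x y hxy => hα (σ.injective (by rw [hf, hf, hxy]))
  exact ⟨Equiv.ofBijective f (Finite.injective_iff_bijective.1 hi), hf⟩

end PermutationSigns

/-! ### Equivariance of cocompositions. -/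

section Equivariance

variable {k : Type u} [Field k] {m m' n : ℕ}

theorem Tree.map_bind {M : GrSMod k} {L L' L'' : Type} (f : L → Tree M L') (g : L' → L'')
    (T : Tree M L) : (T.bind f).map g = T.bind fun l => (f l).map g := by
  induction T with
  | leaf l => rfl
  | node n d e ch ih => simp [Tree.bind, Tree.map, ih]

theorem Tree.bind_map {M : GrSMod k} {L L' L'' : Type} (f : L → L') (g : L' → Tree M L'')
    (T : Tree M L) : (T.map f).bind g = T.bind fun l => g (f l) := by
  induction T with
  | leaf l => rfl
  | node n d e ch ih => simp [Tree.bind, Tree.map, ih]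

theorem Tree.degAfter_map {M : GrSMod k} {L L' : Type} [DecidableEq L] [DecidableEq L']
    {f : L → L'} (hf : Function.Injective f) (T : Tree M L) (l : L) :
    (T.map f).degAfter (f l) = T.degAfter l := by
  induction T with
  | leaf l => rfl
  | node n d e ch ih =>
    simp only [Tree.map, Tree.degAfter, Tree.count_map_of_injective hf, ih, Tree.deg_map]

/-- A renaming that maps the block of `α` to that of `α'`, and likewise for `β`, splits into one
renaming of each tree; the glued input `0` of the lower tree is fixed. -/
theorem glue_map {M : GrSMod k} {β β' : Fin m → Fin n} {α α' : Fin m' → Fin n}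
    {σ : Equiv.Perm (Fin n)} {τ : Equiv.Perm (Fin m')} {τ₁ : Equiv.Perm (Fin m)}
    (hτ : ∀ x, σ (α x) = α' (τ x)) (hτ₁ : ∀ y, σ (β y) = β' (τ₁ y))
    (T : Tree M (Fin (m + 1))) (T' : Tree M (Fin m')) :
    (glue β' α' T T').map σ.symm = glue β α (T.map (extendPerm τ₁).symm) (T'.map τ.symm) := by
  rw [glue, glue, Tree.map_bind, Tree.bind_map]
  congr 1
  funext l
  obtain ⟨l, rfl⟩ := (extendPerm τ₁).surjective l
  rw [Equiv.symm_apply_apply]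
  cases l using Fin.cases with
  | zero =>
    rw [extendPerm_zero]
    simp only [plug, Fin.cons_zero, Tree.map_map]
    congr 1
    funext x
    obtain ⟨x, rfl⟩ := τ.surjective x
    simp [← hτ]
  | succ y =>
    rw [extendPerm_succ]
    simp only [plug, Fin.cons_succ, Tree.map, ← hτ₁, Equiv.symm_apply_apply]

theorem Tree.Multilinear.map {M : GrSMod k} {T : Tree M (Fin n)} (h : T.Multilinear)
    (σ : Equiv.Perm (Fin n)) : (T.map σ).Multilinear := fun l => by
  rw [Tree.count_map]; exact h _

/-- The sign of an element of the symmetric group. -/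
abbrev sgnk (k : Type u) [Field k] (σ : Equiv.Perm (Fin n)) : k :=
  (((Equiv.Perm.sign σ : ℤˣ) : ℤ) : k)

/-- Relabelling of a tensor, multiplied by a scalar. -/
def actTens (r : k) (τ₁ : Equiv.Perm (Fin m)) (τ : Equiv.Perm (Fin m'))
    (s : Σ a : ℤ, Σ b : ℤ, (infGen k).X (m + 1) a × (infGen k).X m' b) :
    Σ a : ℤ, Σ b : ℤ, (infGen k).X (m + 1) a × (infGen k).X m' b :=
  let φ : (infGen k).X (m + 1) s.1 := (infGen k).act (m + 1) s.1 (extendPerm τ₁) s.2.2.1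
  ⟨s.1, s.2.1, r • φ, (infGen k).act m' s.2.1 τ s.2.2.2⟩

/-- Relabelling of a cocomposition. -/
theorem IsCoc.act {d : ℤ} {f : (infGen k).X n d} {β β' : Fin m → Fin n} {α α' : Fin m' → Fin n}
    {Δ : Tens k m m'} (h : IsCoc f β α Δ)
    {σ : Equiv.Perm (Fin n)} {τ : Equiv.Perm (Fin m')} {τ₁ : Equiv.Perm (Fin m)}
    (hτ : ∀ x, σ (α x) = α' (τ x)) (hτ₁ : ∀ y, σ (β y) = β' (τ₁ y)) :
    IsCoc ((infGen k).act n d σ f) β' α'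
      (Δ.map (actTens (sgnk k σ * sgnk k τ * sgnk k τ₁) τ₁ τ)) := by
  intro T T' hT hT'
  have h0 := h (T.map (extendPerm τ₁).symm) (T'.map τ.symm) (hT.map _) (hT'.map _)
  have h1 := Tree.degAfter_map (extendPerm τ₁).symm.injective T 0
  have h2 : (extendPerm τ₁).symm 0 = 0 := by
    rw [Equiv.symm_apply_eq, extendPerm_zero]
  rw [h2] at h1
  rw [Tree.deg_map, h1, ← glue_map hτ hτ₁] at h0
  rw [ev_act, mul_left_comm, h0, ← list_sum_mul, List.map_map]
  congr 2
  funext s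
  simp only [Function.comp, actTens]
  rw [ev_smul, ev_act, ev_act, sign_extendPerm]
  rcases Int.units_eq_one_or (Equiv.Perm.sign τ) with h | h <;>
  rcases Int.units_eq_one_or (Equiv.Perm.sign τ₁) with h' | h' <;>
  simp [h, h', sgnk] <;> ring

end Equivariance

/-! ### Two-vertex trees in the cobar construction. -/

section TwoVertices

variable {k : Type u} [Field k] {L : Type} {m m' n : ℕ}

/-- The cobar construction of `P^!`. -/
abbrev CSpace (k : Type u) [Field k] (L : Type) : Type u := (dualPreLieTwo k).CobarSpace L

/-- The class of a tree in the cobar construction. -/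
abbrev ccls (T : Tree (infGen k) L) : CSpace k L := cls ∅ T

/-- The tree with two vertices `φ`, `ψ` and with the given trees glued to the inputs. -/
def twoV (β : Fin m → Fin n) (α : Fin m' → Fin n) {a b : ℤ} (φ : (infGen k).X (m + 1) a)
    (ψ : (infGen k).X m' b) (ch : Fin n → Tree (infGen k) L) : Tree (infGen k) L :=
  .node _ a φ (Fin.cons (.node _ b ψ fun x => ch (α x)) fun y => ch (β y))

theorem ccls_node_cons {a : ℤ} (φ : (infGen k).X (m + 1) a) (T T' : Tree (infGen k) L)
    (ch : Fin m → Tree (infGen k) L) :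
    ccls (.node _ a φ (Fin.cons T ch : Fin (m + 1) → Tree (infGen k) L)) =
      graftAt ∅ _ a φ (Fin.cons T' ch : Fin (m + 1) → Tree (infGen k) L) 0 (ccls T) := by
  rw [graftAt_cls, Fin.update_cons_zero]

/-- The class of a two-vertex tree, as a bilinear map. -/
def twoVLin (β : Fin m → Fin n) (α : Fin m' → Fin n) (ch : Fin n → Tree (infGen k) L) (a b : ℤ) :
    (infGen k).X (m + 1) a →ₗ[k] (infGen k).X m' b →ₗ[k] CSpace k L :=
  LinearMap.mk₂ k (fun φ ψ => ccls (twoV β α φ ψ ch))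
    (fun _ _ _ => cls_node_add _ _ _ _ _ _) (fun _ _ _ => cls_node_smul _ _ _ _ _ _)
    -- The upper decoration enters through grafting at the input `0`, where linearity on classes is
    -- available.
    (fun φ ψ ψ' => by
      let T : Tree (infGen k) L := .node _ b ψ fun x => ch (α x)
      rw [twoV, twoV, twoV, ccls_node_cons φ _ T, ccls_node_cons φ _ T, ccls_node_cons φ _ T,
        ← map_add]
      exact congrArg _ (cls_node_add _ _ _ _ _ _))
    (fun c φ ψ => by
      let T : Tree (infGen k) L := .node _ b ψ fun x => ch (α x)
      rw [twoV, twoV, ccls_node_cons φ _ T, ccls_node_cons φ _ T, ← map_smul]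
      exact congrArg _ (cls_node_smul _ _ _ _ _ _))

theorem twoV_deg {β : Fin m → Fin n} {α : Fin m' → Fin n} (h : Shuffle β α) {a b : ℤ}
    (φ : (infGen k).X (m + 1) a) (ψ : (infGen k).X m' b) (ch : Fin n → Tree (infGen k) L) :
    (twoV β α φ ψ ch).deg = a + b + ∑ i, (ch i).deg := by
  rw [h.sum_eq, twoV, Tree.deg, Fin.sum_univ_succ]
  simp only [Fin.cons_zero, Fin.cons_succ, Tree.deg]
  ring

/-- Apply the permutation relation at both vertices. The upper vertex stays at the first input of
the lower one, so its degree does not enter the sign. -/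
theorem ccls_twoV_act {β β' : Fin m → Fin n} {α α' : Fin m' → Fin n}
    {σ : Equiv.Perm (Fin n)} {τ : Equiv.Perm (Fin m')} {τ₁ : Equiv.Perm (Fin m)}
    (hτ : ∀ x, σ (α x) = α' (τ x)) (hτ₁ : ∀ y, σ (β y) = β' (τ₁ y)) {a b : ℤ}
    (φ : (infGen k).X (m + 1) a) (ψ : (infGen k).X m' b) (ch : Fin n → Tree (infGen k) L) :
    ccls (twoV β' α' ((infGen k).act _ a (extendPerm τ₁) φ) ((infGen k).act _ b τ ψ) ch)
      = sg k (koszulExp ((fun i => (ch i).deg) ∘ α') τ + koszulExp ((fun i => (ch i).deg) ∘ β') τ₁) •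
        ccls (twoV β α φ ψ (ch ∘ σ)) := by
  let T : Tree (infGen k) L := .node _ b ψ fun x => ch (α x)
  have e : ∀ T : Tree (infGen k) L,
      (Fin.cons T (fun y => ch (β' y)) : Fin (m + 1) → Tree (infGen k) L) ∘ extendPerm τ₁
        = Fin.cons T fun y => (ch ∘ σ) (β y) := fun T => by
    funext i
    cases i using Fin.cases with
    | zero => simp [extendPerm_zero]
    | succ y => simp [extendPerm_succ, hτ₁]
  rw [twoV, ccls, cls_node_perm, e, koszulExp_extendPerm]
  have e2 := ccls_node_cons φ (.node _ b ((infGen k).act _ b τ ψ) fun x => ch (α' x)) T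
    fun y => (ch ∘ σ) (β y)
  have e3 : ccls (.node _ b ((infGen k).act _ b τ ψ) fun x => ch (α' x))
    = sg k (koszulExp ((fun i => (ch i).deg) ∘ α') τ) • ccls (.node _ b ψ fun x => (ch ∘ σ) (α x)) := by
    rw [ccls, cls_node_perm]
    congr 3
    funext x
    simp [hτ]
  rw [e3, map_smul, ← ccls_node_cons φ _ T] at e2
  refine (congrArg _ e2).trans ?_
  rw [smul_smul, ← sg_add, add_comm]
  rfl

end TwoVertices

/-! ### The differential of a root vertex. -/

section RootTerm

variable {k : Type u} [Field k] {L : Type} {m m' n : ℕ}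

/-- The signed two-vertex trees in the differential of a vertex. -/
def rootPhi (β : Fin m → Fin n) (α : Fin m' → Fin n) (ch : Fin n → Tree (infGen k) L) (a b : ℤ) :
    (infGen k).X (m + 1) a →ₗ[k] (infGen k).X m' b →ₗ[k] CSpace k L :=
  sg k (shuffleExp (fun _ => 1) β α + m' * (a + 1) + shuffleExp (fun i => (ch i).deg) β α) •
    twoVLin β α ch a b

theorem rootPhi_apply (β : Fin m → Fin n) (α : Fin m' → Fin n) (ch : Fin n → Tree (infGen k) L)
    {a b : ℤ} (φ : (infGen k).X (m + 1) a) (ψ : (infGen k).X m' b) : rootPhi β α ch a b φ ψ =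
      sg k (shuffleExp (fun _ => 1) β α + m' * (a + 1) + shuffleExp (fun i => (ch i).deg) β α) •
        ccls (twoV β α φ ψ ch) := rfl

/-- The part of the differential of a root vertex that belongs to a subset of its inputs. -/
def rootTerm {d : ℤ} (f : (infGen k).X n d) (β : Fin m → Fin n) (α : Fin m' → Fin n)
    (ch : Fin n → Tree (infGen k) L) : CSpace k L := coSum f β α (rootPhi β α ch)

/-- The span of the classes of trees of a given degree. -/
def degSpan (k : Type u) [Field k] (L : Type) (δ : ℤ) : Submodule k (CSpace k L) :=
  Submodule.span k {x | ∃ T : Tree (infGen k) L, T.deg = δ ∧ x = ccls T}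

theorem list_sum_mem {ι : Type*} {W : Type u} [AddCommGroup W] [Module k W] (S : Submodule k W)
    (Δ : List ι) (g : ι → W) (h : ∀ i ∈ Δ, g i ∈ S) : (Δ.map g).sum ∈ S := by
  induction Δ with
  | nil => exact S.zero_mem
  | cons i Δ ih =>
    rw [List.map_cons, List.sum_cons]
    exact S.add_mem (h i (by simp)) (ih fun j hj => h j (by simp [hj]))

theorem rootTerm_mem {d : ℤ} (f : (infGen k).X n d) {β : Fin m → Fin n} {α : Fin m' → Fin n}
    (h : Shuffle β α) (hm : 1 ≤ m) (hm' : 2 ≤ m') (ch : Fin n → Tree (infGen k) L) :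
    rootTerm f β α ch ∈ degSpan k L (d + ∑ i, (ch i).deg + 1) := by
  obtain ⟨Δ, h1, h2⟩ := exists_isCoc h hm hm' f
  rw [rootTerm, ← coSum_eq hm hm' h1]
  refine list_sum_mem _ _ _ fun s hs => ?_
  rw [rootPhi_apply]
  refine Submodule.smul_mem _ _ (Submodule.subset_span ⟨_, ?_, rfl⟩)
  rw [twoV_deg h, h2 s hs]
  ring

theorem list_smul_sum {ι : Type*} {W : Type u} [AddCommGroup W] [Module k W] (c : k)
    (Δ : List ι) (g : ι → W) : c • (Δ.map g).sum = (Δ.map fun i => c • g i).sum := by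
  induction Δ with
  | nil => simp
  | cons i Δ ih => simp only [List.map_cons, List.sum_cons, smul_add, ih]

theorem rootPhi_actTens {β β' : Fin m → Fin n} {α α' : Fin m' → Fin n}
    {σ : Equiv.Perm (Fin n)} {τ : Equiv.Perm (Fin m')} {τ₁ : Equiv.Perm (Fin m)}
    (hτ : ∀ x, σ (α x) = α' (τ x)) (hτ₁ : ∀ y, σ (β y) = β' (τ₁ y)) (r : k)
    (ch : Fin n → Tree (infGen k) L)
    (s : Σ a : ℤ, Σ b : ℤ, (infGen k).X (m + 1) a × (infGen k).X m' b) :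
    rootPhi β' α' ch _ _ (actTens r τ₁ τ s).2.2.1 (actTens r τ₁ τ s).2.2.2 =
      r • sg k (shuffleExp (fun _ => 1) β' α' + m' * (s.1 + 1)
        + shuffleExp (fun i => (ch i).deg) β' α'
        + (koszulExp ((fun i => (ch i).deg) ∘ α') τ + koszulExp ((fun i => (ch i).deg) ∘ β') τ₁)) •
        ccls (twoV β α s.2.2.1 s.2.2.2 (ch ∘ σ)) := by
  have h1 := congrArg (fun F => F ((infGen k).act m' s.2.1 τ s.2.2.2))
    (map_smul (rootPhi β' α' ch s.1 s.2.1) r ((infGen k).act (m + 1) s.1 (extendPerm τ₁) s.2.2.1))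
  refine Eq.trans h1 ?_
  refine congrArg (fun x : CSpace k L => r • x) ?_
  refine (rootPhi_apply β' α' ch _ _).trans ?_
  rw [ccls_twoV_act hτ hτ₁, smul_smul, ← sg_add]

/-- `koszulExp_shuffle` is used twice: with degrees one it compares the sign characters, with the
degrees of the subtrees the Koszul signs. -/
theorem rootTerm_act {d : ℤ} (f : (infGen k).X n d) {β β' : Fin m → Fin n} {α α' : Fin m' → Fin n}
    (h : Shuffle β α) (hβ : StrictMono β) (hα : StrictMono α) (hβ' : StrictMono β')
    (hα' : StrictMono α') (hm : 1 ≤ m) (hm' : 2 ≤ m')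
    {σ : Equiv.Perm (Fin n)} {τ : Equiv.Perm (Fin m')} {τ₁ : Equiv.Perm (Fin m)}
    (hτ : ∀ x, σ (α x) = α' (τ x)) (hτ₁ : ∀ y, σ (β y) = β' (τ₁ y))
    (ch : Fin n → Tree (infGen k) L) :
    rootTerm ((infGen k).act n d σ f) β' α' ch
      = sg k (koszulExp (fun i => (ch i).deg) σ) • rootTerm f β α (ch ∘ σ) := by
  obtain ⟨Δ, h1, -⟩ := exists_isCoc h hm hm' f
  rw [rootTerm, rootTerm, ← coSum_eq hm hm' h1, ← coSum_eq hm hm' (h1.act hτ hτ₁), List.map_map,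
    list_smul_sum]
  congr 2
  funext s
  rw [Function.comp_apply, rootPhi_actTens hτ hτ₁, rootPhi_apply, smul_smul,
    smul_smul, sgnk, sgnk, sgnk, sign_eq_sg, sign_eq_sg, sign_eq_sg]
  simp only [← sg_add]
  refine congrArg (fun z : k => z • ccls (twoV β α s.2.2.1 s.2.2.2 (ch ∘ σ))) (sg_congr k ?_)
  have k1 := koszulExp_shuffle (fun _ => 1) σ h hβ hα hβ' hα' τ τ₁ hτ hτ₁
  have k2 := koszulExp_shuffle (fun i => (ch i).deg) σ h hβ hα hβ' hα' τ τ₁ hτ hτ₁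
  obtain ⟨x1, k1⟩ := k1
  obtain ⟨x2, k2⟩ := k2
  simp only [Function.comp_def] at k1 k2 ⊢
  refine ⟨x1 - x2 + koszulExp (fun _ => 1) τ + koszulExp (fun _ => 1) τ₁
    + shuffleExp (fun _ => 1) β' α' - shuffleExp (fun _ => 1) β α
    , ?_⟩
  linarith

/-- The differential of the root vertex of a tree. -/
def root {d : ℤ} (f : (infGen k).X n d) (ch : Fin n → Tree (infGen k) L) : CSpace k L :=
  ∑ A : Finset (Fin n) with 2 ≤ #A ∧ #A < n,
    rootTerm f (Aᶜ.orderEmbOfFin rfl) (A.orderEmbOfFin rfl) ch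

theorem one_le_card_compl {A : Finset (Fin n)} (h : #A < n) : 1 ≤ #Aᶜ := by
  rw [card_compl, Fintype.card_fin]; omega

theorem root_mem {d : ℤ} (f : (infGen k).X n d) (ch : Fin n → Tree (infGen k) L) :
    root f ch ∈ degSpan k L (d + ∑ i, (ch i).deg + 1) := by
  refine Submodule.sum_mem _ fun A hA => ?_
  simp only [mem_filter, mem_univ, true_and] at hA
  exact rootTerm_mem f (shuffle_orderEmb rfl rfl) (one_le_card_compl hA.2) hA.1 ch

theorem root_add {d : ℤ} (f f' : (infGen k).X n d) (ch : Fin n → Tree (infGen k) L) :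
    root (f + f') ch = root f ch + root f' ch := by
  simp only [root, rootTerm]
  rw [← sum_add_distrib]
  exact sum_congr rfl fun A _ => coSum_add _ _ _ _ _

theorem root_smul {d : ℤ} (r : k) (f : (infGen k).X n d) (ch : Fin n → Tree (infGen k) L) :
    root (r • f) ch = r • root f ch := by
  simp only [root, rootTerm]
  rw [smul_sum]
  exact sum_congr rfl fun A _ => coSum_smul _ _ _ _ _

/-- Needed because a set and its image under a permutation have provably, but not definitionally,
equal cardinalities. -/
theorem rootTerm_card {d : ℤ} (f : (infGen k).X n d) (A : Finset (Fin n)) (h : #Aᶜ = m)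
    (h' : #A = m') (ch : Fin n → Tree (infGen k) L) :
    rootTerm f (Aᶜ.orderEmbOfFin rfl) (A.orderEmbOfFin rfl) ch
      = rootTerm f (Aᶜ.orderEmbOfFin h) (A.orderEmbOfFin h') ch := by
  subst h h'
  rfl

/-- The permutation carries the summand of `A` to that of its image. -/
theorem root_act {d : ℤ} (f : (infGen k).X n d) (σ : Equiv.Perm (Fin n))
    (ch : Fin n → Tree (infGen k) L) : root ((infGen k).act n d σ f) ch
      = sg k (koszulExp (fun i => (ch i).deg) σ) • root f (ch ∘ σ) := by
  rw [root, root, smul_sum]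
  symm
  refine sum_equiv σ.finsetCongr (fun A => by simp) fun A hA => ?_
  simp only [mem_filter, mem_univ, true_and] at hA
  rw [Equiv.finsetCongr_apply]
  have h1 : #(A.map σ.toEmbedding) = #A := card_map _
  have h2 : #(A.map σ.toEmbedding)ᶜ = #Aᶜ := by rw [card_compl, card_compl, h1]
  have hmem : ∀ (B C : Finset (Fin n)) {r : ℕ} (h : #C = r) (l : Fin n), l ∈ C →
      ∃ x', l = C.orderEmbOfFin h x' := by
    intro B C r h l hl
    have : l ∈ Set.range (C.orderEmbOfFin h) := by rw [range_orderEmbOfFin]; exact hl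
    obtain ⟨x, hx⟩ := this
    exact ⟨x, hx.symm⟩
  obtain ⟨τ, hτ⟩ := exists_perm_comp (α := A.orderEmbOfFin rfl)
    (α' := (A.map σ.toEmbedding).orderEmbOfFin h1) σ (A.orderEmbOfFin rfl).injective fun x =>
      hmem A _ h1 _ (mem_map_of_mem _ (A.orderEmbOfFin_mem rfl x))
  obtain ⟨τ₁, hτ₁⟩ := exists_perm_comp (α := Aᶜ.orderEmbOfFin rfl)
    (α' := (A.map σ.toEmbedding)ᶜ.orderEmbOfFin h2) σ (Aᶜ.orderEmbOfFin rfl).injective fun x =>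
      hmem A _ h2 _ (by
        have := Aᶜ.orderEmbOfFin_mem rfl x
        rw [mem_compl] at this ⊢
        intro h
        obtain ⟨y, hy, hxy⟩ := mem_map.1 h
        exact this (σ.injective hxy ▸ hy))
  rw [rootTerm_card _ (A.map σ.toEmbedding) h2 h1]
  exact (rootTerm_act f (shuffle_orderEmb rfl rfl) (Aᶜ.orderEmbOfFin rfl).strictMono
    (A.orderEmbOfFin rfl).strictMono (OrderEmbedding.strictMono _) (OrderEmbedding.strictMono _)
    (one_le_card_compl hA.2) hA.1 hτ hτ₁ ch).symm

end RootTerm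

/-! ### The differential of a tree and its Koszul signs. -/

section TreeDifferential

variable {k : Type u} [Field k] {L : Type} {n : ℕ}

/-- Total degree of the trees before the `i`-th one. -/
def degBefore (ch : Fin n → Tree (infGen k) L) (i : Fin n) : ℤ :=
  ∑ j : Fin n, if j < i then (ch j).deg else 0

/-- The differential of a tree. -/
def dTree : Tree (infGen k) L → CSpace k L
  | .leaf _ => 0
  | .node n d f ch => root f ch
      + ∑ i : Fin n, sg k (d + degBefore ch i) • graftAt ∅ n d f ch i (dTree (ch i))

theorem dTree_node {d : ℤ} (f : (infGen k).X n d) (ch : Fin n → Tree (infGen k) L) :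
    dTree (.node n d f ch) = root f ch
      + ∑ i : Fin n, sg k (d + degBefore ch i) • graftAt ∅ n d f ch i (dTree (ch i)) := rfl

theorem deg_update (ch : Fin n → Tree (infGen k) L) (i : Fin n) (T : Tree (infGen k) L) :
    ∑ j, (Function.update ch i T j).deg = ∑ j, (ch j).deg - (ch i).deg + T.deg := by
  rw [← add_sum_erase _ _ (mem_univ i), ← add_sum_erase _ (fun j => (ch j).deg) (mem_univ i),
    Function.update_self, sum_congr rfl (g := fun j => (ch j).deg)]
  · ring
  · intro j hj
    rw [Function.update_of_ne (ne_of_mem_erase hj)]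

theorem graftAt_mem {d : ℤ} (f : (infGen k).X n d) (ch : Fin n → Tree (infGen k) L) (i : Fin n)
    {δ : ℤ} {y : CSpace k L} (hy : y ∈ degSpan k L δ) :
    graftAt ∅ n d f ch i y ∈ degSpan k L (d + (∑ j, (ch j).deg - (ch i).deg + δ)) := by
  have : degSpan k L δ ≤ (degSpan k L (d + (∑ j, (ch j).deg - (ch i).deg + δ))).comap
      (graftAt ∅ n d f ch i) := by
    refine Submodule.span_le.2 ?_
    rintro _ ⟨T, hT, rfl⟩
    rw [SetLike.mem_coe, Submodule.mem_comap, graftAt_cls]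
    refine Submodule.subset_span ⟨_, ?_, rfl⟩
    rw [Tree.deg, deg_update, hT]
  exact this hy

theorem dTree_mem (T : Tree (infGen k) L) : dTree T ∈ degSpan k L (T.deg + 1) := by
  induction T with
  | leaf l => exact Submodule.zero_mem _
  | node n d f ch ih =>
    rw [dTree_node, Tree.deg]
    refine Submodule.add_mem _ (root_mem f ch) (Submodule.sum_mem _ fun i _ =>
      Submodule.smul_mem _ _ ?_)
    have := graftAt_mem f ch i (ih i)
    rwa [show d + (∑ j, (ch j).deg - (ch i).deg + ((ch i).deg + 1)) = d + ∑ j, (ch j).deg + 1 by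
      ring] at this

/-- An odd operator can act on a factor before or after the reordering. A factor `j` contributes to
the discrepancy only through its order relative to `i`, and each contribution is even. -/
theorem koszulExp_update (d : Fin n → ℤ) (σ : Equiv.Perm (Fin n)) (i : Fin n) :
    Even ((∑ j, if j < σ i then d j else 0) + koszulExp (Function.update d (σ i) (d (σ i) + 1)) σ
      - (koszulExp d σ + ∑ j, if j < i then d (σ j) else 0)) := by
  have e1 : koszulExp (Function.update d (σ i) (d (σ i) + 1)) σ = koszulExp d σ
      + (∑ j, (if j < i ∧ σ i < σ j then d (σ j) else 0)
        + ∑ j, if i < j ∧ σ j < σ i then d (σ j) else 0) := by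
    have h1 : ∀ a b, (if a < b ∧ σ b < σ a then Function.update d (σ i) (d (σ i) + 1) (σ a) *
          Function.update d (σ i) (d (σ i) + 1) (σ b) else 0)
        = (if a < b ∧ σ b < σ a then d (σ a) * d (σ b) else 0)
          + ((if b = i then (if a < b ∧ σ b < σ a then d (σ a) else 0) else 0)
          + (if a = i then (if a < b ∧ σ b < σ a then d (σ b) else 0) else 0)) := by
      intro a b
      by_cases hab : a < b ∧ σ b < σ a
      · simp only [hab, if_true, and_self]
        by_cases ha : a = i
        · have hb : b ≠ i := fun h => (ha ▸ h ▸ hab.1.ne) rfl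
          have hb' : σ b ≠ σ i := fun h => hb (σ.injective h)
          subst ha
          simp [hb, hb']
          ring
        · have ha' : σ a ≠ σ i := fun h => ha (σ.injective h)
          by_cases hb : b = i
          · subst hb
            simp [ha, ha']
            ring
          · have hb' : σ b ≠ σ i := fun h => hb (σ.injective h)
            simp [ha, hb, ha', hb']
      · simp [hab]
    simp only [koszulExp, h1, sum_add_distrib]
    congr 1
    congr 1
    · exact sum_congr rfl fun a _ => by simp
    · rw [sum_comm]
      exact sum_congr rfl fun a _ => by simp
  have e2 : (∑ j, if j < σ i then d j else 0) = ∑ j, if σ j < σ i then d (σ j) else 0 :=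
    (Equiv.sum_comp σ fun j => if j < σ i then d j else 0).symm
  rw [e1, e2, show ∀ a b c e f : ℤ, a + (b + (c + e)) - (b + f) = a + c + e - f by intros; ring,
    ← sum_add_distrib, ← sum_add_distrib, ← sum_sub_distrib]
  refine Finset.even_sum _ fun j _ => ?_
  rcases lt_trichotomy j i with h | rfl | h
  · have hne : σ j ≠ σ i := fun h' => h.ne (σ.injective h')
    rcases lt_or_gt_of_ne hne with h' | h' <;> simp [h, h', h.not_gt, h'.not_gt]
  · simp
  · have hne : σ j ≠ σ i := fun h' => h.ne' (σ.injective h')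
    rcases lt_or_gt_of_ne hne with h' | h' <;> simp [h, h', h.not_gt, h'.not_gt]

/-- The element inserted must be homogeneous of degree one more than the subtree it replaces, as the
differential of that subtree is; then `koszulExp_update` compares the signs. -/
theorem graftAt_act {d : ℤ} (f : (infGen k).X n d) (σ : Equiv.Perm (Fin n))
    (ch : Fin n → Tree (infGen k) L) (i : Fin n) {y : CSpace k L}
    (hy : y ∈ degSpan k L ((ch (σ i)).deg + 1)) :
    sg k (d + degBefore ch (σ i)) • graftAt ∅ n d ((infGen k).act n d σ f) ch (σ i) y
      = sg k (koszulExp (fun i => (ch i).deg) σ) •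
        sg k (d + degBefore (ch ∘ σ) i) • graftAt ∅ n d f (ch ∘ σ) i y := by
  have key : degSpan k L ((ch (σ i)).deg + 1) ≤ LinearMap.eqLocus
      (sg k (d + degBefore ch (σ i)) • graftAt ∅ n d ((infGen k).act n d σ f) ch (σ i))
      (sg k (koszulExp (fun i => (ch i).deg) σ) •
        sg k (d + degBefore (ch ∘ σ) i) • graftAt ∅ n d f (ch ∘ σ) i) := by
    refine Submodule.span_le.2 ?_
    rintro _ ⟨T, hT, rfl⟩
    change sg k _ • graftAt ∅ n d _ ch (σ i) (cls ∅ T)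
      = sg k _ • sg k _ • graftAt ∅ n d f (ch ∘ σ) i (cls ∅ T)
    rw [graftAt_cls, graftAt_cls, cls_node_perm, smul_smul, smul_smul, ← sg_add, ← sg_add]
    have e1 : Function.update ch (σ i) T ∘ σ = Function.update (ch ∘ σ) i T := by
      funext j
      by_cases hj : j = i
      · subst hj; simp
      · have : σ j ≠ σ i := fun h => hj (σ.injective h)
        simp [hj, this]
    have e2 : (fun j => (Function.update ch (σ i) T j).deg)
        = Function.update (fun j => (ch j).deg) (σ i) ((ch (σ i)).deg + 1) := by
      funext j
      by_cases hj : j = σ i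
      · subst hj; simp [hT]
      · simp [hj]
    rw [e1, e2]
    refine congrArg (fun z : k => z • ccls (.node n d f (Function.update (ch ∘ σ) i T)))
      (sg_congr k ?_)
    obtain ⟨x, hx⟩ := koszulExp_update (fun j => (ch j).deg) σ i
    refine ⟨x, ?_⟩
    simp only [degBefore, Function.comp]
    linarith
  exact key hy

end TreeDifferential

/-! ### The differential on classes of trees. -/

section Descent

variable {k : Type u} [Field k] {L : Type} {n : ℕ}

/-- The differential on formal linear combinations of trees. -/
def dFree (k : Type u) [Field k] (L : Type) : (Tree (infGen k) L →₀ k) →ₗ[k] CSpace k L :=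
  Finsupp.linearCombination k dTree

theorem dFree_single (T : Tree (infGen k) L) (r : k) :
    dFree k L (Finsupp.single T r) = r • dTree T := Finsupp.linearCombination_single _ _ _

theorem graftAt_add {d : ℤ} (f f' : (infGen k).X n d) (ch : Fin n → Tree (infGen k) L) (i : Fin n) :
    graftAt ∅ n d (f + f') ch i = graftAt ∅ n d f ch i + graftAt ∅ n d f' ch i :=
  OpSpace.ext_cls fun T => by
    rw [LinearMap.add_apply, graftAt_cls, graftAt_cls, graftAt_cls, cls_node_add]

theorem graftAt_smul {d : ℤ} (r : k) (f : (infGen k).X n d) (ch : Fin n → Tree (infGen k) L)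
    (i : Fin n) : graftAt ∅ n d (r • f) ch i = r • graftAt ∅ n d f ch i :=
  OpSpace.ext_cls fun T => by
    rw [LinearMap.smul_apply, graftAt_cls, graftAt_cls, cls_node_smul]

/-- A map on trees of a given degree is induced by a linear map of their classes. -/
def IsLinearOn (δ : ℤ) (F : Tree (infGen k) L → CSpace k L) : Prop :=
  ∃ G : CSpace k L →ₗ[k] CSpace k L, ∀ T : Tree (infGen k) L, T.deg = δ → F T = G (ccls T)

theorem IsLinearOn.sum {δ : ℤ} {ι : Type*} (s : Finset ι) {F : ι → Tree (infGen k) L → CSpace k L}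
    (h : ∀ i ∈ s, IsLinearOn δ (F i)) : IsLinearOn δ fun T => ∑ i ∈ s, F i T := by
  classical
  induction s using Finset.induction_on with
  | empty => exact ⟨0, fun T _ => by simp⟩
  | insert i s hi ih =>
    obtain ⟨G, hG⟩ := h i (by simp)
    obtain ⟨G', hG'⟩ := ih fun j hj => h j (by simp [hj])
    refine ⟨G + G', fun T hT => ?_⟩
    beta_reduce at hG' ⊢
    rw [sum_insert hi, hG T hT, hG' T hT]
    rfl

theorem IsLinearOn.smul {δ : ℤ} (c : k) {F : Tree (infGen k) L → CSpace k L}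
    (h : IsLinearOn δ F) : IsLinearOn δ fun T => c • F T := by
  obtain ⟨G, hG⟩ := h
  exact ⟨c • G, fun T hT => by beta_reduce; rw [hG T hT]; rfl⟩

/-- The varying subtree hangs on the lower vertex or on the upper one; the map is one grafting or a
composite of two. -/
theorem isLinearOn_twoV {δ : ℤ} {m m' : ℕ} {β : Fin m → Fin n} {α : Fin m' → Fin n}
    (h : Shuffle β α) {a b : ℤ} (φ : (infGen k).X (m + 1) a)
    (ψ : (infGen k).X m' b) (ch : Fin n → Tree (infGen k) L) (i : Fin n) :
    IsLinearOn δ fun T => ccls (twoV β α φ ψ (Function.update ch i T)) := by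
  rcases h.cover i with ⟨y, rfl⟩ | ⟨x, rfl⟩
  · refine ⟨graftAt ∅ (m + 1) a φ (Fin.cons (.node _ b ψ fun x => ch (α x)) fun y => ch (β y))
      y.succ, fun T _ => ?_⟩
    beta_reduce
    rw [graftAt_cls, twoV]
    congr 2
    funext j
    cases j using Fin.cases with
    | zero =>
      rw [Function.update_of_ne (Fin.succ_ne_zero y).symm]
      simp only [Fin.cons_zero]
      congr 1
      funext x
      rw [Function.update_of_ne (h.disjoint y x).symm]
    | succ j =>
      by_cases hj : j = y
      · subst hj; simp
      · have h1 : β j ≠ β y := fun h' => hj (h.left h')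
        have h2 : j.succ ≠ y.succ := fun h' => hj (Fin.succ_injective _ h')
        simp [h1, h2]
  · let T₀ : Tree (infGen k) L := .node _ b ψ fun x => ch (α x)
    refine ⟨graftAt ∅ (m + 1) a φ (Fin.cons T₀ fun y => ch (β y)) 0 ∘ₗ
      graftAt ∅ m' b ψ (fun x => ch (α x)) x, fun T _ => ?_⟩
    beta_reduce
    rw [LinearMap.comp_apply, graftAt_cls, graftAt_cls, Fin.update_cons_zero, twoV]
    congr 3
    · congr 1
      funext x'
      by_cases hx : x' = x
      · subst hx; simp
      · have h1 : α x' ≠ α x := fun h' => hx (h.right h')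
        simp [hx, h1]
    · funext y
      rw [Function.update_of_ne (h.disjoint y x)]

/-- `coSum` involves no choice depending on the subtrees, and the signs depend on the varying
subtree only through its degree `δ`. -/
theorem isLinearOn_root {d δ : ℤ} (f : (infGen k).X n d) (ch : Fin n → Tree (infGen k) L)
    (i : Fin n) : IsLinearOn δ fun T => root f (Function.update ch i T) := by
  simp only [root, rootTerm, coSum]
  refine IsLinearOn.sum _ fun A _ => IsLinearOn.sum _ fun I _ => IsLinearOn.sum _ fun I' _ =>
    IsLinearOn.smul _ ?_
  obtain ⟨G, hG⟩ := isLinearOn_twoV (δ := δ) (shuffle_orderEmb (A := A) rfl rfl) (setForm k I)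
    (setForm k I') ch i
  refine ⟨sg k (shuffleExp (fun _ => 1) (Aᶜ.orderEmbOfFin rfl) (A.orderEmbOfFin rfl)
    + #A * (setDeg _ I + 1) + shuffleExp (fun j => Function.update (fun j => (ch j).deg) i δ j)
      (Aᶜ.orderEmbOfFin rfl) (A.orderEmbOfFin rfl)) • G, fun T hT => ?_⟩
  beta_reduce at hG ⊢
  rw [rootPhi_apply, LinearMap.smul_apply, ← hG T hT]
  have e : (fun j => (Function.update ch i T j).deg)
      = fun j => Function.update (fun j => (ch j).deg) i δ j := by
    funext j
    by_cases hj : j = i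
    · subst hj; simp [hT]
    · simp [hj]
  rw [e]

/-- Graftings at two different inputs commute. -/
theorem isLinearOn_graftAt {d δ : ℤ} (f : (infGen k).X n d) (ch : Fin n → Tree (infGen k) L)
    {i j : Fin n} (hij : j ≠ i) (y : CSpace k L) :
    IsLinearOn δ fun T => graftAt ∅ n d f (Function.update ch i T) j y := by
  obtain ⟨x, rfl⟩ := Submodule.Quotient.mk_surjective _ y
  induction x using Finsupp.induction_linear with
  | zero => exact ⟨0, fun T _ => by simp⟩
  | add x x' h h' =>
    obtain ⟨G, hG⟩ := h
    obtain ⟨G', hG'⟩ := h'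
    refine ⟨G + G', fun T hT => ?_⟩
    beta_reduce at hG hG' ⊢
    rw [LinearMap.add_apply, ← hG T hT, ← hG' T hT, Submodule.Quotient.mk_add, map_add]
  | single S r =>
    refine ⟨r • graftAt ∅ n d f (Function.update ch j S) i, fun T _ => ?_⟩
    beta_reduce
    rw [mk_single, map_smul, LinearMap.smul_apply, graftAt_cls, graftAt_cls,
      Function.update_comm hij]

/-- Makes all signs constant along a relation that is grafted above a vertex. -/
theorem OpRel.homogeneous {x : Tree (infGen k) L →₀ k} (hx : OpRel (∅ : Set _) x) :
    ∃ δ, ∀ T ∈ x.support, T.deg = δ := by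
  classical
  have hs : ∀ (δ : ℤ) (T : Tree (infGen k) L) (r : k), T.deg = δ →
      ∀ T' ∈ (Finsupp.single T r).support, T'.deg = δ := by
    intro δ T r h T' hT'
    rw [Finset.mem_singleton.1 (Finsupp.support_single_subset hT'), h]
  have hsub : ∀ (δ : ℤ) (x y : Tree (infGen k) L →₀ k), (∀ T ∈ x.support, T.deg = δ) →
      (∀ T ∈ y.support, T.deg = δ) → ∀ T ∈ (x - y).support, T.deg = δ := by
    intro δ x y h h' T hT
    rcases mem_union.1 (Finsupp.support_sub hT) with hT | hT
    · exact h T hT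
    · exact h' T hT
  induction hx with
  | rel x hx => exact absurd hx (Set.notMem_empty x)
  | add n d e e' ch =>
    exact ⟨d + ∑ i, (ch i).deg, hsub _ _ _ (hsub _ _ _ (hs _ _ _ rfl) (hs _ _ _ rfl))
      (hs _ _ _ rfl)⟩
  | smul n d a e ch => exact ⟨d + ∑ i, (ch i).deg, hsub _ _ _ (hs _ _ _ rfl) (hs _ _ _ rfl)⟩
  | perm n d σ e ch =>
    refine ⟨d + ∑ i, (ch i).deg, hsub _ _ _ (hs _ _ _ rfl) (hs _ _ _ ?_)⟩
    rw [Tree.deg, ← Equiv.sum_comp σ fun i => (ch i).deg]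
    rfl
  | graft n d e ch i x hx ih =>
    obtain ⟨δ, h⟩ := ih
    refine ⟨d + (∑ j, (ch j).deg - (ch i).deg + δ), fun T hT => ?_⟩
    obtain ⟨T', hT', rfl⟩ := mem_image.1 (Finsupp.mapDomain_support hT)
    rw [Tree.deg, deg_update, h T' hT']

/-- Well-definedness of the differential. For a grafted relation, the part of the differential
outside the grafted subtree is linear in its class and vanishes there; the part inside vanishes by
induction. -/
theorem dFree_eq_zero {x : Tree (infGen k) L →₀ k} (hx : OpRel (∅ : Set _) x) :
    dFree k L x = 0 := by
  induction hx with
  | rel x hx => exact absurd hx (Set.notMem_empty x)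
  | add n d e e' ch =>
    rw [map_sub, map_sub, dFree_single, dFree_single, dFree_single, one_smul, one_smul, one_smul,
      dTree_node, dTree_node, dTree_node, root_add]
    have h : ∀ i, graftAt ∅ n d (e + e') ch i = graftAt ∅ n d e ch i + graftAt ∅ n d e' ch i :=
      graftAt_add e e' ch
    rw [sum_congr rfl fun i _ => by rw [h i, LinearMap.add_apply, smul_add], sum_add_distrib]
    abel
  | smul n d a e ch =>
    rw [map_sub, dFree_single, dFree_single, one_smul, dTree_node, dTree_node, root_smul, smul_add,
      smul_sum]
    have h : ∀ i, graftAt ∅ n d (a • e) ch i = a • graftAt ∅ n d e ch i := graftAt_smul a e ch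
    rw [sum_congr rfl fun i _ => by rw [h i, LinearMap.smul_apply, smul_comm], sub_self]
  | perm n d σ e ch =>
    rw [map_sub, dFree_single, dFree_single, one_smul, dTree_node, dTree_node, root_act, smul_add,
      smul_sum, ← Equiv.sum_comp σ, sub_eq_zero]
    congr 1
    exact sum_congr rfl fun i _ => graftAt_act e σ ch i (dTree_mem _)
  | graft n d e ch i x hx ih =>
    obtain ⟨δ, hδ⟩ := hx.homogeneous
    have hF : IsLinearOn δ fun T => root e (Function.update ch i T)
        + ∑ j ∈ univ.erase i, sg k (d + degBefore (Function.update ch i T) j) •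
            graftAt ∅ n d e (Function.update ch i T) j (dTree (ch j)) := by
      obtain ⟨G, hG⟩ := isLinearOn_root (δ := δ) e ch i
      have h2 : IsLinearOn δ fun T => ∑ j ∈ univ.erase i,
          sg k (d + degBefore (Function.update ch i T) j) •
            graftAt ∅ n d e (Function.update ch i T) j (dTree (ch j)) := by
        refine IsLinearOn.sum _ fun j hj => ?_
        obtain ⟨G, hG⟩ := isLinearOn_graftAt (δ := δ) e ch (ne_of_mem_erase hj) (dTree (ch j))
        refine ⟨sg k (d + ∑ l, if l < j then Function.update (fun l => (ch l).deg) i δ l else 0) • G,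
          fun T hT => ?_⟩
        beta_reduce at hG ⊢
        rw [LinearMap.smul_apply, ← hG T hT, degBefore]
        congr 4
        funext l
        by_cases hl : l = i
        · subst hl; simp [hT]
        · simp [hl]
      obtain ⟨G', hG'⟩ := h2
      exact ⟨G + G', fun T hT => by
        beta_reduce at hG hG' ⊢
        rw [LinearMap.add_apply, ← hG T hT, ← hG' T hT]⟩
    obtain ⟨G, hG⟩ := hF
    let c : k := sg k (d + degBefore ch i)
    -- `G` collects the root vertex and the siblings, the second summand is the differential inside
    -- the grafted subtree; its sign is the same for all `T`.
    have hT : ∀ T : Tree (infGen k) L, T.deg = δ →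
        dTree (.node n d e (Function.update ch i T))
          = (G ∘ₗ Submodule.mkQ _ + c • (graftAt ∅ n d e ch i ∘ₗ dFree k L))
            (Finsupp.single T 1) := by
      intro T hT
      rw [LinearMap.add_apply, LinearMap.smul_apply, LinearMap.comp_apply, LinearMap.comp_apply,
        dFree_single, one_smul]
      have h1 : (Submodule.mkQ _ (Finsupp.single T 1) : CSpace k L) = ccls T := rfl
      beta_reduce at hG
      rw [h1, ← hG T hT, dTree_node, ← add_sum_erase _ _ (mem_univ i), Function.update_self]
      have h2 : degBefore (Function.update ch i T) i = degBefore ch i := by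
        refine sum_congr rfl fun j _ => ?_
        split_ifs with hj
        · rw [Function.update_of_ne hj.ne]
        · rfl
      have h3 : graftAt ∅ n d e (Function.update ch i T) i = graftAt ∅ n d e ch i :=
        OpSpace.ext_cls fun T => by rw [graftAt_cls, graftAt_cls, Function.update_idem]
      rw [h2, h3, add_assoc]
      congr 1
      rw [add_comm]
      congr 1
      refine sum_congr rfl fun j hj => ?_
      rw [Function.update_of_ne (ne_of_mem_erase hj)]
    have hsum : dFree k L (x.mapDomain fun T => .node n d e (Function.update ch i T))
        = (G ∘ₗ Submodule.mkQ _ + c • (graftAt ∅ n d e ch i ∘ₗ dFree k L)) x := by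
      rw [dFree, Finsupp.linearCombination_mapDomain, Finsupp.linearCombination_apply]
      conv_rhs => rw [← Finsupp.sum_single x]
      rw [Finsupp.sum, Finsupp.sum, map_sum]
      refine sum_congr rfl fun T hTs => ?_
      have h1 : Finsupp.single T (x T) = x T • Finsupp.single T (1 : k) := by simp
      rw [h1, map_smul, Function.comp_apply, hT T (hδ T hTs)]
      rfl
    have h1 : (Submodule.mkQ _ x : CSpace k L) = 0 := mk_eq_zero_of_rel _ hx
    rw [hsum, LinearMap.add_apply, LinearMap.smul_apply, LinearMap.comp_apply, LinearMap.comp_apply,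
      ih, h1, map_zero, map_zero, smul_zero, add_zero]

/-- The cobar differential. -/
def cobarD (k : Type u) [Field k] (L : Type) : CSpace k L →ₗ[k] CSpace k L :=
  Submodule.liftQ _ (dFree k L) (Submodule.span_le.2 fun _ hx => dFree_eq_zero hx)

theorem cobarD_cls (T : Tree (infGen k) L) : cobarD k L (ccls T) = dTree T := by
  have : cobarD k L (ccls T) = dFree k L (Finsupp.single T 1) := rfl
  rw [this, dFree_single, one_smul]

theorem rootTerm_eq {d : ℤ} (f : (infGen k).X n d) (ch : Fin n → Tree (infGen k) L)
    {A : Finset (Fin n)} (hA : 2 ≤ #A) (hA' : #A < n) {Δ : (dualPreLieTwo k).Tensors A}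
    (h : (dualPreLieTwo k).IsCocomposition f A Δ) :
    rootTerm f (Aᶜ.orderEmbOfFin rfl) (A.orderEmbOfFin rfl) ch = (Δ.map fun s =>
      sg k (unshuffleExp (fun _ => 1) A + #A * (s.1 + 1) + unshuffleExp (fun i => (ch i).deg) A) •
        ccls ((dualPreLieTwo k).twoVertex A s.2.2.1 s.2.2.2 ch)).sum := by
  rw [rootTerm, ← coSum_eq (one_le_card_compl hA') hA h, unshuffleExp_eq _ rfl rfl,
    unshuffleExp_eq _ rfl rfl]
  rfl

theorem isCobarDifferential_cobarD : (dualPreLieTwo k).IsCobarDifferential (cobarD k L) where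
  leaf l := cobarD_cls _
  node n d f ch := by
    have hex : ∀ A : Finset (Fin n), ∃ Δ : (dualPreLieTwo k).Tensors A, 2 ≤ #A → #A < n →
        (dualPreLieTwo k).IsCocomposition f A Δ := fun A => by
      by_cases h : 2 ≤ #A ∧ #A < n
      · obtain ⟨Δ, hΔ, -⟩ := exists_isCoc (shuffle_orderEmb (A := A) rfl rfl)
          (one_le_card_compl h.2) h.1 f
        exact ⟨Δ, fun _ _ => hΔ⟩
      -- A default for sets outside the range of the sum.
      · exact ⟨[], fun h1 h2 => absurd ⟨h1, h2⟩ h⟩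
    choose Δ hΔ using hex
    refine ⟨Δ, hΔ, ?_⟩
    rw [show cobarD k L (cls _ (.node n d f ch)) = _ from cobarD_cls _, dTree_node, root]
    congr 1
    · refine sum_congr rfl fun A hA => ?_
      simp only [mem_filter, mem_univ, true_and] at hA
      exact rootTerm_eq f ch hA.1 hA.2 (hΔ A hA.1 hA.2)
    · exact sum_congr rfl fun i _ => by
        rw [show cobarD k L (cls _ (ch i)) = _ from cobarD_cls _]
        rfl

end Descent

/-! ### Counting inversions of concatenated lists. -/

section Inversions

variable {k : Type u} [Field k] {m m' n : ℕ}

theorem inversions_ofFn (f : Fin m → Fin n) : (inversions (List.ofFn f) : ℤ)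
    = ∑ i, ∑ j, if i < j ∧ f j < f i then 1 else 0 := by
  induction m with
  | zero => simp [inversions]
  | succ m ih =>
    have hc : ∀ {m : ℕ} (g : Fin m → Fin n) (a : Fin n),
        ((List.ofFn g).countP (fun b => decide (b < a)) : ℤ) = ∑ j, if g j < a then 1 else 0 := by
      intro m g a
      induction m with
      | zero => simp
      | succ m ih =>
        rw [List.ofFn_succ, List.countP_cons, Fin.sum_univ_succ, Nat.cast_add, ih]
        simp [add_comm]
    rw [List.ofFn_succ, inversions_cons, Nat.cast_add, ih, hc]
    simp only [Fin.sum_univ_succ, Fin.succ_lt_succ_iff, Fin.succ_pos, Fin.not_lt_zero,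
      true_and, false_and, if_false, zero_add]

theorem sgnk_eq_inversions (σ : Equiv.Perm (Fin n)) :
    sgnk k σ = sg k (inversions ((List.finRange n).map σ)) := by
  rw [sgnk, sign_eq_sg, ← List.ofFn_eq_map, inversions_ofFn]
  simp [koszulExp]

/-- Number of inversions between two sets. -/
def cross (S T : Finset (Fin n)) : ℤ := ∑ i ∈ S, ∑ j ∈ T, if j < i then 1 else 0

theorem inversions_append_sort (l : List (Fin n)) (hl : l.Nodup) (T : Finset (Fin n)) :
    (inversions (l ++ T.sort (· ≤ ·)) : ℤ) = inversions l + cross l.toFinset T := by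
  induction l with
  | nil => simp [inversions_sort, inversions, cross]
  | cons a l ih =>
    rw [List.nodup_cons] at hl
    have hT : ((T.sort (· ≤ ·)).countP (fun b => decide (b < a)) : ℤ)
        = ∑ j ∈ T, if j < a then 1 else 0 := by
      rw [List.countP_eq_length_filter, ← List.toFinset_card_of_nodup
        ((sort_nodup _ _).filter _), card_eq_sum_ones, Nat.cast_sum, sum_ite, sum_const_zero,
        add_zero]
      refine sum_congr ?_ fun _ _ => by simp
      ext b
      simp
    rw [List.cons_append, inversions_cons, inversions_cons, List.countP_append, List.toFinset_cons,
      cross, sum_insert (by simpa using hl.1), ← cross, Nat.cast_add, Nat.cast_add, hT, ih hl.2]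
    push_cast
    ring

theorem inversions_sort_append_sort (S T : Finset (Fin n)) :
    (inversions (S.sort (· ≤ ·) ++ T.sort (· ≤ ·)) : ℤ) = cross S T := by
  rw [inversions_append_sort _ (sort_nodup _ _), inversions_sort, sort_toFinset]
  simp

theorem inversions_sort_three (S T U : Finset (Fin n)) (h : Disjoint S T) :
    (inversions (S.sort (· ≤ ·) ++ T.sort (· ≤ ·) ++ U.sort (· ≤ ·)) : ℤ)
      = cross S T + cross (S ∪ T) U := by
  rw [inversions_append_sort, inversions_sort_append_sort, List.toFinset_append, sort_toFinset,
    sort_toFinset]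
  rw [List.nodup_append']
  refine ⟨sort_nodup _ _, sort_nodup _ _, fun a ha hb => ?_⟩
  rw [mem_sort] at ha hb
  exact disjoint_left.1 h ha hb

theorem cross_union_left {S S' : Finset (Fin n)} (h : Disjoint S S') (T : Finset (Fin n)) :
    cross (S ∪ S') T = cross S T + cross S' T := sum_union h

theorem cross_union_right (S : Finset (Fin n)) {T T' : Finset (Fin n)} (h : Disjoint T T') :
    cross S (T ∪ T') = cross S T + cross S T' := by
  rw [cross, cross, cross, ← sum_add_distrib]
  exact sum_congr rfl fun i _ => sum_union h

theorem cross_eq_zero {S T : Finset (Fin n)} (h : ∀ i ∈ S, ∀ j ∈ T, i < j) : cross S T = 0 :=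
  sum_eq_zero fun i hi => sum_eq_zero fun j hj => if_neg (h i hi j hj).not_gt

theorem cross_eq_mul {S T : Finset (Fin n)} (h : ∀ i ∈ S, ∀ j ∈ T, j < i) :
    cross S T = #S * #T := by
  rw [cross, sum_congr rfl fun i hi => sum_congr rfl fun j hj => if_pos (h i hi j hj)]
  simp

theorem cross_add_cross {S T : Finset (Fin n)} (h : Disjoint S T) :
    cross S T + cross T S = #S * #T := by
  rw [cross, cross, sum_comm (s := T), ← sum_add_distrib]
  rw [sum_congr rfl (g := fun _ => (#T : ℤ))]
  · simp
  · intro i hi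
    rw [← sum_add_distrib, sum_congr rfl (g := fun _ => (1 : ℤ))]
    · simp
    · intro j hj
      rcases lt_or_gt_of_ne (fun e => disjoint_left.1 h hi (e ▸ hj) : i ≠ j) with h' | h' <;>
        simp [h', h'.not_gt]

theorem inversions_map {f : Fin m → Fin n} (hf : StrictMono f) (l : List (Fin m)) :
    inversions (l.map f) = inversions l := by
  induction l with
  | nil => rfl
  | cons a l ih =>
    rw [List.map_cons, inversions_cons, inversions_cons, ih, List.countP_map]
    simp [Function.comp_def, hf.lt_iff_lt]

/-- The entry `0` forms an inversion with each entry before it and with none after it. -/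
theorem inversions_star (l l' : List (Fin m)) :
    inversions (l.map Fin.succ ++ 0 :: l'.map Fin.succ) = l.length + inversions (l ++ l') := by
  induction l with
  | nil =>
    rw [List.map_nil, List.nil_append, inversions_cons, inversions_map (Fin.strictMono_succ),
      List.countP_eq_zero.2]
    · simp
    · simp
  | cons a l ih =>
    rw [List.map_cons, List.cons_append, inversions_cons, ih, List.cons_append, inversions_cons,
      List.countP_append, List.countP_append, List.countP_cons, List.countP_map, List.countP_map]
    simp [Function.comp_def]
    ring

end Inversions

/-! ### Vertices decorated by coefficient forms as corollas. -/

section Corollas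

variable {k : Type u} [Field k] {L : Type} {m m' n : ℕ}

theorem corolla_eq (c : ∀ n p : ℕ, (infGen k).X n (1 - p)) {n p : ℕ}
    (s w : List (Tree (infGen k) L)) (hn : (s ++ w).length = n) (hp : w.length = p) :
    corolla c s w = .node n (1 - p) (c n p) fun i => (s ++ w).get (i.cast hn.symm) := by
  subst hn hp
  rfl

theorem koszulExp_eq_zero {d : Fin n → ℤ} (h : ∀ i j, i ≠ j → d i * d j = 0)
    (σ : Equiv.Perm (Fin n)) : koszulExp d σ = 0 := by
  refine sum_eq_zero fun i _ => sum_eq_zero fun j _ => ?_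
  split_ifs with hij
  · exact h _ _ hij.2.ne'
  · rfl

/-- A vertex decorated by a coefficient form is a corolla. -/
theorem ccls_coefF_node {a : ℤ} {l l₁ l₂ : List (Fin n)} (ha : a = 1 - l₂.length)
    (hl : l.Perm l₁) (hnd : (l₁ ++ l₂).Nodup) (hlen : l₁.length + l₂.length = n)
    (ch : Fin n → Tree (infGen k) L) (hch : ∀ i j, i ≠ j → (ch i).deg * (ch j).deg = 0) :
    ccls (.node n a (coefF k n a l) ch)
      = sg k (inversions l + inversions l₁ + inversions (l₁ ++ l₂) + cornorm n) •
        ccls (corolla (stdCor k) (l₁.map ch) (l₂.map ch)) := by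
  subst ha
  -- The permutation that lists solid before wavy inputs; its sign is counted by the inversions of
  -- `l₁ ++ l₂`.
  obtain ⟨σ, hσ⟩ := exists_perm_map_eq (List.nodup_finRange n) hnd (by
    rw [List.length_finRange, List.length_append, hlen])
  have hσ₁ : (stdList n l₂.length).map σ = l₁ := by
    rw [stdList, List.map_take, hσ, show n - l₂.length = l₁.length by omega, List.take_left]
  have e1 : coefF k n (1 - l₂.length) l
      = sg k (inversions l + inversions l₁) • coefF k n (1 - l₂.length) l₁ := by
    rw [sg_add, mul_smul, ← coefF_perm hl (hl.nodup_iff.2 (List.nodup_append'.1 hnd).1)]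
    exact (sg_smul_sg_smul (M := infGen k) _ _).symm
  have e2 : coefF k n (1 - l₂.length) l₁ = sg k (inversions (l₁ ++ l₂) + cornorm n) •
      (infGen k).act n (1 - l₂.length) σ (stdCor k n l₂.length) := by
    rw [stdCor, map_smul, act_coefF, hσ₁, ← hσ, add_comm, sg_add, mul_smul, ← sgnk_eq_inversions,
      smul_comm (sgnk k σ), sign_smul_sign_smul (M := infGen k), sg_smul_sg_smul (M := infGen k)]
  have e3 : coefF k n (1 - l₂.length) l
      = sg k (inversions l + inversions l₁ + inversions (l₁ ++ l₂) + cornorm n) •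
      (infGen k).act n (1 - l₂.length) σ (stdCor k n l₂.length) := by
    rw [e1, e2, smul_smul, ← sg_add]
    congr 2
    ring
  rw [e3, ccls, cls_node_smul, cls_node_perm, koszulExp_eq_zero hch, sg_zero, one_smul,
    corolla_eq (stdCor k) (n := n) (p := l₂.length) _ _ (by simp [hlen]) (by simp)]
  congr 3
  funext i
  have e4 : l₁.map ch ++ l₂.map ch = (List.finRange n).map (ch ∘ σ) := by
    rw [← List.map_append, ← hσ, List.map_map]
  simp only [List.get_eq_getElem, e4]
  simp

/-- The trees with a given tree at the first input and leaves at the others. -/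
def starLeaves (k : Type u) [Field k] (β : Fin m → Fin n) (X : Tree (infGen k) (Fin n)) :
    Fin (m + 1) → Tree (infGen k) (Fin n) := Fin.cons X fun y => .leaf (β y)

/-- The upper vertex is the only subtree that may have nonzero degree, so permuting the inputs of
the lower vertex produces no Koszul sign and the signs of the two vertices simply add. -/
theorem ccls_twoV_coefF {β : Fin m → Fin n} {α : Fin m' → Fin n} {a b : ℤ}
    {l l₁ l₂ : List (Fin (m + 1))} (ha : a = 1 - l₂.length)
    (hl : l.Perm l₁) (hnd : (l₁ ++ l₂).Nodup) (hlen : l₁.length + l₂.length = m + 1)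
    {t t₁ t₂ : List (Fin m')} (hb : b = 1 - t₂.length)
    (ht : t.Perm t₁) (hnd' : (t₁ ++ t₂).Nodup) (hlen' : t₁.length + t₂.length = m') :
    let X := corolla (stdCor k) ((t₁.map α).map .leaf) ((t₂.map α).map .leaf)
    ccls (twoV β α (coefF k (m + 1) a l) (coefF k m' b t) .leaf)
      = sg k ((inversions l + inversions l₁ + inversions (l₁ ++ l₂) + cornorm (m + 1))
          + (inversions t + inversions t₁ + inversions (t₁ ++ t₂) + cornorm m')) •
        ccls (corolla (stdCor k) (l₁.map (starLeaves k β X)) (l₂.map (starLeaves k β X))) := by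
  intro X
  have h1 := ccls_coefF_node hb ht hnd' hlen' (fun x => (.leaf (α x) : Tree (infGen k) (Fin n)))
    (fun i j _ => by simp [Tree.deg])
  have h2 : ccls (corolla (stdCor k) (t₁.map fun x => (.leaf (α x) : Tree (infGen k) (Fin n)))
      (t₂.map fun x => .leaf (α x))) = ccls X := by
    simp only [X, List.map_map]
    rfl
  have h3 := ccls_coefF_node ha hl hnd hlen (starLeaves k β X) (fun i j hij => by
    cases i using Fin.cases with
    | zero =>
      cases j using Fin.cases with
      | zero => exact absurd rfl hij
      | succ j => simp [starLeaves, Tree.deg]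
    | succ i => simp [starLeaves, Tree.deg])
  rw [sg_add, mul_smul, smul_comm, ← h3, twoV, ccls_node_cons _ _ X, h1, h2, map_smul,
    ← ccls_node_cons _ _ X]
  rfl

end Corollas

/-! ### Terms with the upper corolla at a solid input. -/

section Terms

variable {k : Type u} [Field k] {m m' n p : ℕ}

theorem pre_map {B : Finset (Fin n)} (h : #B = m) (S : Finset (Fin n)) :
    (pre (B.orderEmbOfFin h) S).map (B.orderEmbOfFin h) = (S ∩ B).sort (· ≤ ·) := by
  have e : (univ.filter fun i => B.orderEmbOfFin h i ∈ S).map (B.orderEmbOfFin h).toEmbedding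
      = S ∩ B := by
    ext l
    simp only [mem_map, mem_filter, mem_univ, true_and, mem_inter]
    constructor
    · rintro ⟨i, hi, rfl⟩
      exact ⟨hi, B.orderEmbOfFin_mem h i⟩
    · rintro ⟨h1, h2⟩
      have : l ∈ Set.range (B.orderEmbOfFin h) := by rw [range_orderEmbOfFin]; exact h2
      obtain ⟨i, rfl⟩ := this
      exact ⟨i, h1, rfl⟩
  rw [← e, pre]
  exact map_sort (fun i j : Fin m => i ≤ j) (fun i j : Fin n => i ≤ j)
    (f := (B.orderEmbOfFin h).toEmbedding) (s := univ.filter fun i => B.orderEmbOfFin h i ∈ S)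
    fun a _ b _ => ((B.orderEmbOfFin h).le_iff_le (a := a) (b := b)).symm

theorem length_pre {B : Finset (Fin n)} (h : #B = m) (S : Finset (Fin n)) :
    (pre (B.orderEmbOfFin h) S).length = #(S ∩ B) := by
  rw [← length_sort (· ≤ ·), ← pre_map h, List.length_map]

theorem pre_eq_nil {B : Finset (Fin n)} (h : #B = m) (S : Finset (Fin n)) :
    pre (B.orderEmbOfFin h) S = [] ↔ ¬ (S ∩ B).Nonempty := by
  rw [← List.length_eq_zero_iff, length_pre, card_eq_zero, not_nonempty_iff_eq_empty]

theorem wavyInputs_eq (n p : ℕ) : wavyInputs n p = (solidInputs n p)ᶜ := by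
  ext i
  simp [wavyInputs, solidInputs]

theorem solid_lt_wavy {i j : Fin n} (hi : i ∈ solidInputs n p) (hj : j ∈ wavyInputs n p) : i < j := by
  simp only [solidInputs, wavyInputs, mem_filter, mem_univ, true_and] at hi hj
  exact Fin.lt_def.2 (by omega)

theorem solid_union_wavy : solidInputs n p ∪ wavyInputs n p = univ := by
  rw [wavyInputs_eq, union_compl]

theorem disjoint_solid_wavy : Disjoint (solidInputs n p) (wavyInputs n p) := by
  rw [wavyInputs_eq]
  exact disjoint_compl_right

theorem inter_union_inter (B : Finset (Fin n)) :
    (solidInputs n p ∩ B) ∪ (wavyInputs n p ∩ B) = B := by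
  rw [← union_inter_distrib_right, solid_union_wavy, univ_inter]

theorem disjoint_inter_inter (B : Finset (Fin n)) :
    Disjoint (solidInputs n p ∩ B) (wavyInputs n p ∩ B) :=
  disjoint_solid_wavy.mono inter_subset_left inter_subset_left

theorem card_inter_add_card_inter (B : Finset (Fin n)) :
    #(solidInputs n p ∩ B) + #(wavyInputs n p ∩ B) = #B := by
  rw [← card_union_of_disjoint (disjoint_inter_inter B), inter_union_inter]

theorem cross_solid_wavy {S T : Finset (Fin n)} (hS : S ⊆ solidInputs n p)
    (hT : T ⊆ wavyInputs n p) : cross S T = 0 :=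
  cross_eq_zero fun _ hi _ hj => solid_lt_wavy (hS hi) (hT hj)

theorem cross_wavy_solid {S T : Finset (Fin n)} (hS : S ⊆ wavyInputs n p)
    (hT : T ⊆ solidInputs n p) : cross S T = #S * #T :=
  cross_eq_mul fun _ hi _ hj => solid_lt_wavy (hT hj) (hS hi)

theorem unshuffleExp_one (A : Finset (Fin n)) : unshuffleExp (fun _ => 1) A = cross A Aᶜ := by
  simp [unshuffleExp, cross]

theorem nodup_sort_append_sort {S T : Finset (Fin n)} (h : Disjoint S T) :
    (S.sort (· ≤ ·) ++ T.sort (· ≤ ·)).Nodup := by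
  rw [List.nodup_append']
  refine ⟨sort_nodup _ _, sort_nodup _ _, fun a ha hb => ?_⟩
  rw [mem_sort] at ha hb
  exact disjoint_left.1 h ha hb

theorem sort_singleton_eq (w : Fin n) : ({w} : Finset (Fin n)).sort (· ≤ ·) = [w] :=
  sort_singleton _ w

theorem rootPhi_smul {L : Type} (β : Fin m → Fin n) (α : Fin m' → Fin n)
    (ch : Fin n → Tree (infGen k) L) {a b : ℤ} (c : k) (φ : (infGen k).X (m + 1) a)
    (ψ : (infGen k).X m' b) :
    rootPhi β α ch a b (c • φ) ψ = c • rootPhi β α ch a b φ ψ :=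
  congrArg (fun F => F ψ) (map_smul (rootPhi β α ch a b) c φ)

theorem map_starLeaves_succ (β : Fin m → Fin n) (X : Tree (infGen k) (Fin n)) (l : List (Fin m)) :
    (l.map Fin.succ).map (starLeaves k β X) = (l.map β).map .leaf := by
  rw [List.map_map, List.map_map]
  rfl

/-- All solid inputs precede all wavy ones, so of the two mixed contributions one vanishes and the
other is a product of cardinalities. -/
theorem cross_compl (A : Finset (Fin n)) :
    cross A Aᶜ = cross (solidInputs n p ∩ A) (solidInputs n p ∩ Aᶜ)
      + #(wavyInputs n p ∩ A) * #(solidInputs n p ∩ Aᶜ)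
      + cross (wavyInputs n p ∩ A) (wavyInputs n p ∩ Aᶜ) := by
  have hA := inter_union_inter (p := p) A
  have hAc := inter_union_inter (p := p) Aᶜ
  have h : cross A Aᶜ = cross ((solidInputs n p ∩ A) ∪ (wavyInputs n p ∩ A))
      ((solidInputs n p ∩ Aᶜ) ∪ (wavyInputs n p ∩ Aᶜ)) := by rw [hA, hAc]
  rw [h, cross_union_left (disjoint_inter_inter A),
    cross_union_right _ (disjoint_inter_inter Aᶜ), cross_union_right _ (disjoint_inter_inter Aᶜ),
    cross_solid_wavy (p := p) inter_subset_left inter_subset_left,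
    cross_wavy_solid (p := p) inter_subset_left inter_subset_left]
  ring

/-- The upper corolla has arity `#A`, the lower one `#Aᶜ + 1`. -/
theorem cornorm_split {A : Finset (Fin n)} (hA : 2 ≤ #A) :
    cornorm n = cornorm #A + cornorm (#Aᶜ + 1) + (#A - 1) * #Aᶜ := by
  have h := cornorm_add (#A - 1) #Aᶜ
  have h1 : #A - 1 + #Aᶜ + 1 = n := by
    have := card_add_card_compl A
    rw [Fintype.card_fin] at this
    omega
  rw [h1, show #A - 1 + 1 = #A by omega] at h
  rw [h]
  push_cast [show 1 ≤ #A by omega]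
  ring

/-- The term of the first sum that belongs to a set of inputs. -/
def solidTerm (k : Type u) [Field k] (n p : ℕ) (A : Finset (Fin n)) : CSpace k (Fin n) :=
  sg k (#(wavyInputs n p ∩ Aᶜ) + inversions ((wavyInputs n p ∩ A).sort (· ≤ ·)
      ++ (wavyInputs n p ∩ Aᶜ).sort (· ≤ ·))) •
    ccls (corolla (stdCor k) (leaves k (solidInputs n p ∩ Aᶜ)
      ++ [corolla (stdCor k) (leaves k (solidInputs n p ∩ A)) (leaves k (wavyInputs n p ∩ A))])
      (leaves k (wavyInputs n p ∩ Aᶜ)))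

/-- The term of the second sum that belongs to a set of inputs and its first wavy input. -/
def wavyTerm (k : Type u) [Field k] (n p : ℕ) (A : Finset (Fin n)) (w : Fin n) :
    CSpace k (Fin n) :=
  sg k (#((wavyInputs n p ∩ A).erase w) + #(wavyInputs n p ∩ Aᶜ)
      + inversions (({w} : Finset (Fin n)).sort (· ≤ ·) ++
        ((wavyInputs n p ∩ A).erase w).sort (· ≤ ·) ++ (wavyInputs n p ∩ Aᶜ).sort (· ≤ ·))) •
    ccls (corolla (stdCor k) (leaves k (solidInputs n p ∩ Aᶜ))
      (corolla (stdCor k) (leaves k (solidInputs n p ∩ A) ++ leaves k {w})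
        (leaves k ((wavyInputs n p ∩ A).erase w)) :: leaves k (wavyInputs n p ∩ Aᶜ)))

/-- All signs, from the differential, the cocomposition, the normalizations and the reordering into
corollas, are expressed by the sizes of the four parts of the inputs and their mutual inversions,
and compared modulo two. -/
theorem rootPhi_left {A : Finset (Fin n)} (hA : 2 ≤ #A) {a b : ℤ}
    (ha : a = 1 - #(wavyInputs n p ∩ Aᶜ)) (hb : b = 1 - #(wavyInputs n p ∩ A)) :
    let β := Aᶜ.orderEmbOfFin rfl
    let α := A.orderEmbOfFin rfl
    let l₁ := pre β (solidInputs n p)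
    let l₂ := pre α (solidInputs n p)
    rootPhi β α (.leaf : Fin n → Tree (infGen k) (Fin n)) a b
        (((sg k (cornorm n) * sg k (inversions (l₁.map β ++ l₂.map α))) * sg k l₁.length) •
          coefF k (#Aᶜ + 1) a (0 :: l₁.map Fin.succ)) (coefF k #A b l₂)
      = solidTerm k n p A := by
  intro β α l₁ l₂
  set I := solidInputs n p with hI
  set J := wavyInputs n p with hJ
  have hα := (A.orderEmbOfFin rfl).strictMono
  have hβ := (Aᶜ.orderEmbOfFin rfl).strictMono
  have dA := disjoint_inter_inter (p := p) A
  have dAc := disjoint_inter_inter (p := p) Aᶜ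
  have cA := card_inter_add_card_inter (p := p) A
  have cAc := card_inter_add_card_inter (p := p) Aᶜ
  have m1 : (l₁ ++ pre β J).map β = (I ∩ Aᶜ).sort (· ≤ ·) ++ (J ∩ Aᶜ).sort (· ≤ ·) := by
    rw [List.map_append, pre_map, pre_map]
  have m2 : (l₂ ++ pre α J).map α = (I ∩ A).sort (· ≤ ·) ++ (J ∩ A).sort (· ≤ ·) := by
    rw [List.map_append, pre_map, pre_map]
  have nd1 : (l₁ ++ pre β J).Nodup := (m1 ▸ nodup_sort_append_sort dAc : List.Nodup _).of_map _
  have nd2 : (l₂ ++ pre α J).Nodup := (m2 ▸ nodup_sort_append_sort dA : List.Nodup _).of_map _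
  have inv1 : (inversions (l₁ ++ pre β J) : ℤ) = 0 := by
    rw [← inversions_map hβ, m1, inversions_sort_append_sort]
    exact cross_solid_wavy (p := p) inter_subset_left inter_subset_left
  have inv2 : (inversions (l₂ ++ pre α J) : ℤ) = 0 := by
    rw [← inversions_map hα, m2, inversions_sort_append_sort]
    exact cross_solid_wavy (p := p) inter_subset_left inter_subset_left
  have len1 : l₁.length = #(I ∩ Aᶜ) := length_pre _ _
  have len1' : (pre β J).length = #(J ∩ Aᶜ) := length_pre _ _
  have len2 : l₂.length = #(I ∩ A) := length_pre _ _
  have len2' : (pre α J).length = #(J ∩ A) := length_pre _ _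
  have hX := ccls_twoV_coefF (k := k) (β := β) (α := α) (a := a) (b := b)
    -- In the coefficient form the glued input comes first, in the corolla it is the last solid
    -- input.
    (l := 0 :: l₁.map Fin.succ) (l₁ := l₁.map Fin.succ ++ [0]) (l₂ := (pre β J).map Fin.succ)
    (t := l₂) (t₁ := l₂) (t₂ := pre α J)
    (by rw [ha, List.length_map, len1']) (List.perm_append_singleton _ _).symm
    (by
      have : (l₁.map Fin.succ ++ [0] ++ (pre β J).map Fin.succ).Perm
          (0 :: (l₁ ++ pre β J).map Fin.succ) := by
        rw [List.map_append, List.append_assoc]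
        exact List.perm_middle
      rw [this.nodup_iff, List.nodup_cons]
      refine ⟨fun h0 => ?_, nd1.map (Fin.succ_injective _)⟩
      obtain ⟨i, -, hi⟩ := List.mem_map.1 h0
      exact Fin.succ_ne_zero i hi)
    (by rw [List.length_append, List.length_map, List.length_map, len1, len1', ← cAc]; simp; ring)
    (by rw [hb, len2']) (List.Perm.refl _) nd2 (by rw [len2, len2', cA])
  simp only at hX
  rw [rootPhi_smul, rootPhi_apply, hX, solidTerm, smul_smul, smul_smul]
  have hvec : ∀ X : Tree (infGen k) (Fin n),
      (l₁.map Fin.succ ++ [0]).map (starLeaves k β X) = leaves k (I ∩ Aᶜ) ++ [X] := fun X => by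
    rw [List.map_append, map_starLeaves_succ, pre_map]
    rfl
  rw [hvec, map_starLeaves_succ, pre_map, pre_map, pre_map, pre_map]
  refine congrArg (fun z : k => z • ccls (corolla (stdCor k) (leaves k (I ∩ Aᶜ)
    ++ [corolla (stdCor k) (leaves k (I ∩ A)) (leaves k (J ∩ A))]) (leaves k (J ∩ Aᶜ)))) ?_
  simp only [← sg_add]
  refine sg_congr k ?_
  have i1 : (inversions (0 :: l₁.map Fin.succ) : ℤ) = 0 := by
    have h1 := inversions_star ([] : List (Fin #Aᶜ)) l₁
    have h2 : inversions l₁ = 0 := inversions_sort _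
    rw [List.map_nil, List.nil_append] at h1
    rw [h1]
    simp [h2]
  have i2 : (inversions (l₁.map Fin.succ ++ [0]) : ℤ) = #(I ∩ Aᶜ) := by
    have h1 := inversions_star l₁ ([] : List (Fin #Aᶜ))
    have h2 : inversions l₁ = 0 := inversions_sort _
    rw [List.map_nil] at h1
    rw [h1, List.append_nil, h2, len1]
    simp
  have i3 : (inversions (l₁.map Fin.succ ++ [0] ++ (pre β J).map Fin.succ) : ℤ) = #(I ∩ Aᶜ) := by
    rw [List.append_assoc, List.singleton_append, inversions_star, Nat.cast_add, inv1, len1,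
      add_zero]
  have i4 : (inversions l₂ : ℤ) = 0 := by
    rw [show inversions l₂ = 0 from inversions_sort _]; rfl
  have hsh : shuffleExp (fun _ => 1) β α = cross A Aᶜ := by
    rw [← unshuffleExp_one, unshuffleExp_eq _ rfl rfl]
  have hsh' : shuffleExp (fun i => (Tree.leaf i : Tree (infGen k) (Fin n)).deg) β α = 0 := by
    simp [shuffleExp, Tree.deg]
  have hcc : cross A Aᶜ = cross (I ∩ A) (I ∩ Aᶜ) + #(J ∩ A) * #(I ∩ Aᶜ)
    + cross (J ∩ A) (J ∩ Aᶜ) := cross_compl A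
  rw [i1, i2, i3, i4, inv2, hsh, hsh', inversions_sort_append_sort,
    inversions_sort_append_sort, hcc, cornorm_split hA, ha, len1]
  -- The unshuffle counts inversions of solid inputs from `A` to its complement, the sorting of
  -- `l₁`, `l₂` those in the other direction; together they give a product of cardinalities.
  have hx := cross_add_cross (S := I ∩ A) (T := I ∩ Aᶜ)
    (disjoint_compl_right.mono inter_subset_right inter_subset_right)
  rw [← eq_sub_iff_add_eq] at hx
  rw [hx, ← cA, ← cAc]
  push_cast
  -- Half of the difference of the two exponents.
  refine ⟨cornorm (#(I ∩ A) + #(J ∩ A)) + cornorm (#(I ∩ Aᶜ) + #(J ∩ Aᶜ) + 1)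
    + (#(I ∩ A) + #(J ∩ A)) * #(I ∩ Aᶜ) + #(I ∩ Aᶜ) - #(J ∩ Aᶜ) + (#(I ∩ A) + #(J ∩ A)), ?_⟩
  ring

end Terms

/-! ### Terms with the upper corolla at a wavy input. -/

section WavyTerms

variable {k : Type u} [Field k] {m m' n p : ℕ}

/-- The same comparison of exponents. Here the glued input becomes the first wavy one, and `j`,
which heads the list of the coefficient form, must be moved behind the solid inputs of `A`. The
exponents now differ by an odd number, whence the minus sign. -/
theorem rootPhi_right {A : Finset (Fin n)} (hA : 2 ≤ #A) {a b : ℤ} {j : Fin #A}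
    (hj : A.orderEmbOfFin rfl j ∈ wavyInputs n p)
    (ha : a = - #(wavyInputs n p ∩ Aᶜ))
    (hb : b = 1 - #((wavyInputs n p ∩ A).erase (A.orderEmbOfFin rfl j))) :
    let β := Aᶜ.orderEmbOfFin rfl
    let α := A.orderEmbOfFin rfl
    let l₁ := pre β (solidInputs n p)
    let l₂ := pre α (solidInputs n p)
    rootPhi β α (.leaf : Fin n → Tree (infGen k) (Fin n)) a b
        ((sg k (cornorm n) * sg k (inversions (l₁.map β ++ l₂.map α))) •
          coefF k (#Aᶜ + 1) a (l₁.map Fin.succ)) (coefF k #A b (j :: l₂))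
      = - wavyTerm k n p A (α j) := by
  intro β α l₁ l₂
  set I := solidInputs n p with hI
  set J := wavyInputs n p with hJ
  set w : Fin n := α j with hw
  have hwA : w ∈ A := A.orderEmbOfFin_mem rfl j
  have hα := (A.orderEmbOfFin rfl).strictMono
  have hβ := (Aᶜ.orderEmbOfFin rfl).strictMono
  have dAc := disjoint_inter_inter (p := p) Aᶜ
  have cA : #(I ∩ A) + #(J ∩ A) = #A := card_inter_add_card_inter (p := p) A
  have cAc : #(I ∩ Aᶜ) + #(J ∩ Aᶜ) = #Aᶜ := card_inter_add_card_inter (p := p) Aᶜ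
  have hwJ : w ∈ J ∩ A := mem_inter.2 ⟨hj, hwA⟩
  have hE : J.erase w ∩ A = (J ∩ A).erase w := erase_inter _ _ _
  have cw : #((J ∩ A).erase w) + 1 = #(J ∩ A) := card_erase_add_one hwJ
  have hIw : ∀ i ∈ I ∩ A, i < w := fun i hi => solid_lt_wavy (mem_inter.1 hi).1 hj
  have dIw : Disjoint (I ∩ A) {w} := disjoint_singleton_right.2 fun h => (hIw w h).false
  have dE : Disjoint (I ∩ A ∪ {w}) ((J ∩ A).erase w) := by
    rw [disjoint_union_left]
    exact ⟨(disjoint_inter_inter (p := p) A).mono_right (erase_subset _ _),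
      disjoint_singleton_left.2 (notMem_erase _ _)⟩
  have m1 : (l₁ ++ pre β J).map β = (I ∩ Aᶜ).sort (· ≤ ·) ++ (J ∩ Aᶜ).sort (· ≤ ·) := by
    rw [List.map_append, pre_map, pre_map]
  have m2 : (l₂ ++ [j]).map α = (I ∩ A).sort (· ≤ ·) ++ ({w} : Finset (Fin n)).sort (· ≤ ·) := by
    rw [List.map_append, pre_map, sort_singleton_eq]
    rfl
  have m3 : (j :: l₂).map α = ({w} : Finset (Fin n)).sort (· ≤ ·) ++ (I ∩ A).sort (· ≤ ·) := by
    rw [List.map_cons, pre_map, sort_singleton_eq]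
    rfl
  have m4 : (l₂ ++ [j] ++ pre α (J.erase w)).map α = (I ∩ A).sort (· ≤ ·)
      ++ ({w} : Finset (Fin n)).sort (· ≤ ·) ++ ((J ∩ A).erase w).sort (· ≤ ·) := by
    rw [List.map_append, m2, pre_map, hE]
  have nd1 : (l₁ ++ pre β J).Nodup := (m1 ▸ nodup_sort_append_sort dAc : List.Nodup _).of_map _
  have nd2 : (l₂ ++ [j] ++ pre α (J.erase w)).Nodup := by
    refine List.Nodup.of_map α ?_
    rw [m4, List.nodup_append']
    refine ⟨nodup_sort_append_sort dIw, sort_nodup _ _, fun x hx hx' => ?_⟩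
    rw [List.mem_append, mem_sort, mem_sort, ← mem_union] at hx
    rw [mem_sort] at hx'
    exact disjoint_left.1 dE hx hx'
  have c1 : cross (I ∩ A) {w} = 0 := cross_eq_zero fun i hi j' hj' => by
    rw [mem_singleton] at hj'; exact hj' ▸ hIw i hi
  have inv1 : (inversions (l₁ ++ pre β J) : ℤ) = 0 := by
    rw [← inversions_map hβ, m1, inversions_sort_append_sort]
    exact cross_solid_wavy (p := p) inter_subset_left inter_subset_left
  have inv2 : (inversions (l₂ ++ [j] ++ pre α (J.erase w)) : ℤ)
      = cross {w} ((J ∩ A).erase w) := by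
    rw [← inversions_map hα, m4, inversions_sort_three _ _ _ dIw, c1, cross_union_left dIw,
      cross_solid_wavy (p := p) inter_subset_left ((erase_subset _ _).trans inter_subset_left)]
    ring
  have inv3 : (inversions (l₂ ++ [j]) : ℤ) = 0 := by
    rw [← inversions_map hα, m2, inversions_sort_append_sort, c1]
  have inv4 : (inversions (j :: l₂) : ℤ) = #(I ∩ A) := by
    rw [← inversions_map hα, m3, inversions_sort_append_sort,
      cross_eq_mul fun i hi j' hj' => by rw [mem_singleton] at hi; exact hi ▸ hIw j' hj']
    simp
  have len1 : l₁.length = #(I ∩ Aᶜ) := length_pre _ _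
  have len1' : (pre β J).length = #(J ∩ Aᶜ) := length_pre _ _
  have len2 : l₂.length = #(I ∩ A) := length_pre _ _
  have len2' : (pre α (J.erase w)).length = #((J ∩ A).erase w) := by rw [length_pre, hE]
  have hX := ccls_twoV_coefF (k := k) (β := β) (α := α) (a := a) (b := b)
    (l := l₁.map Fin.succ) (l₁ := l₁.map Fin.succ) (l₂ := 0 :: (pre β J).map Fin.succ)
    (t := j :: l₂) (t₁ := l₂ ++ [j]) (t₂ := pre α (J.erase w))
    (by rw [ha, List.length_cons, List.length_map, len1']; push_cast; ring) (List.Perm.refl _)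
    (by
      have : (l₁.map Fin.succ ++ 0 :: (pre β J).map Fin.succ).Perm
          (0 :: (l₁ ++ pre β J).map Fin.succ) := by
        rw [List.map_append]
        exact List.perm_middle
      rw [this.nodup_iff, List.nodup_cons]
      refine ⟨fun h0 => ?_, nd1.map (Fin.succ_injective _)⟩
      obtain ⟨i, -, hi⟩ := List.mem_map.1 h0
      exact Fin.succ_ne_zero i hi)
    (by rw [List.length_cons, List.length_map, List.length_map, len1, len1', ← cAc]; ring)
    (by rw [hb, len2']) (List.perm_append_singleton _ _).symm nd2
    (by rw [List.length_append, len2, len2', List.length_singleton]; omega)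
  simp only at hX
  have hleaf : ((l₂ ++ [j]).map α).map (.leaf : Fin n → Tree (infGen k) (Fin n))
      = leaves k (I ∩ A) ++ leaves k {w} := by rw [m2, List.map_append]; rfl
  have hleaf' : ((pre α (J.erase w)).map α).map (.leaf : Fin n → Tree (infGen k) (Fin n))
      = leaves k ((J ∩ A).erase w) := by rw [pre_map, hE]; rfl
  have hvec : ∀ X : Tree (infGen k) (Fin n),
      (0 :: (pre β J).map Fin.succ).map (starLeaves k β X) = X :: leaves k (J ∩ Aᶜ) := fun X => by
    rw [List.map_cons, map_starLeaves_succ, pre_map]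
    rfl
  rw [rootPhi_smul, rootPhi_apply, hX, hleaf, hleaf', hvec, map_starLeaves_succ, pre_map, pre_map,
    wavyTerm, smul_smul, smul_smul, ← neg_smul]
  refine congrArg (fun z : k => z • ccls (corolla (stdCor k) (leaves k (I ∩ Aᶜ))
    (corolla (stdCor k) (leaves k (I ∩ A) ++ leaves k {w})
        (leaves k ((J ∩ A).erase w)) :: leaves k (J ∩ Aᶜ)))) ?_
  rw [← sg_add_one]
  simp only [← sg_add]
  refine sg_congr k ?_
  have i2 : (inversions (l₁.map (Fin.succ (n := #Aᶜ))) : ℤ) = 0 := by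
    rw [inversions_map Fin.strictMono_succ, show inversions l₁ = 0 from inversions_sort _]; rfl
  have i3 : (inversions (l₁.map Fin.succ ++ 0 :: (pre β J).map Fin.succ) : ℤ) = #(I ∩ Aᶜ) := by
    rw [inversions_star, Nat.cast_add, inv1, len1, add_zero]
  have hsh : shuffleExp (fun _ => 1) β α = cross A Aᶜ := by
    rw [← unshuffleExp_one, unshuffleExp_eq _ rfl rfl]
  have hsh' : shuffleExp (fun i => (Tree.leaf i : Tree (infGen k) (Fin n)).deg) β α = 0 := by
    simp [shuffleExp, Tree.deg]
  have hcc : cross A Aᶜ = cross (I ∩ A) (I ∩ Aᶜ) + #(J ∩ A) * #(I ∩ Aᶜ)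
    + cross (J ∩ A) (J ∩ Aᶜ) := cross_compl A
  have dwE : Disjoint {w} ((J ∩ A).erase w) := disjoint_singleton_left.2 (notMem_erase _ _)
  have huw : {w} ∪ (J ∩ A).erase w = J ∩ A := by
    rw [← insert_eq, insert_erase hwJ]
  rw [i2, i3, inv2, inv3, inv4, hsh, hsh', inversions_sort_append_sort,
    inversions_sort_three _ _ _ dwE, huw, hcc, cornorm_split hA, ha]
  have hx := cross_add_cross (S := I ∩ A) (T := I ∩ Aᶜ)
    (disjoint_compl_right.mono inter_subset_right inter_subset_right)
  rw [← eq_sub_iff_add_eq] at hx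
  rw [hx, ← cA, ← cAc, ← cw]
  push_cast
  generalize cornorm (#(I ∩ A) + (#((J ∩ A).erase w) + 1)) = x1
  generalize cornorm (#(I ∩ Aᶜ) + #(J ∩ Aᶜ) + 1) = x2
  generalize (#((J ∩ A).erase w) : ℤ) = j2
  generalize (#(I ∩ A) : ℤ) = i2
  generalize (#(I ∩ Aᶜ) : ℤ) = i1
  generalize (#(J ∩ Aᶜ) : ℤ) = j3
  refine ⟨x1 + x2 + (i2 + j2 + 1) * i1 - j3 + i2, ?_⟩
  ring

end WavyTerms

/-! ### The differential of a corolla, by subsets of its inputs. -/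

section RootCorolla

variable {k : Type u} [Field k] {m m' n p : ℕ}

theorem stdList_eq (n p : ℕ) : stdList n p = (solidInputs n p).sort (· ≤ ·) := by
  have h1 : (stdList n p).Pairwise (· ≤ ·) :=
    (List.pairwise_le_finRange n).sublist (List.take_sublist _ _)
  refine List.Perm.eq_of_pairwise (le := (· ≤ ·)) (fun a b _ _ => le_antisymm) h1
    (pairwise_sort _ _) ?_
  refine (List.perm_ext_iff_of_nodup (stdList_nodup _ _) (sort_nodup _ _)).2 fun i => ?_
  rw [mem_stdList, mem_sort, solidInputs, mem_filter]
  simp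

theorem card_solidInputs (n p : ℕ) : #(solidInputs n p) = n - p := by
  rw [← length_sort (· ≤ ·), ← stdList_eq, length_stdList]

theorem card_wavyInputs (hp : p < n) : #(wavyInputs n p) = p := by
  have h := card_inter_add_card_inter (p := p) (univ : Finset (Fin n))
  rw [inter_univ, inter_univ, card_solidInputs, card_univ, Fintype.card_fin] at h
  omega

theorem finRange_eq (n p : ℕ) : (solidInputs n p).sort (· ≤ ·) ++ (wavyInputs n p).sort (· ≤ ·)
    = List.finRange n := by
  refine List.Perm.eq_of_pairwise (le := (· ≤ ·)) (fun a b _ _ => le_antisymm) ?_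
    (List.pairwise_le_finRange n) ?_
  · rw [List.pairwise_append]
    refine ⟨pairwise_sort _ _, pairwise_sort _ _, fun a ha b hb => ?_⟩
    rw [mem_sort] at ha hb
    exact (solid_lt_wavy ha hb).le
  · refine (List.perm_ext_iff_of_nodup (nodup_sort_append_sort disjoint_solid_wavy)
      (List.nodup_finRange _)).2 fun i => ?_
    rw [List.mem_append, mem_sort, mem_sort, ← mem_union, solid_union_wavy]
    simp

theorem corolla_leaves (hp : p < n) : corolla (stdCor k) (leaves k (solidInputs n p))
    (leaves k (wavyInputs n p)) = .node n (1 - p) (stdCor k n p) .leaf := by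
  rw [corolla_eq (stdCor k) (n := n) (p := p)]
  · congr 1
    funext i
    have e : leaves k (solidInputs n p) ++ leaves k (wavyInputs n p)
        = (List.finRange n).map .leaf := by
      rw [leaves, leaves, ← List.map_append, finRange_eq]
    simp only [List.get_eq_getElem, e]
    simp
  · rw [leaves, leaves, ← List.map_append, finRange_eq]
    simp
  · rw [leaves, List.length_map, length_sort, card_wavyInputs hp]

/-- All subtrees are leaves, whose differential is zero, so only the root contributes. -/
theorem cobarD_corolla (hp : p < n) : cobarD k (Fin n) (ccls (corolla (stdCor k)
    (leaves k (solidInputs n p)) (leaves k (wavyInputs n p)))) = root (stdCor k n p) .leaf := by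
  rw [corolla_leaves hp, cobarD_cls, dTree_node, sum_eq_zero, add_zero]
  intro i _
  rw [dTree, map_zero, smul_zero]

theorem sum_coTensLeft (r : k) {A : Finset (Fin n)} (hA : 2 ≤ #A) :
    let β := Aᶜ.orderEmbOfFin rfl
    let α := A.orderEmbOfFin rfl
    let l₁ := pre β (solidInputs n p)
    let l₂ := pre α (solidInputs n p)
    r = sg k (cornorm n) * sg k (inversions (l₁.map β ++ l₂.map α)) →
    ((coTensLeft r l₁ l₂).map fun s => rootPhi β α (.leaf : Fin n → Tree (infGen k) (Fin n))
      s.1 s.2.1 s.2.2.1 s.2.2.2).sum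
      = if (solidInputs n p ∩ A).Nonempty then solidTerm k n p A else 0 := by
  intro β α l₁ l₂ hr
  have len1 : l₁.length = #(solidInputs n p ∩ Aᶜ) := length_pre _ _
  have len2 : l₂.length = #(solidInputs n p ∩ A) := length_pre _ _
  have cA := card_inter_add_card_inter (p := p) A
  have cAc := card_inter_add_card_inter (p := p) Aᶜ
  rw [coTensLeft]
  by_cases h : (solidInputs n p ∩ A).Nonempty
  · rw [if_neg (by rw [pre_eq_nil]; exact not_not.2 h), if_pos h, List.map_singleton,
      List.sum_singleton, hr]
    have ha : 1 + (l₁.length : ℤ) - #Aᶜ = 1 - #(wavyInputs n p ∩ Aᶜ) := by omega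
    have hb : 1 + (l₂.length : ℤ) - #A = 1 - #(wavyInputs n p ∩ A) := by omega
    exact rootPhi_left hA ha hb
  · rw [if_pos ((pre_eq_nil _ _).2 h), if_neg h]
    rfl

theorem sum_coTensRight (r : k) {A : Finset (Fin n)} (hA : 2 ≤ #A) :
    let β := Aᶜ.orderEmbOfFin rfl
    let α := A.orderEmbOfFin rfl
    let l₁ := pre β (solidInputs n p)
    let l₂ := pre α (solidInputs n p)
    r = sg k (cornorm n) * sg k (inversions (l₁.map β ++ l₂.map α)) →
    ((coTensRight r l₁ l₂).map fun s => rootPhi β α (.leaf : Fin n → Tree (infGen k) (Fin n))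
      s.1 s.2.1 s.2.2.1 s.2.2.2).sum
      = if (solidInputs n p ∩ Aᶜ).Nonempty then
        ∑ w ∈ wavyInputs n p ∩ A, - wavyTerm k n p A w else 0 := by
  intro β α l₁ l₂ hr
  have len1 : l₁.length = #(solidInputs n p ∩ Aᶜ) := length_pre _ _
  have len2 : l₂.length = #(solidInputs n p ∩ A) := length_pre _ _
  have cA := card_inter_add_card_inter (p := p) A
  have cAc := card_inter_add_card_inter (p := p) Aᶜ
  -- The index that becomes solid in the upper corolla runs over the wavy inputs in `A`.
  have hmem : ∀ j, j ∉ l₂ ↔ α j ∈ wavyInputs n p ∩ A := fun j => by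
    rw [mem_pre, mem_inter, wavyInputs_eq, mem_compl]
    exact ⟨fun h => ⟨h, A.orderEmbOfFin_mem rfl j⟩, fun h => h.1⟩
  rw [coTensRight]
  by_cases h : (solidInputs n p ∩ Aᶜ).Nonempty
  · rw [if_neg (by rw [pre_eq_nil]; exact not_not.2 h), if_pos h, List.map_map,
      ← List.sum_toFinset _ ((List.nodup_finRange _).filter _)]
    refine sum_bij (fun j _ => α j) ?_ (fun _ _ _ _ e => α.injective e) ?_ ?_
    · intro j hj
      exact (hmem j).1 (by simpa using hj)
    · intro w hw
      have : w ∈ Set.range α := by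
        rw [range_orderEmbOfFin]
        exact (mem_inter.1 hw).2
      obtain ⟨j, rfl⟩ := this
      exact ⟨j, by simpa using (hmem j).2 hw, rfl⟩
    · intro j hj
      have hj' := (hmem j).1 (by simpa using hj)
      have := card_erase_add_one hj'
      have ha : (l₁.length : ℤ) - #Aᶜ = - #(wavyInputs n p ∩ Aᶜ) := by omega
      have hb : 2 + (l₂.length : ℤ) - #A = 1 - #((wavyInputs n p ∩ A).erase (α j)) := by omega
      rw [hr]
      exact rootPhi_right hA (mem_inter.1 hj').1 ha hb
  · rw [if_pos ((pre_eq_nil _ _).2 h), if_neg h]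
    rfl

theorem rootTerm_stdCor (hp : p < n) {A : Finset (Fin n)} (hA : 2 ≤ #A) (hA' : #A < n) :
    rootTerm (stdCor k n p) (Aᶜ.orderEmbOfFin rfl) (A.orderEmbOfFin rfl) .leaf
      = (if (solidInputs n p ∩ A).Nonempty then solidTerm k n p A else 0)
        + if (solidInputs n p ∩ Aᶜ).Nonempty then
          ∑ w ∈ wavyInputs n p ∩ A, - wavyTerm k n p A w else 0 := by
  have hc := (isCoc_coefF_sort (k := k) (d := 1 - p) (shuffle_orderEmb (A := A) rfl rfl)
    (one_le_card_compl hA') hA (I := solidInputs n p)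
    (by rw [card_solidInputs]; omega) (sg k (cornorm n))).1
  rw [stdCor, stdList_eq, rootTerm, ← coSum_eq (one_le_card_compl hA') hA hc, List.map_append,
    List.sum_append, sum_coTensLeft _ hA rfl, sum_coTensRight _ hA rfl]

end RootCorolla

/-! ### From subsets of the inputs to the sums over solid and wavy parts. -/

section Reindexing

variable {k : Type u} [Field k] {n p : ℕ}

theorem union_inter_of {I I₁ I₂ J J₁ J₂ : Finset (Fin n)} (hIJ : Disjoint I J)
    (hI : Disjoint I₁ I₂) (hI' : I₁ ∪ I₂ = I) (hJ : Disjoint J₁ J₂) (hJ' : J₁ ∪ J₂ = J) :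
    I ∩ (I₂ ∪ J₁) = I₂ ∧ J ∩ (I₂ ∪ J₁) = J₁ := by
  subst hI' hJ'
  rw [disjoint_left] at *
  constructor <;> ext i <;> have h1 := @hIJ i <;> have h2 := @hI i <;> have h3 := @hJ i <;>
    simp only [mem_union, mem_inter] at * <;> tauto

theorem inter_compl_of {I I₁ I₂ A : Finset (Fin n)} (hI : Disjoint I₁ I₂) (hI' : I₁ ∪ I₂ = I)
    (h : I ∩ A = I₂) : I ∩ Aᶜ = I₁ := by
  rw [← sdiff_eq_inter_compl, ← sdiff_inter_self_left, h, ← hI', union_sdiff_cancel_right hI]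

theorem disjoint_inter_compl (I A : Finset (Fin n)) : Disjoint (I ∩ A) (I ∩ Aᶜ) :=
  disjoint_compl_right.mono inter_subset_right inter_subset_right

theorem inter_union_inter_compl (I A : Finset (Fin n)) : (I ∩ A) ∪ (I ∩ Aᶜ) = I := by
  rw [← inter_union_distrib_left, union_compl, inter_univ]

/-- The inputs of the upper corolla are `A = I₂ ∪ J₁`. The bounds on `#A` become the conditions on
`I₁`, `J₂` and on `I₂`, `J₁`, and the term survives only if `I₂` is nonempty. -/
theorem sum_solidTerm : ∑ A : Finset (Fin n) with 2 ≤ #A ∧ #A < n,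
    (if (solidInputs n p ∩ A).Nonempty then solidTerm k n p A else 0)
      = firstSum (stdCor k) n p := by
  rw [firstSum, ← sum_filter, filter_filter]
  refine sum_bij' (fun A _ => ((solidInputs n p ∩ Aᶜ, solidInputs n p ∩ A),
      (wavyInputs n p ∩ A, wavyInputs n p ∩ Aᶜ))) (fun x _ => x.1.2 ∪ x.2.1) ?_ ?_ ?_ ?_ ?_
  · intro A hA
    simp only [mem_filter, mem_univ, true_and] at hA ⊢
    have cA := card_inter_add_card_inter (p := p) A
    have cAc := card_inter_add_card_inter (p := p) Aᶜ
    have := one_le_card_compl hA.1.2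
    refine ⟨⟨(disjoint_inter_compl _ _).symm, ?_⟩, ⟨disjoint_inter_compl _ _,
      inter_union_inter_compl _ _⟩, card_pos.2 hA.2, by omega, by omega⟩
    rw [union_comm, inter_union_inter_compl]
  · rintro ⟨⟨I₁, I₂⟩, J₁, J₂⟩ hx
    simp only [mem_filter, mem_univ, true_and] at hx ⊢
    obtain ⟨⟨h1, h2⟩, ⟨h3, h4⟩, h5, h6, h7⟩ := hx
    obtain ⟨e1, e2⟩ := union_inter_of disjoint_solid_wavy h1 h2 h3 h4
    have e3 := inter_compl_of h1 h2 e1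
    have e4 := inter_compl_of h3.symm (by rw [union_comm, h4]) e2
    have cA := card_inter_add_card_inter (p := p) (I₂ ∪ J₁)
    have cAc := card_inter_add_card_inter (p := p) (I₂ ∪ J₁)ᶜ
    have cc := card_add_card_compl (I₂ ∪ J₁)
    rw [Fintype.card_fin] at cc
    rw [e1, e2] at cA
    rw [e3, e4] at cAc
    exact ⟨⟨by omega, by omega⟩, by rw [e1]; exact card_pos.1 h5⟩
  · intro A hA
    exact inter_union_inter A
  · rintro ⟨⟨I₁, I₂⟩, J₁, J₂⟩ hx
    simp only [mem_filter, mem_univ, true_and] at hx ⊢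
    obtain ⟨⟨h1, h2⟩, ⟨h3, h4⟩, -⟩ := hx
    obtain ⟨e1, e2⟩ := union_inter_of disjoint_solid_wavy h1 h2 h3 h4
    rw [e1, e2, inter_compl_of h1 h2 e1, inter_compl_of h3.symm (by rw [union_comm, h4]) e2]
  · intro A _
    rfl

/-- Pairs of a set `A` and a wavy `w ∈ A` correspond to `J₁ = {w}` and `A = I₂ ∪ J₁ ∪ J₂`.
Nonemptiness of `I₁` already forces `#A < n`, and `2 ≤ #A` says that `I₂` or `J₂` is nonempty. -/
theorem sum_wavyTerm : ∑ A : Finset (Fin n) with 2 ≤ #A ∧ #A < n,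
    (if (solidInputs n p ∩ Aᶜ).Nonempty then ∑ w ∈ wavyInputs n p ∩ A, wavyTerm k n p A w else 0)
      = secondSum (stdCor k) n p := by
  rw [secondSum, ← sum_filter, filter_filter, sum_sigma']
  refine sum_bij (fun x _ => ((solidInputs n p ∩ x.1ᶜ, solidInputs n p ∩ x.1),
      ({x.2}, (wavyInputs n p ∩ x.1).erase x.2, wavyInputs n p ∩ x.1ᶜ))) ?_ ?_ ?_ ?_
  · rintro ⟨A, w⟩ hA
    simp only [mem_filter, mem_univ, true_and, mem_sigma] at hA ⊢
    obtain ⟨⟨⟨h1, h2⟩, h3⟩, h4⟩ := hA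
    have cA := card_inter_add_card_inter (p := p) A
    have cw := card_erase_add_one h4
    refine ⟨⟨(disjoint_inter_compl _ _).symm, ?_⟩, ⟨disjoint_singleton_left.2 (notMem_erase _ _),
      disjoint_singleton_left.2 fun h => disjoint_left.1 (disjoint_inter_compl _ _) h4 h,
      (disjoint_inter_compl _ _).mono_left (erase_subset _ _), ?_⟩, card_pos.2 h3,
      card_singleton _, by omega⟩
    · rw [union_comm, inter_union_inter_compl]
    · rw [← insert_eq, insert_erase h4, inter_union_inter_compl]
  · rintro ⟨A, w⟩ hA ⟨B, v⟩ hB e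
    simp only [mem_filter, mem_univ, true_and, mem_sigma] at hA hB
    simp only [Prod.mk.injEq, singleton_inj] at e
    obtain ⟨⟨-, e1⟩, rfl, e2, -⟩ := e
    have e3 : wavyInputs n p ∩ A = wavyInputs n p ∩ B := by
      rw [← insert_erase hA.2, e2, insert_erase hB.2]
    have : A = B := by rw [← inter_union_inter (p := p) A, e1, e3, inter_union_inter]
    rw [this]
  · rintro ⟨⟨I₁, I₂⟩, J₁, J₂, J₃⟩ hx
    simp only [mem_filter, mem_univ, true_and] at hx
    obtain ⟨⟨h1, h2⟩, ⟨h3, h4, h5, h6⟩, h7, h8, h9⟩ := hx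
    obtain ⟨w, rfl⟩ := card_eq_one.1 h8
    obtain ⟨e1, e2⟩ := union_inter_of disjoint_solid_wavy h1 h2 (disjoint_union_left.2 ⟨h4, h5⟩) h6
    have e3 := inter_compl_of h1 h2 e1
    have e4 := inter_compl_of (disjoint_union_left.2 ⟨h4, h5⟩).symm (by rw [union_comm, h6]) e2
    have e5 : ({w} ∪ J₂).erase w = J₂ := by
      rw [← insert_eq, erase_insert (disjoint_singleton_left.1 h3)]
    have cA := card_inter_add_card_inter (p := p) (I₂ ∪ ({w} ∪ J₂))
    have cAc := card_inter_add_card_inter (p := p) (I₂ ∪ ({w} ∪ J₂))ᶜ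
    have cc := card_add_card_compl (I₂ ∪ ({w} ∪ J₂))
    rw [Fintype.card_fin] at cc
    rw [e1, e2, card_union_of_disjoint h3, card_singleton] at cA
    rw [e3, e4] at cAc
    refine ⟨⟨I₂ ∪ ({w} ∪ J₂), w⟩, ?_, ?_⟩
    · simp only [mem_filter, mem_univ, true_and, mem_sigma]
      refine ⟨⟨⟨by omega, by omega⟩, by rw [e3]; exact card_pos.1 h7⟩, ?_⟩
      rw [e2]
      simp
    · simp only [e1, e2, e3, e4, e5]
  · rintro ⟨A, w⟩ _
    rfl

theorem root_stdCor (hp : p < n) : root (stdCor k n p) (.leaf : Fin n → Tree (infGen k) (Fin n))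
    = firstSum (stdCor k) n p - secondSum (stdCor k) n p := by
  rw [← sum_solidTerm, ← sum_wavyTerm, ← sum_sub_distrib, root]
  refine sum_congr rfl fun A hA => ?_
  simp only [mem_filter, mem_univ, true_and] at hA
  rw [rootTerm_stdCor hp hA.1 hA.2, sub_eq_add_neg]
  congr 1
  split_ifs
  · exact sum_neg_distrib _
  · exact neg_zero.symm

end Reindexing

end PreLieTwo

end

theorem proposition3p6p1 (k : Type u) [Field k] :
    ∃ D : ∀ n : ℕ, (PreLieTwo.dualPreLieTwo k).CobarSpace (Fin n) →ₗ[k]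
        (PreLieTwo.dualPreLieTwo k).CobarSpace (Fin n),
      (∀ n, (PreLieTwo.dualPreLieTwo k).IsCobarDifferential (D n)) ∧
      ∃ c : ∀ n p : ℕ, (PreLieTwo.infGen k).X n (1 - p),
        PreLieTwo.IsCorollas c ∧
        ∀ n p : ℕ, 2 ≤ n → p < n →
          D n (PreLieTwo.cls _ (PreLieTwo.corolla c
              (PreLieTwo.leaves k (PreLieTwo.solidInputs n p))
              (PreLieTwo.leaves k (PreLieTwo.wavyInputs n p))))
            = PreLieTwo.firstSum c n p - PreLieTwo.secondSum c n p :=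
  ⟨fun n => PreLieTwo.cobarD k (Fin n), fun _ => PreLieTwo.isCobarDifferential_cobarD,
    PreLieTwo.stdCor k, PreLieTwo.isCorollas_stdCor, fun _ _ _ hp =>
      (PreLieTwo.cobarD_corolla hp).trans (PreLieTwo.root_stdCor hp)⟩
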